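/- All graphs are finite, simple and undirected; $d(v)$ is the degree of $v$ in the input graph $G=(V,E)$. A randomized algorithm for the maximum independent set problem (MIS) has canonical recoverable value $\rho$ if on every graph $G$ it always outputs an independent set, and the expected size of its output is at least $$\max_I \sum_{v\in I}\min\Bigl[1,\frac{\rho}{d(v)+1}\Bigr],$$ where $I$ ranges over all independent sets of $G$. Consider the following algorithm. 1. (Elimination.) Repeat as long as possible on the current graph: if a vertex $u$ has degree $0$, take $u$ and delete it; if a vertex $u$ has degree $1$, take $u$ and delete $u$ and its neighbour; if the minimum degree is $2$ and $u$ is a vertex of degree $2$ with neighbours $v,w$, apply 2-elimination: when $v,w$ are adjacent, take $u$ and delete $u,v,w$; when they are not adjacent, delete $u$ and merge $v,w$ into one vertex $u'$ adjacent to all other neighbours of $v$ and of $w$; in the end, if $u'$ belongs to the independent set found in the smaller graph, replace it by $v$ and $w$, and otherwise add $u$ to that set. The graph $H$ that remains has minimum degree at least $3$ (or is empty). 2. (PLG with $G_4$.) Draw a uniformly random ordering of the vertices of $H$ and let $G_4$ be the subgraph of $H$ induced on the vertices that have at most three neighbours in $H$ before them in the ordering. Take a half-integral optimal solution of the linear program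 $\max\sum_i x_i$ subject to $x_i+x_j\le 1$ for every edge $ij$ of $G_4$ and $0\le x_i\le 1$. Take the vertices with $x_i=1$, discard those with $x_i=0$, and on the subgraph induced on the vertices with $x_i=\frac12$ run the greedy algorithm (repeatedly take a vertex of minimum degree and delete it and its neighbours). **Statement.** The canonical recoverable value $\rho=20/9$ is achievable for MIS in randomized polynomial time by this algorithm: however the choices that the description leaves open are made (which vertex is eliminated, which half-integral optimum is used, ties in greedy), the output is always an independent set, and its expected size is at least $\max_I\sum_{v\in I}\min[1,\frac{20/9}{d(v)+1}]$; and the algorithm, with suitable such choices, is implemented by a single randomized program (which may draw uniformly random elements of lists) whose number of steps on every $n$-vertex graph is, for all outcomes of its random draws, at most a fixed polynomial in $n$. -/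

import Mathlib

/-! ### Randomized programs and their running time

The machine model is the textbook WHILE language over binary trees (LISP data), extended by an
instruction that draws a uniformly random element of a list.  A program is a finite object; its
running time is the number of elementary steps of a small-step semantics. -/

/-- Binary trees, the data that programs work on. -/
inductive Data : Type
  | nil : Data
  | cons : Data → Data → Data

namespace Data

/-- The list of trees that a tree represents (`nil` is the empty list, `cons a l` is `a :: l`). -/
def toList : Data → List Data
  | nil => []
  | cons a l => a :: l.toList

/-- The tree that represents a list of trees. -/
def ofList : List Data → Data
  | [] => nil
  | a :: l => cons a (ofList l)

/-- Truth values: `nil` is false, every other tree counts as true. -/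
def ofBool : Bool → Data
  | false => nil
  | true => cons nil nil

/-- A uniformly random entry of the list represented by a tree (`nil` for the empty list). -/
noncomputable def pick : Data → PMF Data
  | nil => PMF.pure nil
  | cons a l =>
      (PMF.uniformOfFintype (Fin (l.toList.length + 1))).map fun i => (a :: l.toList).get i

end Data

/-- Memory contents: the values of the variables `0, 1, 2, …`. -/
abbrev Store : Type := ℕ → Data

/-- Expressions. -/
inductive Expr : Type
  | var : ℕ → Expr
  | nil : Expr
  | cons : Expr → Expr → Expr
  | hd : Expr → Expr
  | tl : Expr → Expr

/-- Value of an expression; the head and the tail of `nil` are `nil`. -/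
def Expr.eval (σ : Store) : Expr → Data
  | var i => σ i
  | nil => Data.nil
  | cons a b => Data.cons (a.eval σ) (b.eval σ)
  | hd a => match a.eval σ with
      | Data.nil => Data.nil
      | Data.cons x _ => x
  | tl a => match a.eval σ with
      | Data.nil => Data.nil
      | Data.cons _ y => y

/-- Commands, which are also the programs. `choose i e` assigns to the variable `i` a uniformly
random entry of the list that is the value of `e`. -/
inductive Cmd : Type
  | assign : ℕ → Expr → Cmd
  | seq : Cmd → Cmd → Cmd
  | cond : Expr → Cmd → Cmd → Cmd
  | loop : Expr → Cmd → Cmd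
  | choose : ℕ → Expr → Cmd

/-- A configuration: the commands still to be executed, and the memory. -/
abbrev Config : Type := List Cmd × Store

/-- One elementary step. A configuration with nothing left to execute has halted. -/
noncomputable def Config.step : Config → PMF Config
  | ([], σ) => PMF.pure ([], σ)
  | (Cmd.assign i e :: k, σ) => PMF.pure (k, Function.update σ i (e.eval σ))
  | (Cmd.seq c d :: k, σ) => PMF.pure (c :: d :: k, σ)
  | (Cmd.cond e c d :: k, σ) => match e.eval σ with
      | Data.nil => PMF.pure (d :: k, σ)
      | Data.cons _ _ => PMF.pure (c :: k, σ)
  | (Cmd.loop e c :: k, σ) => match e.eval σ with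
      | Data.nil => PMF.pure (k, σ)
      | Data.cons _ _ => PMF.pure (c :: Cmd.loop e c :: k, σ)
  | (Cmd.choose i e :: k, σ) =>
      ((e.eval σ).pick).map fun d => (k, Function.update σ i d)

/-- The random configuration reached after a number of steps. -/
noncomputable def Config.run : ℕ → Config → PMF Config
  | 0, c => PMF.pure c
  | t + 1, c => c.step.bind (Config.run t)

/-- Initially the variable `0` holds the input and all other variables hold `nil`. -/
def Cmd.start (P : Cmd) (x : Data) : Config :=
  ([P], fun i => if i = 0 then x else Data.nil)

/-- On input `x` the program `P` halts after at most `t` steps, whatever its random draws are, and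
its output, the final value of the variable `0`, has the law `μ`. -/
def Cmd.HaltsWithLaw (P : Cmd) (x : Data) (t : ℕ) (μ : PMF Data) : Prop :=
  (∀ c ∈ (Config.run t (P.start x)).support, c.1 = []) ∧
    (Config.run t (P.start x)).map (fun c => c.2 0) = μ

open Classical in
/-- A graph is given to a program by its adjacency matrix, as a list of rows. -/
noncomputable def encodeGraph {n : ℕ} (G : SimpleGraph (Fin n)) : Data :=
  Data.ofList (List.ofFn fun i : Fin n =>
    Data.ofList (List.ofFn fun j : Fin n => Data.ofBool (decide (G.Adj i j))))

/-- A set of vertices is returned by a program as its characteristic vector. -/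
def encodeSet {n : ℕ} (J : Finset (Fin n)) : Data :=
  Data.ofList (List.ofFn fun i : Fin n => Data.ofBool (decide (i ∈ J)))

/-! ### Recoverable value -/

open Classical in
/-- The canonical recoverable value of a vertex set: the sum of `min (1, ρ / (d(v) + 1))`. -/
noncomputable def canonicalValue {V : Type*} [Fintype V] (ρ : ℝ) (G : SimpleGraph V)
    (I : Finset V) : ℝ :=
  ∑ v ∈ I, min 1 (ρ / ((G.degree v : ℝ) + 1))

/-- The expected size of a random vertex set with the law `μ`. -/
noncomputable def expectedSize {V : Type*} [Fintype V] (μ : PMF (Finset V)) : ℝ :=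
  ∑ J : Finset V, (μ J).toReal * (J.card : ℝ)

/-- A random vertex set with the law `μ` is always independent in `G`, and its expected size is at
least the canonical recoverable value, with parameter `ρ`, of every independent set of `G`. -/
def HasCanonicalRecoverableValue {V : Type*} [Fintype V] (ρ : ℝ) (G : SimpleGraph V)
    (μ : PMF (Finset V)) : Prop :=
  (∀ J ∈ μ.support, G.IsIndepSet (J : Set V)) ∧
    ∀ I : Finset V, G.IsIndepSet (I : Set V) → canonicalValue ρ G I ≤ expectedSize μ

/-! ### The algorithm

A graph on the vertex set `S ⊆ V` is given as a graph `G` on `V` of which only the subgraph induced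
on `S` matters.  The choices that the algorithm leaves open are expressed by relations. -/

section Algorithm

variable {V : Type*} [DecidableEq V]

open Classical in
/-- The neighbours of `v` in the subgraph of `G` induced on `S`. -/
noncomputable def nbrs (G : SimpleGraph V) (S : Finset V) (v : V) : Finset V :=
  S.filter fun u => G.Adj v u

/-- `J` is a possible outcome of the greedy algorithm on the subgraph of `G` induced on `T`: pick a
vertex of minimum degree, delete it and its neighbours, and go on until no vertex is left. -/
inductive GreedyOutcome (G : SimpleGraph V) : Finset V → Finset V → Prop
  | done : GreedyOutcome G ∅ ∅
  | pick (T J : Finset V) (v : V) (hv : v ∈ T)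
      (hmin : ∀ u ∈ T, (nbrs G T v).card ≤ (nbrs G T u).card)
      (h : GreedyOutcome G (T \ insert v (nbrs G T v)) J) :
      GreedyOutcome G T (insert v J)

/-- `x` is a feasible solution of the LP relaxation of MIS on the subgraph induced on `T`. -/
def LPFeasible (G : SimpleGraph V) (T : Finset V) (x : V → ℝ) : Prop :=
  (∀ v ∈ T, 0 ≤ x v ∧ x v ≤ 1) ∧ ∀ u ∈ T, ∀ v ∈ T, G.Adj u v → x u + x v ≤ 1

/-- `x` is a half-integral optimal solution of the LP relaxation of MIS on the subgraph of `G`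
induced on `T`. -/
def HalfIntegralLPOptimum (G : SimpleGraph V) (T : Finset V) (x : V → ℝ) : Prop :=
  LPFeasible G T x ∧ (∀ v ∈ T, x v = 0 ∨ x v = 1 / 2 ∨ x v = 1) ∧
    ∀ y : V → ℝ, LPFeasible G T y → ∑ v ∈ T, y v ≤ ∑ v ∈ T, x v

open Classical in
/-- The vertex set of `G_k`, the union of the first `k` layers, for the graph induced on `S` and
the ordering `π` of `S`: the vertices that have fewer than `k` neighbours before them. -/
noncomputable def firstLayers (k : ℕ) (G : SimpleGraph V) (S : Finset V) (π : S ≃ Fin S.card) :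
    Finset V :=
  (Finset.univ.filter fun v : S =>
    (Finset.univ.filter fun u : S => G.Adj (v : V) (u : V) ∧ π u < π v).card < k).map
      (Function.Embedding.subtype _)

open Classical in
/-- `J` is a possible outcome of LP+greedy on the subgraph of `G` induced on `T`: take a
half-integral optimal solution, take all vertices of value `1`, drop those of value `0`, and run
the greedy algorithm on the subgraph induced on the vertices of value `1 / 2`. -/
def LPGreedyOutcome (G : SimpleGraph V) (T J : Finset V) : Prop :=
  ∃ (x : V → ℝ) (K : Finset V), HalfIntegralLPOptimum G T x ∧
    GreedyOutcome G (T.filter fun v => x v = 1 / 2) K ∧ J = (T.filter fun v => x v = 1) ∪ K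

instance orderingNonempty (S : Finset V) : Nonempty (S ≃ Fin S.card) := ⟨S.equivFin⟩

/-- `μ` is a possible law of the output of PLG (permute, LP, greedy) with `G_k`, on the subgraph of
`G` induced on `S`: draw a uniformly random ordering `π` of `S` and run LP+greedy on `G_k`. -/
def PLGLaw (k : ℕ) (G : SimpleGraph V) (S : Finset V) (μ : PMF (Finset V)) : Prop :=
  ∃ out : (S ≃ Fin S.card) → Finset V,
    (∀ π, LPGreedyOutcome G (firstLayers k G S π) (out π)) ∧
      μ = (PMF.uniformOfFintype (S ≃ Fin S.card)).map out

/-- The graph in which `v` has become adjacent to all neighbours of `w`. On a vertex set without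
`w` this is the graph in which `v` and `w` are merged into one vertex, which is called `v`. -/
def mergeInto (G : SimpleGraph V) (v w : V) : SimpleGraph V where
  Adj a b := a ≠ b ∧ (G.Adj a b ∨ (a = v ∧ G.Adj w b) ∨ (b = v ∧ G.Adj w a))
  symm := ⟨by
    rintro a b ⟨hne, h⟩
    refine ⟨hne.symm, ?_⟩
    rcases h with h | h | h
    · exact Or.inl h.symm
    · exact Or.inr (Or.inr h)
    · exact Or.inr (Or.inl h)⟩
  loopless := ⟨fun _ h => h.1 rfl⟩

/-- `μ` is a possible law of the output, on the subgraph of `G` induced on `S`, of the algorithm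
that removes vertices of degree at most `1` and applies 2-elimination as long as it can, and then
runs PLG with `G_k` on the remaining graph, which has minimum degree at least `3`. -/
inductive EliminateThenPLG (k : ℕ) : SimpleGraph V → Finset V → PMF (Finset V) → Prop
  /-- An isolated vertex `u` is taken. -/
  | isolated (G : SimpleGraph V) (S : Finset V) (μ : PMF (Finset V)) (u : V) (hu : u ∈ S)
      (hdeg : nbrs G S u = ∅) (h : EliminateThenPLG k G (S \ {u}) μ) :
      EliminateThenPLG k G S (μ.map fun J => insert u J)
  /-- A vertex `u` of degree one is taken, and its neighbour `v` is removed. -/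
  | pendant (G : SimpleGraph V) (S : Finset V) (μ : PMF (Finset V)) (u v : V) (hu : u ∈ S)
      (hdeg : nbrs G S u = {v}) (h : EliminateThenPLG k G (S \ {u, v}) μ) :
      EliminateThenPLG k G S (μ.map fun J => insert u J)
  /-- 2-elimination when the two neighbours `v`, `w` of `u` are adjacent: `u` is taken. -/
  | triangle (G : SimpleGraph V) (S : Finset V) (μ : PMF (Finset V)) (u v w : V) (hu : u ∈ S)
      (hmin : ∀ x ∈ S, 2 ≤ (nbrs G S x).card) (hvw : v ≠ w) (hdeg : nbrs G S u = {v, w})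
      (hadj : G.Adj v w) (h : EliminateThenPLG k G (S \ {u, v, w}) μ) :
      EliminateThenPLG k G S (μ.map fun J => insert u J)
  /-- 2-elimination when the two neighbours `v`, `w` of `u` are not adjacent: `u` is removed and
  `v`, `w` are merged. If the merged vertex is in the set `J` found in the smaller graph, it is
  replaced by `v` and `w`; otherwise `u` is taken. -/
  | merge (G : SimpleGraph V) (S : Finset V) (μ : PMF (Finset V)) (u v w : V) (hu : u ∈ S)
      (hmin : ∀ x ∈ S, 2 ≤ (nbrs G S x).card) (hvw : v ≠ w) (hdeg : nbrs G S u = {v, w})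
      (hadj : ¬ G.Adj v w) (h : EliminateThenPLG k (mergeInto G v w) (S \ {u, w}) μ) :
      EliminateThenPLG k G S (μ.map fun J => if v ∈ J then insert w J else insert u J)
  /-- Once the minimum degree is at least three, PLG is run. -/
  | plg (G : SimpleGraph V) (S : Finset V) (μ : PMF (Finset V))
      (hmin : ∀ x ∈ S, 3 ≤ (nbrs G S x).card) (h : PLGLaw k G S μ) :
      EliminateThenPLG k G S μ

end Algorithm

set_option linter.unusedSectionVars false

/-! ### Edge counting and the greedy algorithm. -/

section RecoverableValue

variable {V : Type*} [DecidableEq V]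

/-! Two matters are separate: every run recovers the value, and suitable choices are made by a
polynomial-time program.

Value. Everything rests on one linear inequality. When greedy deletes a vertex of minimum degree
with its neighbours, a set of w vertices of which i lie in I, at least w(w-1) + i(i-1) ordered
adjacent pairs disappear. By integrality this pays for 72|J| ≥ 10|I| + 30|T| - 10m, where m is the
number of edges inside T. Three perturbations of a half-integral LP optimum turn this into 72|J| ≥
40|I| + 15|T| - 10m for LP+greedy (`LPGreedyOutcome.card_bound`). In the first four layers every
edge is charged to its later end. A vertex of rank r < 4 in its closed neighbourhood then
contributes 15 - 10r, plus 40 if it lies in I. The rank is uniform on d+1 ≥ 4 values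
(`card_mul_card_rankIn_eq`) and 15 - 10r sums to zero over r = 0,1,2,3. So vertices outside I cancel
on average, a vertex of I yields 160/(d+1), and 160/72 = 20/9. Each elimination step adds exactly
one vertex to the output, while the value of I drops by at most one (`Recovers.take`,
`Recovers.merge`). The only delicate case is a merge of two vertices of I: the merged degree is at
most d(v) + d(w) - 2, and `min_div_merge` applies.

Program. An assignment costs one step however large the data, so running times can be bounded by
polynomials in n alone, uniformly in the argument. The class `PolyTime` is therefore closed under
composition, case distinction and loops over the vertices, with no control of intermediate sizes.
The LP is solved combinatorially: an auction finds a matching in the bipartite double cover, and a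
price level that nobody attains cuts out an independent set of the cover that certifies optimality.
Averaging its two sides gives a half-integral LP optimum (`halfSolution_optimum`). Drawing the
vertices without replacement yields a uniform ordering (`drawOrder_eq_uniform`), and the recorded
eliminations are undone at the end (`outputLaw_spec`, `exists_program`). -/

theorem mem_nbrs {G : SimpleGraph V} {S : Finset V} {u v : V} :
    u ∈ nbrs G S v ↔ u ∈ S ∧ G.Adj v u := by
  classical
  simp [nbrs]

theorem nbrs_subset (G : SimpleGraph V) (S : Finset V) (v : V) : nbrs G S v ⊆ S :=
  fun _ h => (mem_nbrs.1 h).1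

theorem not_mem_nbrs_self (G : SimpleGraph V) (S : Finset V) (v : V) : v ∉ nbrs G S v :=
  fun h => G.loopless.irrefl v (mem_nbrs.1 h).2

/-- The number of ordered pairs of adjacent vertices in `X × Y`. -/
noncomputable def adjCount (G : SimpleGraph V) (X Y : Finset V) : ℕ :=
  ∑ v ∈ X, (nbrs G Y v).card

open Classical in
theorem adjCount_eq_sum (G : SimpleGraph V) (X Y : Finset V) :
    adjCount G X Y = ∑ v ∈ X, ∑ u ∈ Y, if G.Adj v u then 1 else 0 := by
  refine Finset.sum_congr rfl fun v _ => ?_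
  rw [nbrs, Finset.card_filter]

theorem adjCount_comm (G : SimpleGraph V) (X Y : Finset V) :
    adjCount G X Y = adjCount G Y X := by
  classical
  rw [adjCount_eq_sum, adjCount_eq_sum, Finset.sum_comm]
  simp [G.adj_comm]

theorem adjCount_union_left (G : SimpleGraph V) {X Y : Finset V} (Z : Finset V)
    (h : Disjoint X Y) : adjCount G (X ∪ Y) Z = adjCount G X Z + adjCount G Y Z :=
  Finset.sum_union h

theorem adjCount_union_right (G : SimpleGraph V) {X Y : Finset V} (Z : Finset V)
    (h : Disjoint X Y) : adjCount G Z (X ∪ Y) = adjCount G Z X + adjCount G Z Y := by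
  rw [adjCount_comm, adjCount_union_left G Z h, adjCount_comm G X, adjCount_comm G Y]

theorem nbrs_mono (G : SimpleGraph V) {S T : Finset V} (h : S ⊆ T) (v : V) :
    nbrs G S v ⊆ nbrs G T v :=
  fun _ hu => mem_nbrs.2 ⟨h (mem_nbrs.1 hu).1, (mem_nbrs.1 hu).2⟩

theorem adjCount_mono (G : SimpleGraph V) {S T : Finset V} (h : S ⊆ T) :
    adjCount G S S ≤ adjCount G T T :=
  (Finset.sum_le_sum fun v _ => Finset.card_le_card (nbrs_mono G h v)).trans
    (Finset.sum_le_sum_of_subset h)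

/-- A vertex set containing `k` independent vertices spans few edges. -/
theorem adjCount_self_add_le (G : SimpleGraph V) {W I : Finset V} (hIW : I ⊆ W)
    (hI : G.IsIndepSet (I : Set V)) :
    (adjCount G W W : ℤ) ≤ W.card * (W.card - 1) - I.card * (I.card - 1) := by
  -- A vertex of `I` sees only `W \ I`; any other vertex of `W` sees at most all the rest of `W`.
  have h1 : ∀ v ∈ I, ((nbrs G W v).card : ℤ) ≤ W.card - I.card := by
    intro v hv
    have : nbrs G W v ⊆ W \ I := by
      intro u hu
      rw [mem_nbrs] at hu
      refine Finset.mem_sdiff.2 ⟨hu.1, fun huI => hI hv huI hu.2.ne hu.2⟩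
    have h := Finset.card_le_card this
    rw [Finset.card_sdiff_of_subset hIW] at h
    have := Finset.card_le_card hIW
    omega
  have h2 : ∀ v ∈ W \ I, ((nbrs G W v).card : ℤ) ≤ W.card - 1 := by
    intro v hv
    have hvW := (Finset.mem_sdiff.1 hv).1
    have : nbrs G W v ⊆ W.erase v := by
      intro u hu
      exact Finset.mem_erase.2
        ⟨fun e => not_mem_nbrs_self G W v (e ▸ hu), (mem_nbrs.1 hu).1⟩
    have h := Finset.card_le_card this
    rw [Finset.card_erase_of_mem hvW] at h
    have := Finset.card_pos.2 ⟨v, hvW⟩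
    omega
  have h3 := Finset.sum_le_sum h1
  have h4 := Finset.sum_le_sum h2
  have h5 : (adjCount G W W : ℤ)
      = ∑ v ∈ W \ I, ((nbrs G W v).card : ℤ) + ∑ v ∈ I, ((nbrs G W v).card : ℤ) := by
    rw [Finset.sum_sdiff hIW, adjCount]
    push_cast
    rfl
  rw [Finset.sum_const, nsmul_eq_mul] at h3 h4
  rw [Finset.card_sdiff_of_subset hIW, Nat.cast_sub (Finset.card_le_card hIW)] at h4
  rw [h5]
  refine (add_le_add h4 h3).trans (le_of_eq ?_)
  ring

theorem GreedyOutcome.subset {G : SimpleGraph V} {T J : Finset V} (h : GreedyOutcome G T J) :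
    J ⊆ T := by
  induction h with
  | done => exact Finset.Subset.refl _
  | pick T J v hv _ _ ih =>
    exact Finset.insert_subset hv (ih.trans Finset.sdiff_subset)

theorem IsIndepSet.insert_of_not_adj {G : SimpleGraph V} {J : Finset V} {v : V}
    (hJ : G.IsIndepSet (J : Set V)) (hv : ∀ u ∈ J, ¬ G.Adj v u) :
    G.IsIndepSet ((insert v J : Finset V) : Set V) := by
  rw [Finset.coe_insert]
  refine hJ.insert fun u hu _ => ⟨hv u hu, fun h => hv u hu h.symm⟩

theorem GreedyOutcome.isIndepSet {G : SimpleGraph V} {T J : Finset V}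
    (h : GreedyOutcome G T J) : G.IsIndepSet (J : Set V) := by
  induction h with
  | done => simp [SimpleGraph.IsIndepSet]
  | pick T J v hv _ h ih =>
    refine IsIndepSet.insert_of_not_adj ih fun u hu hadj => ?_
    have := Finset.mem_sdiff.1 (h.subset hu)
    exact this.2 (Finset.mem_insert_of_mem (mem_nbrs.2 ⟨this.1, hadj⟩))

/-- Lower bound for the size of the output of the greedy algorithm. -/
theorem GreedyOutcome.card_bound {G : SimpleGraph V} {T J : Finset V}
    (h : GreedyOutcome G T J) : ∀ {I : Finset V}, I ⊆ T → G.IsIndepSet (I : Set V) →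
    (10 * I.card + 30 * T.card : ℤ) ≤ 72 * J.card + 5 * adjCount G T T := by
  induction h with
  | done =>
    intro I hI _
    rw [Finset.subset_empty.1 hI]
    simp [adjCount]
  | pick T J v hv hmin h ih =>
    intro I hIT hI
    set W := insert v (nbrs G T v) with hW
    have hWT : W ⊆ T := Finset.insert_subset hv (nbrs_subset G T v)
    have hWc : (W.card : ℤ) = (nbrs G T v).card + 1 := by
      rw [hW, Finset.card_insert_of_notMem (not_mem_nbrs_self G T v)]
      push_cast
      rfl
    have hvJ : v ∉ J := fun hvJ =>
      (Finset.mem_sdiff.1 (h.subset hvJ)).2 (Finset.mem_insert_self _ _)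
    have h1 := ih (I := I \ W) (Finset.sdiff_subset_sdiff hIT (Finset.Subset.refl _))
      (hI.mono (by simp))
    have h2 := adjCount_self_add_le G (Finset.inter_subset_right (s₁ := I) (s₂ := W))
      (hI.mono (by simp))
    have hT : T = W ∪ (T \ W) := (Finset.union_sdiff_of_subset hWT).symm
    have hdisj : Disjoint W (T \ W) := Finset.disjoint_sdiff
    have h3 : adjCount G T T = adjCount G W W + 2 * adjCount G W (T \ W)
        + adjCount G (T \ W) (T \ W) := by
      conv_lhs => rw [hT]
      rw [adjCount_union_left G _ hdisj, adjCount_union_right G _ hdisj,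
        adjCount_union_right G _ hdisj, adjCount_comm G (T \ W) W]
      ring
    have h4 : adjCount G W T = adjCount G W W + adjCount G W (T \ W) := by
      conv_lhs => rw [hT]
      exact adjCount_union_right G _ hdisj
    have h5 : (W.card * (W.card - 1) : ℤ) ≤ adjCount G W T := by
      have : ∑ _w ∈ W, (nbrs G T v).card ≤ adjCount G W T :=
        Finset.sum_le_sum fun w hw => hmin w (hWT hw)
      rw [Finset.sum_const, smul_eq_mul] at this
      rw [hWc, add_sub_cancel_right]
      have h' : ((W.card * (nbrs G T v).card : ℕ) : ℤ) ≤ adjCount G W T := by exact_mod_cast this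
      push_cast at h'
      rwa [hWc] at h'
    have h6 : (T.card : ℤ) = W.card + (T \ W).card := by
      have := Finset.card_sdiff_add_card_eq_card hWT
      omega
    have h7 : (I.card : ℤ) = (I ∩ W).card + (I \ W).card := by
      have := Finset.card_inter_add_card_sdiff I W
      omega
    have h8 : ((insert v J).card : ℤ) = J.card + 1 := by
      rw [Finset.card_insert_of_notMem hvJ]
      push_cast
      rfl
    -- With w = |W| and i = |I ∩ W| the step needs 5(w² - 7w) + 5(i² - 3i) + 72 ≥ 0. For integers w²
    -- - 7w ≥ -12 and i² - 3i ≥ -2, so the left side is at least 2.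
    have consec : ∀ a b : ℤ, a + 1 = b → ∀ z : ℤ, 0 ≤ (z - a) * (z - b) := by
      intro a b hab z
      rcases le_or_gt z a with hz | hz
      · nlinarith
      · nlinarith
    have h9 := consec 3 4 rfl W.card
    have h10 := consec 1 2 rfl (I ∩ W).card
    rw [h8, h6, h7]
    zify at h3 h4
    nlinarith

/-! ### The linear program -/

section LP

variable {G : SimpleGraph V} {T I : Finset V} {x : V → ℝ}

theorem sum_le_of_change (hx : HalfIntegralLPOptimum G T x) {y : V → ℝ}
    (hy : LPFeasible G T y) : ∑ v ∈ T, (y v - x v) ≤ 0 := by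
  rw [Finset.sum_sub_distrib]
  linarith [hx.2.2 y hy]

/-- The constant solution 1/2 gains 1/2 at every zero of `x` and loses 1/2 at every one. -/
theorem HalfIntegralLPOptimum.card_zero_le (hx : HalfIntegralLPOptimum G T x) :
    (T.filter fun v => x v = 0).card ≤ (T.filter fun v => x v = 1).card := by
  have h := sum_le_of_change hx (y := fun _ => 1 / 2)
    ⟨fun v _ => by norm_num, fun u _ v _ _ => by norm_num⟩
  have h2 : ∀ v ∈ T, (1 / 2 - x v : ℝ)
      = (if x v = 0 then 1 / 2 else 0) - (if x v = 1 then 1 / 2 else 0) := by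
    intro v hv
    rcases hx.2.1 v hv with h | h | h <;> rw [h] <;> norm_num
  rw [Finset.sum_congr rfl h2, Finset.sum_sub_distrib, ← Finset.sum_filter, ← Finset.sum_filter,
    Finset.sum_const, Finset.sum_const, nsmul_eq_mul, nsmul_eq_mul] at h
  have : ((T.filter fun v => x v = 0).card : ℝ) ≤ (T.filter fun v => x v = 1).card := by linarith
  exact_mod_cast this

/-- Replace the values 1/2 by the indicator of `I`. This stays feasible because a vertex of value
1/2 has no neighbour of value 1 and `I` is independent. -/
theorem HalfIntegralLPOptimum.card_half (hx : HalfIntegralLPOptimum G T x) (hIT : I ⊆ T)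
    (hI : G.IsIndepSet (I : Set V)) :
    2 * (I.filter fun v => x v = 1 / 2).card ≤ (T.filter fun v => x v = 1 / 2).card := by
  have h := sum_le_of_change hx (y := fun v => if x v = 1 / 2 then if v ∈ I then 1 else 0 else x v)
    (by
      refine ⟨fun v hv => ?_, fun u hu v hv huv => ?_⟩
      · have := hx.1.1 v hv
        dsimp only
        split_ifs <;> norm_num [this]
      · have := hx.1.2 u hu v hv huv
        have hu' := hx.2.1 u hu
        have hv' := hx.2.1 v hv
        have hnot : u ∈ I → v ∈ I → False := fun h1 h2 => hI h1 h2 huv.ne huv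
        dsimp only
        rcases hu' with hu' | hu' | hu' <;> rcases hv' with hv' | hv' | hv' <;>
          by_cases h1 : u ∈ I <;> by_cases h2 : v ∈ I <;>
          simp only [hu', hv'] at this ⊢ <;>
          first
            | exact (hnot h1 h2).elim
            | (norm_num [h1, h2]; done)
            | (norm_num at this))
  have h2 : ∀ v ∈ T, ((if x v = 1 / 2 then if v ∈ I then 1 else 0 else x v) - x v : ℝ)
      = (if v ∈ I ∧ x v = 1 / 2 then 1 else 0) - (if x v = 1 / 2 then 1 / 2 else 0) := by
    intro v hv
    rcases hx.2.1 v hv with h | h | h <;> by_cases h2 : v ∈ I <;> norm_num [h, h2]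
  have h3 : T.filter (fun v => v ∈ I ∧ x v = 1 / 2) = I.filter fun v => x v = 1 / 2 := by
    ext v
    simp only [Finset.mem_filter]
    exact ⟨fun h => h.2, fun h => ⟨hIT h.1, h⟩⟩
  rw [Finset.sum_congr rfl h2, Finset.sum_sub_distrib, ← Finset.sum_filter, ← Finset.sum_filter,
    Finset.sum_const, Finset.sum_const, nsmul_eq_mul, nsmul_eq_mul, h3] at h
  have : ((2 * (I.filter fun v => x v = 1 / 2).card : ℕ) : ℝ)
      ≤ (T.filter fun v => x v = 1 / 2).card := by
    push_cast
    linarith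
  exact_mod_cast this

/-- Raise the zeros in `I` to 1/2 and lower the ones outside `I` to 1/2. Neighbours of a raised
vertex lie outside `I`, so afterwards their values are at most 1/2. -/
theorem HalfIntegralLPOptimum.card_inter_zero_le (hx : HalfIntegralLPOptimum G T x) (hIT : I ⊆ T)
    (hI : G.IsIndepSet (I : Set V)) :
    (I.filter fun v => x v = 0).card + (I.filter fun v => x v = 1).card
      ≤ (T.filter fun v => x v = 1).card := by
  have h := sum_le_of_change hx
    (y := fun v => if (v ∈ I ∧ x v = 0) ∨ (v ∉ I ∧ x v = 1) then 1 / 2 else x v)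
    (by
      refine ⟨fun v hv => ?_, fun u hu v hv huv => ?_⟩
      · have := hx.1.1 v hv
        dsimp only
        split_ifs <;> norm_num [this]
      · have := hx.1.2 u hu v hv huv
        have hu' := hx.2.1 u hu
        have hv' := hx.2.1 v hv
        have hnot : u ∈ I → v ∈ I → False := fun h1 h2 => hI h1 h2 huv.ne huv
        dsimp only
        rcases hu' with hu' | hu' | hu' <;> rcases hv' with hv' | hv' | hv' <;>
          by_cases h1 : u ∈ I <;> by_cases h2 : v ∈ I <;>
          simp only [hu', hv'] at this ⊢ <;>
          first
            | exact (hnot h1 h2).elim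
            | (norm_num [h1, h2]; done)
            | (norm_num at this))
  have h2 : ∀ v ∈ T, ((if (v ∈ I ∧ x v = 0) ∨ (v ∉ I ∧ x v = 1) then 1 / 2 else x v) - x v : ℝ)
      = (if v ∈ I ∧ x v = 0 then 1 / 2 else 0) + (if v ∈ I ∧ x v = 1 then 1 / 2 else 0)
        - (if x v = 1 then 1 / 2 else 0) := by
    intro v hv
    rcases hx.2.1 v hv with h | h | h <;> by_cases h2 : v ∈ I <;> norm_num [h, h2]
  have h3 : ∀ c : ℝ, T.filter (fun v => v ∈ I ∧ x v = c) = I.filter fun v => x v = c := by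
    intro c
    ext v
    simp only [Finset.mem_filter]
    exact ⟨fun h => h.2, fun h => ⟨hIT h.1, h⟩⟩
  rw [Finset.sum_congr rfl h2, Finset.sum_sub_distrib, Finset.sum_add_distrib,
    ← Finset.sum_filter, ← Finset.sum_filter, ← Finset.sum_filter,
    Finset.sum_const, Finset.sum_const, Finset.sum_const, nsmul_eq_mul, nsmul_eq_mul,
    nsmul_eq_mul, h3, h3] at h
  have : (((I.filter fun v => x v = 0).card + (I.filter fun v => x v = 1).card : ℕ) : ℝ)
      ≤ (T.filter fun v => x v = 1).card := by
    push_cast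
    linarith
  exact_mod_cast this

theorem HalfIntegralLPOptimum.card_eq (hx : HalfIntegralLPOptimum G T x) {X : Finset V}
    (hX : X ⊆ T) : X.card = (X.filter fun v => x v = 0).card
      + (X.filter fun v => x v = 1 / 2).card + (X.filter fun v => x v = 1).card := by
  rw [Finset.card_filter, Finset.card_filter, Finset.card_filter, ← Finset.sum_add_distrib,
    ← Finset.sum_add_distrib, Finset.card_eq_sum_ones]
  refine Finset.sum_congr rfl fun v hv => ?_
  rcases hx.2.1 v (hX hv) with h | h | h <;> rw [h] <;> norm_num

end LP

/-! ### LP followed by greedy. -/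

theorem LPGreedyOutcome.subset {G : SimpleGraph V} {T J : Finset V} (h : LPGreedyOutcome G T J) :
    J ⊆ T := by
  obtain ⟨x, K, _, hK, rfl⟩ := h
  exact Finset.union_subset (Finset.filter_subset _ _)
    (hK.subset.trans (Finset.filter_subset _ _))

theorem LPGreedyOutcome.isIndepSet {G : SimpleGraph V} {T J : Finset V}
    (h : LPGreedyOutcome G T J) : G.IsIndepSet (J : Set V) := by
  classical
  obtain ⟨x, K, hx, hK, rfl⟩ := h
  have key : ∀ u ∈ T, ∀ v ∈ T, x u = 1 → (x v = 1 ∨ x v = 1 / 2) → ¬ G.Adj u v := by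
    intro u hu v hv h1 h2 hadj
    have := hx.1.2 u hu v hv hadj
    rcases h2 with h2 | h2 <;> rw [h1, h2] at this <;> norm_num at this
  intro u hu v hv huv hadj
  simp only [Finset.coe_union, Finset.coe_filter, Set.mem_union, Set.mem_ofPred_eq,
    Finset.mem_coe] at hu hv
  rcases hu with hu | hu
  · rcases hv with hv | hv
    · exact key u hu.1 v hv.1 hu.2 (Or.inl hv.2) hadj
    · have hv' := Finset.mem_filter.1 (hK.subset hv)
      exact key u hu.1 v hv'.1 hu.2 (Or.inr hv'.2) hadj
  · rcases hv with hv | hv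
    · have hu' := Finset.mem_filter.1 (hK.subset hu)
      exact key v hv.1 u hu'.1 hv.2 (Or.inr hu'.2) hadj.symm
    · exact hK.isIndepSet hu hv huv hadj

/-- Lower bound for the size of the output of LP+greedy. -/
theorem LPGreedyOutcome.card_bound {G : SimpleGraph V} {T J I : Finset V}
    (h : LPGreedyOutcome G T J) (hIT : I ⊆ T) (hI : G.IsIndepSet (I : Set V)) :
    (40 * I.card + 15 * T.card : ℤ) ≤ 72 * J.card + 5 * adjCount G T T := by
  obtain ⟨x, K, hx, hK, rfl⟩ := h
  have hdisj : Disjoint (T.filter fun v => x v = 1) K := by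
    rw [Finset.disjoint_left]
    intro v hv hvK
    have h1 := (Finset.mem_filter.1 hv).2
    have h2 := (Finset.mem_filter.1 (hK.subset hvK)).2
    rw [h1] at h2
    norm_num at h2
  rw [Finset.card_union_of_disjoint hdisj]
  have h1 := hK.card_bound (I := I.filter fun v => x v = 1 / 2)
    (Finset.filter_subset_filter _ hIT)
    (hI.mono (Finset.coe_subset.2 (Finset.filter_subset _ _)))
  have h2 := hx.card_zero_le
  have h3 := hx.card_half hIT hI
  have h4 := hx.card_inter_zero_le hIT hI
  have h5 := hx.card_eq hIT
  have h6 := hx.card_eq (Finset.Subset.refl T)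
  have h7 := adjCount_mono G (Finset.filter_subset (fun v => x v = 1 / 2) T)
  -- Index the parts of `I` and `T` by the value of `x`. On the half part 10|I½| + 30|T½| ≥ 40|I½| +
  -- 15|T½|, as 2|I½| ≤ |T½|. On the integral part 40(|I₀| + |I₁|) + 15(|T₀| + |T₁|) ≤ 70|T₁|.
  push_cast
  omega

end RecoverableValue

/-! ### Random orderings -/

section RandomOrder

variable {α : Type*} [Fintype α] [DecidableEq α] {N : ℕ}

/-- The number of elements of `A` that precede `a` in the ordering `π`. -/
def rankIn (π : α ≃ Fin N) (A : Finset α) (a : α) : ℕ :=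
  (A.filter fun u => π u < π a).card

theorem rankIn_lt (π : α ≃ Fin N) {A : Finset α} {a : α} (ha : a ∈ A) :
    rankIn π A a < A.card :=
  Finset.card_lt_card ⟨Finset.filter_subset _ _, fun h => by simpa using h ha⟩

theorem rankIn_lt_rankIn (π : α ≃ Fin N) {A : Finset α} {a b : α} (ha : a ∈ A)
    (hab : π a < π b) : rankIn π A a < rankIn π A b := by
  refine Finset.card_lt_card ⟨fun u hu => ?_, fun h => ?_⟩
  · rw [Finset.mem_filter] at hu ⊢
    exact ⟨hu.1, hu.2.trans hab⟩
  · have := h (Finset.mem_filter.2 ⟨ha, hab⟩)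
    simp at this

theorem rankIn_injOn (π : α ≃ Fin N) (A : Finset α) : Set.InjOn (rankIn π A) A := by
  intro a ha b hb hab
  by_contra hne
  rcases lt_or_gt_of_ne (fun h => hne (π.injective h) : π a ≠ π b) with h | h
  · exact (rankIn_lt_rankIn π ha h).ne hab
  · exact (rankIn_lt_rankIn π hb h).ne' hab

/-- The rank maps `A` injectively into `range A.card`, hence onto it. -/
theorem card_rankIn_eq (π : α ≃ Fin N) {A : Finset α} {r : ℕ} (hr : r < A.card) :
    (A.filter fun a => rankIn π A a = r).card = 1 := by
  have himg : A.image (rankIn π A) = Finset.range A.card := by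
    refine Finset.eq_of_subset_of_card_le (fun x hx => ?_) ?_
    · obtain ⟨a, ha, rfl⟩ := Finset.mem_image.1 hx
      exact Finset.mem_range.2 (rankIn_lt π ha)
    · rw [Finset.card_image_of_injOn (rankIn_injOn π A), Finset.card_range]
  obtain ⟨a, ha, har⟩ := Finset.mem_image.1 (himg ▸ Finset.mem_range.2 hr)
  rw [Finset.card_eq_one]
  refine ⟨a, Finset.eq_singleton_iff_unique_mem.2 ⟨Finset.mem_filter.2 ⟨ha, har⟩, fun b hb => ?_⟩⟩
  rw [Finset.mem_filter] at hb
  exact rankIn_injOn π A hb.1 ha (hb.2.trans har.symm)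

/-- Composition with the transposition of `a` and `b`, which preserves `A`, permutes the orderings
and exchanges the two ranks. -/
theorem card_rankIn_eq_of_mem {A : Finset α} {a b : α} (ha : a ∈ A) (hb : b ∈ A) (r : ℕ) :
    (Finset.univ.filter fun π : α ≃ Fin N => rankIn π A a = r).card
      = (Finset.univ.filter fun π : α ≃ Fin N => rankIn π A b = r).card := by
  have hswap : ∀ u, Equiv.swap a b u ∈ A ↔ u ∈ A := by
    intro u
    rcases eq_or_ne u a with rfl | h1
    · simp [ha, hb]
    rcases eq_or_ne u b with rfl | h2
    · simp [ha, hb]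
    rw [Equiv.swap_apply_of_ne_of_ne h1 h2]
  have hrank : ∀ π : α ≃ Fin N, rankIn ((Equiv.swap a b).trans π) A a = rankIn π A b := by
    intro π
    refine Finset.card_bij (fun u _ => Equiv.swap a b u) ?_ ?_ ?_
    · intro u hu
      simpa [hswap] using hu
    · intro u _ w _ h
      exact (Equiv.swap a b).injective h
    · intro w hw
      refine ⟨Equiv.swap a b w, ?_, by simp⟩
      simpa [hswap] using hw
  refine (Finset.card_bij (fun π _ => (Equiv.swap a b).trans π) ?_ ?_ ?_).symm
  · intro π hπ
    simpa [hrank] using hπ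
  · intro π _ π' _ h
    ext x
    have := congrArg (fun e : α ≃ Fin N => e (Equiv.swap a b x)) h
    simpa using congrArg Fin.val this
  · intro π hπ
    refine ⟨(Equiv.swap a b).trans π, ?_, ?_⟩
    · have := hrank ((Equiv.swap a b).trans π)
      rw [← Equiv.trans_assoc] at this
      simp only [Finset.mem_filter, Finset.mem_univ, true_and] at hπ ⊢
      rw [← this, ← hπ]
      congr 1
      ext x
      simp
    · ext x
      simp

/-- In a uniformly random ordering, the rank of an element of `A` among the elements of `A` is
uniformly distributed. -/
theorem card_mul_card_rankIn_eq {A : Finset α} {a : α} (ha : a ∈ A) {r : ℕ} (hr : r < A.card) :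
    A.card * (Finset.univ.filter fun π : α ≃ Fin N => rankIn π A a = r).card
      = Fintype.card (α ≃ Fin N) := by
  -- Double counting: the factor `A.card` becomes a sum over all `b ∈ A`, and each ordering has
  -- exactly one element of rank `r`.
  rw [← smul_eq_mul, ← Finset.sum_const,
    Finset.sum_congr rfl fun b hb => card_rankIn_eq_of_mem ha hb r]
  simp only [Finset.card_filter]
  rw [Finset.sum_comm]
  simp only [← Finset.card_filter]
  rw [Finset.sum_congr rfl fun π _ => card_rankIn_eq π hr]
  rw [Finset.sum_const, smul_eq_mul, mul_one, Finset.card_univ]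

theorem sum_comp_rankIn {A : Finset α} {a : α} (ha : a ∈ A) (f : ℕ → ℝ) :
    ∑ π : α ≃ Fin N, f (rankIn π A a)
      = Fintype.card (α ≃ Fin N) / A.card * ∑ r ∈ Finset.range A.card, f r := by
  have hA : (A.card : ℝ) ≠ 0 := Nat.cast_ne_zero.2 (Finset.card_pos.2 ⟨a, ha⟩).ne'
  rw [← Finset.sum_fiberwise_of_maps_to (t := Finset.range A.card)
    (g := fun π : α ≃ Fin N => rankIn π A a) fun π _ => Finset.mem_range.2 (rankIn_lt π ha),
    Finset.mul_sum]
  refine Finset.sum_congr rfl fun r hr => ?_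
  have h1 := card_mul_card_rankIn_eq (N := N) ha (Finset.mem_range.1 hr)
  rw [Finset.sum_congr rfl fun π hπ => by rw [(Finset.mem_filter.1 hπ).2], Finset.sum_const,
    nsmul_eq_mul, ← h1]
  push_cast
  field_simp

end RandomOrder

/-! ### Expected sizes of random sets. -/

section Expectation

theorem sum_map_toReal {α β : Type*} [Fintype α] [Fintype β] (p : PMF α) (f : α → β)
    (g : β → ℝ) : ∑ b, ((p.map f) b).toReal * g b = ∑ a, (p a).toReal * g (f a) := by
  classical
  have h : ∀ b, ((p.map f) b).toReal = ∑ a, if b = f a then (p a).toReal else 0 := by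
    intro b
    rw [PMF.map_apply, tsum_fintype, ENNReal.toReal_sum]
    · refine Finset.sum_congr rfl fun a _ => ?_
      split_ifs <;> simp
    · intro a _
      split_ifs
      · exact p.apply_ne_top a
      · simp
  simp only [h, Finset.sum_mul]
  rw [Finset.sum_comm]
  refine Finset.sum_congr rfl fun a _ => ?_
  simp

theorem sum_toReal_eq_one {α : Type*} [Fintype α] (p : PMF α) : ∑ a, (p a).toReal = 1 := by
  rw [← ENNReal.toReal_sum fun a _ => p.apply_ne_top a, ← tsum_fintype (L := .unconditional α),
    p.tsum_coe]
  rfl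

variable {V : Type*} [Fintype V]

/-- The gain from undoing an elimination step. The hypothesis is confined to the support, since only
there is the inserted vertex known to be new. -/
theorem expectedSize_map_succ (μ : PMF (Finset V)) (f : Finset V → Finset V)
    (hf : ∀ J ∈ μ.support, (f J).card = J.card + 1) :
    expectedSize (μ.map f) = expectedSize μ + 1 := by
  classical
  rw [expectedSize, sum_map_toReal μ f fun J => (J.card : ℝ), expectedSize,
    ← sum_toReal_eq_one μ, ← Finset.sum_add_distrib]
  refine Finset.sum_congr rfl fun J _ => ?_
  by_cases hJ : J ∈ μ.support
  · rw [hf J hJ]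
    push_cast
    ring
  · rw [PMF.mem_support_iff, not_not] at hJ
    simp [hJ]

theorem expectedSize_uniform_map {α : Type*} [Fintype α] [Nonempty α] (f : α → Finset V) :
    expectedSize ((PMF.uniformOfFintype α).map f)
      = (∑ a, ((f a).card : ℝ)) / Fintype.card α := by
  classical
  rw [expectedSize, sum_map_toReal _ f fun J => (J.card : ℝ), Finset.sum_div]
  refine Finset.sum_congr rfl fun a _ => ?_
  simp [PMF.uniformOfFintype_apply, div_eq_inv_mul]

end Expectation

/-! ### PLG with the first layers of a random ordering. -/

section PLG

variable {V : Type*} [DecidableEq V]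

open Classical in
/-- The neighbours of `v`, and `v` itself, as a set of vertices of the subgraph induced on `S`. -/
noncomputable def closedNbhd (G : SimpleGraph V) (S : Finset V) (v : S) : Finset S :=
  Finset.univ.filter fun u : S => u = v ∨ G.Adj (v : V) (u : V)

theorem self_mem_closedNbhd (G : SimpleGraph V) (S : Finset V) (v : S) :
    v ∈ closedNbhd G S v := by
  simp [closedNbhd]

theorem card_closedNbhd (G : SimpleGraph V) (S : Finset V) (v : S) :
    (closedNbhd G S v).card = (nbrs G S v).card + 1 := by
  classical
  have h : (closedNbhd G S v).map (Function.Embedding.subtype _) = insert (v : V) (nbrs G S v) := by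
    ext u
    simp only [closedNbhd, Finset.mem_map, Finset.mem_filter, Finset.mem_univ, true_and,
      Function.Embedding.subtype_apply, Finset.mem_insert, mem_nbrs]
    constructor
    · rintro ⟨a, rfl | h, rfl⟩
      · exact Or.inl rfl
      · exact Or.inr ⟨a.2, h⟩
    · rintro (rfl | h)
      · exact ⟨v, Or.inl rfl, rfl⟩
      · exact ⟨⟨u, h.1⟩, Or.inr h.2, rfl⟩
  rw [← Finset.card_map, h, Finset.card_insert_of_notMem (not_mem_nbrs_self G S v)]

-- As `v` does not precede itself, including it changes no count; it is included because uniformity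
-- of the rank holds for elements of the set.
open Classical in
theorem rankIn_closedNbhd (G : SimpleGraph V) (S : Finset V) (π : S ≃ Fin S.card) (v : S) :
    rankIn π (closedNbhd G S v) v
      = (Finset.univ.filter fun u : S => G.Adj (v : V) (u : V) ∧ π u < π v).card := by
  rw [rankIn, closedNbhd, Finset.filter_filter]
  congr 1
  ext u
  simp only [Finset.mem_filter, Finset.mem_univ, true_and]
  constructor
  · rintro ⟨rfl | h, h2⟩
    · exact (lt_irrefl _ h2).elim
    · exact ⟨h, h2⟩
  · rintro ⟨h, h2⟩
    exact ⟨Or.inr h, h2⟩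

theorem mem_firstLayers {k : ℕ} {G : SimpleGraph V} {S : Finset V} {π : S ≃ Fin S.card} {v : V} :
    v ∈ firstLayers k G S π ↔ ∃ h : v ∈ S, rankIn π (closedNbhd G S ⟨v, h⟩) ⟨v, h⟩ < k := by
  classical
  simp only [rankIn_closedNbhd, firstLayers, Finset.mem_map, Finset.mem_filter, Finset.mem_univ,
    true_and, Function.Embedding.subtype_apply]
  constructor
  · rintro ⟨a, ha, rfl⟩
    exact ⟨a.2, ha⟩
  · rintro ⟨h, ha⟩
    exact ⟨⟨v, h⟩, ha, rfl⟩

theorem firstLayers_eq_map (k : ℕ) (G : SimpleGraph V) (S : Finset V) (π : S ≃ Fin S.card) :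
    firstLayers k G S π = (Finset.univ.filter fun v : S =>
      rankIn π (closedNbhd G S v) v < k).map (Function.Embedding.subtype _) := by
  classical
  simp only [rankIn_closedNbhd, firstLayers]

theorem firstLayers_subset (k : ℕ) (G : SimpleGraph V) (S : Finset V) (π : S ≃ Fin S.card) :
    firstLayers k G S π ⊆ S :=
  fun _ h => (mem_firstLayers.1 h).1

/-- Every edge is counted at its later end. -/
theorem adjCount_firstLayers_le (k : ℕ) (G : SimpleGraph V) (S : Finset V)
    (π : S ≃ Fin S.card) :
    adjCount G (firstLayers k G S π) (firstLayers k G S π)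
      ≤ 2 * ∑ v : S with rankIn π (closedNbhd G S v) v < k,
          rankIn π (closedNbhd G S v) v := by
  classical
  set T := Finset.univ.filter fun v : S => rankIn π (closedNbhd G S v) v < k
  have hsplit : ∀ v u : S, (if G.Adj (v : V) (u : V) then 1 else 0 : ℕ)
      = (if G.Adj (v : V) (u : V) ∧ π u < π v then 1 else 0)
        + if G.Adj (u : V) (v : V) ∧ π v < π u then 1 else 0 := by
    intro v u
    rw [G.adj_comm (u : V) (v : V)]
    by_cases h : G.Adj (v : V) (u : V)
    · have hne : π u ≠ π v := fun e => h.ne (by rw [π.injective e])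
      rcases lt_or_gt_of_ne hne with h' | h'
      · simp [h, h', h'.le]
      · simp [h, h', h'.le]
    · simp [h]
  have hsum : adjCount G (firstLayers k G S π) (firstLayers k G S π)
      = ∑ v ∈ T, ∑ u ∈ T, ((if G.Adj (v : V) (u : V) ∧ π u < π v then 1 else 0)
        + if G.Adj (u : V) (v : V) ∧ π v < π u then 1 else 0) := by
    rw [adjCount_eq_sum, firstLayers_eq_map, Finset.sum_map]
    refine Finset.sum_congr rfl fun v _ => ?_
    rw [Finset.sum_map]
    exact Finset.sum_congr rfl fun u _ => hsplit v u
  rw [hsum]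
  simp only [Finset.sum_add_distrib]
  rw [Finset.sum_comm (f := fun v u : S => if G.Adj (u : V) (v : V) ∧ π v < π u then 1 else 0),
    ← two_mul]
  refine Nat.mul_le_mul_left _ (Finset.sum_le_sum fun v _ => ?_)
  rw [rankIn_closedNbhd, Finset.card_filter]
  exact Finset.sum_le_sum_of_subset (Finset.subset_univ T)

variable [Fintype V]

/-- The degree-based value of `I` in the subgraph induced on `S`. -/
noncomputable def inducedValue (ρ : ℝ) (G : SimpleGraph V) (S I : Finset V) : ℝ :=
  ∑ v ∈ I, min 1 (ρ / (((nbrs G S v).card : ℝ) + 1))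

theorem PLGLaw.inducedValue_le {G : SimpleGraph V} {S I : Finset V} {μ : PMF (Finset V)}
    (hmin : ∀ x ∈ S, 3 ≤ (nbrs G S x).card) (h : PLGLaw 4 G S μ) (hIS : I ⊆ S)
    (hI : G.IsIndepSet (I : Set V)) : inducedValue (20 / 9) G S I ≤ expectedSize μ := by
  classical
  obtain ⟨out, hout, rfl⟩ := h
  rw [expectedSize_uniform_map]
  set N : ℝ := ((Fintype.card (S ≃ Fin S.card) : ℕ) : ℝ) with hN
  have hNpos : 0 < N := Nat.cast_pos.2 Fintype.card_pos
  -- The contribution of a vertex of rank `r` to 40|I ∩ G₄| + 15|G₄| - 10 ∑ rank; it is zero outside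
  -- G₄.
  let f : S → ℕ → ℝ := fun v r =>
    if r < 4 then (if (v : V) ∈ I then 40 else 0) + 15 - 10 * r else 0
  have hpath : ∀ π : S ≃ Fin S.card,
      ∑ v : S, f v (rankIn π (closedNbhd G S v) v) ≤ 72 * ((out π).card : ℝ) := by
    intro π
    set T := firstLayers 4 G S π with hT
    have h1 := (hout π).card_bound (I := I ∩ T) Finset.inter_subset_right
      (hI.mono (by simp))
    have h2 := adjCount_firstLayers_le 4 G S π
    rw [← hT] at h1 h2
    have hcard : ∀ (p : V → Prop) [DecidablePred p], (((T.filter p).card : ℕ) : ℝ)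
        = ∑ v : S with rankIn π (closedNbhd G S v) v < 4, if p v then 1 else 0 := by
      intro p _
      rw [Finset.card_filter, hT, firstLayers_eq_map, Finset.sum_map]
      push_cast
      rfl
    have h3 : ((I ∩ T).card : ℝ)
        = ∑ v : S with rankIn π (closedNbhd G S v) v < 4, if (v : V) ∈ I then 1 else 0 := by
      have := hcard fun v => v ∈ I
      rwa [Finset.filter_mem_eq_inter, Finset.inter_comm] at this
    have h4 : (T.card : ℝ) = ∑ v : S with rankIn π (closedNbhd G S v) v < 4, 1 := by
      have := hcard fun _ => True
      simpa using this
    have h1' : (40 * (I ∩ T).card + 15 * T.card : ℝ)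
        ≤ 72 * (out π).card + 5 * adjCount G T T := by exact_mod_cast h1
    have h2' : (adjCount G T T : ℝ) ≤ 2 * ∑ v : S with rankIn π (closedNbhd G S v) v < 4,
        (rankIn π (closedNbhd G S v) v : ℝ) := by exact_mod_cast h2
    have h5 : ∑ v : S, f v (rankIn π (closedNbhd G S v) v)
        = 40 * (I ∩ T).card + 15 * T.card
          - 10 * ∑ v : S with rankIn π (closedNbhd G S v) v < 4,
            (rankIn π (closedNbhd G S v) v : ℝ) := by
      rw [h3, h4, Finset.mul_sum, Finset.mul_sum, Finset.mul_sum, ← Finset.sum_add_distrib,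
        ← Finset.sum_sub_distrib, Finset.sum_filter]
      refine Finset.sum_congr rfl fun v _ => ?_
      simp only [f]
      split_ifs <;> ring
    rw [h5]
    linarith
  -- Since 4·15 = 10(0+1+2+3), only 4·40 = 160 survives, and only for vertices of `I`. Minimum
  -- degree three guarantees that all ranks 0,…,3 occur.
  have hsum : ∑ π : S ≃ Fin S.card, ∑ v : S, f v (rankIn π (closedNbhd G S v) v)
      = ∑ v : S, N / (((nbrs G S v).card : ℝ) + 1) * (if (v : V) ∈ I then 160 else 0) := by
    rw [Finset.sum_comm]
    refine Finset.sum_congr rfl fun v _ => ?_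
    rw [sum_comp_rankIn (self_mem_closedNbhd G S v) (f v), card_closedNbhd, ← hN]
    push_cast
    congr 1
    have h4 : 4 ≤ (nbrs G S (v : V)).card + 1 := by
      have := hmin v v.2
      omega
    rw [← Finset.sum_subset (Finset.range_subset_range.2 h4)]
    · simp only [Finset.sum_range_succ, Finset.sum_range_zero, f]
      norm_num
      split_ifs <;> norm_num
    · intro r _ hr
      have : ¬ r < 4 := by simpa using hr
      simp [f, this]
  have hI' : inducedValue (20 / 9) G S I
      ≤ ∑ v ∈ I, (20 / 9) / (((nbrs G S v).card : ℝ) + 1) :=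
    Finset.sum_le_sum fun v _ => min_le_right _ _
  refine hI'.trans ?_
  rw [le_div_iff₀ hNpos]
  have htot := Finset.sum_le_sum fun (π : S ≃ Fin S.card) (_ : π ∈ Finset.univ) => hpath π
  rw [hsum, ← Finset.mul_sum] at htot
  -- This is 160 = 72 · 20/9.
  have hconv : ∑ v : S, N / (((nbrs G S v).card : ℝ) + 1) * (if (v : V) ∈ I then 160 else 0)
      = 72 * ((∑ v ∈ I, (20 / 9) / (((nbrs G S v).card : ℝ) + 1)) * N) := by
    rw [Finset.sum_coe_sort S fun v : V =>
      N / (((nbrs G S v).card : ℝ) + 1) * (if v ∈ I then (160 : ℝ) else 0)]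
    simp only [mul_ite, mul_zero]
    rw [← Finset.sum_filter, Finset.filter_mem_eq_inter, Finset.inter_eq_right.2 hIS,
      Finset.sum_mul, Finset.mul_sum]
    refine Finset.sum_congr rfl fun v _ => ?_
    ring
  rw [hconv] at htot
  linarith

end PLG

/-! ### Elimination steps preserve the recoverable value. -/

section Elimination

variable {V : Type*} [DecidableEq V] [Fintype V]

theorem isIndepSet_map {μ : PMF (Finset V)} {f : Finset V → Finset V} {P Q : Finset V → Prop}
    (hμ : ∀ J ∈ μ.support, P J) (hf : ∀ J, P J → Q (f J)) : ∀ J ∈ (μ.map f).support, Q J := by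
  intro J hJ
  rw [PMF.support_map] at hJ
  obtain ⟨K, hK, rfl⟩ := hJ
  exact hf K (hμ K hK)

theorem min_one_div_anti {ρ a b : ℝ} (hρ : 0 ≤ ρ) (ha : 0 ≤ a) (hab : a ≤ b) :
    min 1 (ρ / (b + 1)) ≤ min 1 (ρ / (a + 1)) :=
  min_le_min_left _ (div_le_div_of_nonneg_left hρ (by linarith) (by linarith))

/-- Removing a set `D` of vertices, of which `I` contains at most one, costs at most one. -/
theorem inducedValue_le_add_one {ρ : ℝ} (hρ : 0 ≤ ρ) {G G' : SimpleGraph V}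
    {S S' I : Finset V} (I' : Finset V) (hI' : I' ⊆ I) (hcard : I.card ≤ I'.card + 1)
    (hdeg : ∀ x ∈ I', (nbrs G' S' x).card ≤ (nbrs G S x).card) :
    inducedValue ρ G S I ≤ inducedValue ρ G' S' I' + 1 := by
  rw [inducedValue, ← Finset.sum_sdiff hI', add_comm]
  refine add_le_add (Finset.sum_le_sum fun x hx => ?_) ?_
  · exact min_one_div_anti hρ (Nat.cast_nonneg _) (Nat.cast_le.2 (hdeg x hx))
  · refine (Finset.sum_le_card_nsmul _ _ 1 fun x _ => min_le_left _ _).trans ?_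
    rw [Finset.card_sdiff_of_subset hI', nsmul_eq_mul, mul_one]
    have : I.card - I'.card ≤ 1 := by omega
    exact_mod_cast this

/-- Used for a merge with both vertices in `I`, where `a`, `b`, `c` are degrees plus one. If the cap
is active for `c` it is trivial; otherwise monotonicity reduces it to `c = a + b - 3`. -/
theorem min_div_merge {a b c : ℝ} (ha : 3 ≤ a) (hb : 3 ≤ b) (hc : 0 < c) (hab : c ≤ a + b - 3) :
    min 1 (20 / 9 / a) + min 1 (20 / 9 / b) ≤ min 1 (20 / 9 / c) + 1 := by
  rcases le_or_gt 1 (20 / 9 / c) with h | h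
  · rw [min_eq_left h]
    exact add_le_add (min_le_left _ _) (min_le_left _ _)
  · rw [min_eq_right h.le]
    have h1 : 20 / 9 / (a + b - 3) ≤ 20 / 9 / c :=
      div_le_div_of_nonneg_left (by norm_num) hc hab
    have h2 : 20 / 9 / a + 20 / 9 / b ≤ 20 / 9 / (a + b - 3) + 1 := by
      have ha' : 0 < a := by linarith
      have hb' : 0 < b := by linarith
      have hd : 0 < a + b - 3 := by linarith
      rw [div_add_div _ _ ha'.ne' hb'.ne', div_add_one hd.ne', div_le_div_iff₀ (by positivity) hd]
      -- With σ = s + t and p = st, the right side minus the left side is (7/9)(3 + σ)² + (47/9)p +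
      -- pσ.
      obtain ⟨s, hs, rfl⟩ : ∃ s, 0 ≤ s ∧ a = 3 + s := ⟨a - 3, by linarith, by ring⟩
      obtain ⟨t, ht, rfl⟩ : ∃ t, 0 ≤ t ∧ b = 3 + t := ⟨b - 3, by linarith, by ring⟩
      nlinarith [mul_nonneg hs ht, mul_nonneg (mul_nonneg hs ht) ht,
        mul_nonneg (mul_nonneg hs ht) hs]
    have h3 : min 1 (20 / 9 / a) ≤ 20 / 9 / a := min_le_right _ _
    have h4 : min 1 (20 / 9 / b) ≤ 20 / 9 / b := min_le_right _ _
    linarith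

/-- The law `μ` lives on independent subsets of `S`, and its expected size is at least the
recoverable value of every independent subset of `S`. -/
def Recovers (ρ : ℝ) (G : SimpleGraph V) (S : Finset V) (μ : PMF (Finset V)) : Prop :=
  (∀ J ∈ μ.support, J ⊆ S ∧ G.IsIndepSet (J : Set V)) ∧
    ∀ I ⊆ S, G.IsIndepSet (I : Set V) → inducedValue ρ G S I ≤ expectedSize μ

theorem PLGLaw.recovers {G : SimpleGraph V} {S : Finset V} {μ : PMF (Finset V)}
    (hmin : ∀ x ∈ S, 3 ≤ (nbrs G S x).card) (h : PLGLaw 4 G S μ) :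
    Recovers (20 / 9) G S μ := by
  refine ⟨?_, fun I hIS hI => h.inducedValue_le hmin hIS hI⟩
  obtain ⟨out, hout, rfl⟩ := h
  intro J hJ
  rw [PMF.support_map] at hJ
  obtain ⟨π, _, rfl⟩ := hJ
  exact ⟨(hout π).subset.trans (firstLayers_subset 4 G S π), (hout π).isIndepSet⟩

/-- Taking `u` and removing `u` and its neighbours, which are pairwise adjacent. -/
theorem Recovers.take {ρ : ℝ} (hρ : 0 ≤ ρ) {G : SimpleGraph V} {S D : Finset V}
    {μ : PMF (Finset V)} {u : V} (hu : u ∈ S) (huD : u ∈ D) (hnb : nbrs G S u ⊆ D)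
    (hcl : ∀ I : Finset V, G.IsIndepSet (I : Set V) → (I ∩ D).card ≤ 1)
    (h : Recovers ρ G (S \ D) μ) : Recovers ρ G S (μ.map fun J => insert u J) := by
  refine ⟨isIndepSet_map h.1 fun J hJ => ⟨Finset.insert_subset hu
    (hJ.1.trans Finset.sdiff_subset), IsIndepSet.insert_of_not_adj hJ.2 fun x hx hadj => ?_⟩,
    fun I hIS hI => ?_⟩
  · have := Finset.mem_sdiff.1 (hJ.1 hx)
    exact this.2 (hnb (mem_nbrs.2 ⟨this.1, hadj⟩))
  · rw [expectedSize_map_succ]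
    · refine (inducedValue_le_add_one hρ (G' := G) (S' := S \ D) (I \ D) Finset.sdiff_subset ?_
        fun x _ => Finset.card_le_card (nbrs_mono G Finset.sdiff_subset x)).trans ?_
      · have := Finset.card_inter_add_card_sdiff I D
        have := hcl I hI
        omega
      · exact add_le_add_left (h.2 _ (Finset.sdiff_subset_sdiff hIS (Finset.Subset.refl _))
          (hI.mono (by simp))) _
    · intro J hJ
      exact Finset.card_insert_of_notMem fun huJ =>
        (Finset.mem_sdiff.1 ((h.1 J hJ).1 huJ)).2 huD

/-- If `I` contains `v` and `w`, the merged vertex stands for both. Otherwise `I` contains at most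
one of `u`, `v`, `w`, and dropping it costs at most one. Degrees of the other vertices do not grow:
a neighbour `w` is merely traded for `v`. -/
theorem Recovers.merge {G : SimpleGraph V} {S : Finset V} {μ : PMF (Finset V)} {u v w : V}
    (hu : u ∈ S) (hmin : ∀ x ∈ S, 2 ≤ (nbrs G S x).card) (hvw : v ≠ w)
    (hdeg : nbrs G S u = {v, w}) (hadj : ¬ G.Adj v w)
    (h : Recovers (20 / 9) (mergeInto G v w) (S \ {u, w}) μ) :
    Recovers (20 / 9) G S (μ.map fun J => if v ∈ J then insert w J else insert u J) := by
  have hv : v ∈ nbrs G S u := by simp [hdeg]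
  have hw : w ∈ nbrs G S u := by simp [hdeg]
  rw [mem_nbrs] at hv hw
  have huv := hv.2.ne
  have huw := hw.2.ne
  have hnb : ∀ x ∈ S, G.Adj u x → x = v ∨ x = w := by
    intro x hx hux
    have : x ∈ nbrs G S u := mem_nbrs.2 ⟨hx, hux⟩
    simpa [hdeg] using this
  have hindep : ∀ J : Finset V, (mergeInto G v w).IsIndepSet (J : Set V) →
      G.IsIndepSet (J : Set V) :=
    fun J hJ x hx y hy hxy hadj => hJ hx hy hxy ⟨hxy, Or.inl hadj⟩
  refine ⟨isIndepSet_map h.1 fun J hJ => ?_, fun I hIS hI => ?_⟩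
  · have hJS : ∀ x ∈ J, x ∈ S ∧ x ≠ u ∧ x ≠ w := by
      intro x hx
      simpa [not_or] using hJ.1 hx
    have hsub : J ⊆ S := fun x hx => (hJS x hx).1
    split_ifs with hvJ
    · refine ⟨Finset.insert_subset hw.1 hsub,
        IsIndepSet.insert_of_not_adj (hindep J hJ.2) fun x hx hwx => ?_⟩
      have hxv : x ≠ v := fun e => hadj (e ▸ hwx).symm
      exact hJ.2 hvJ hx hxv.symm ⟨hxv.symm, Or.inr (Or.inl ⟨rfl, hwx⟩)⟩
    · refine ⟨Finset.insert_subset hu hsub,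
        IsIndepSet.insert_of_not_adj (hindep J hJ.2) fun x hx hux => ?_⟩
      rcases hnb x (hJS x hx).1 hux with rfl | rfl
      · exact hvJ hx
      · exact (hJS x hx).2.2 rfl
  · rw [expectedSize_map_succ]
    · have hdegle : ∀ x ∈ S \ {u, w}, x ≠ v →
          (nbrs (mergeInto G v w) (S \ {u, w}) x).card ≤ (nbrs G S x).card := by
        intro x hx hxv
        have hx' : x ∈ S ∧ x ≠ u ∧ x ≠ w := by simpa [not_or] using hx
        by_cases hwx : G.Adj w x
        · have hsub : nbrs (mergeInto G v w) (S \ {u, w}) x ⊆ insert v ((nbrs G S x).erase w) := by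
            intro y hy
            rw [mem_nbrs] at hy
            have hy' : y ∈ S ∧ y ≠ u ∧ y ≠ w := by simpa [not_or] using hy.1
            rcases hy.2.2 with h | h | h
            · exact Finset.mem_insert_of_mem
                (Finset.mem_erase.2 ⟨hy'.2.2, mem_nbrs.2 ⟨hy'.1, h⟩⟩)
            · exact (hxv h.1).elim
            · exact h.1 ▸ Finset.mem_insert_self _ _
          refine (Finset.card_le_card hsub).trans ((Finset.card_insert_le _ _).trans ?_)
          rw [Finset.card_erase_of_mem (mem_nbrs.2 ⟨hw.1, hwx.symm⟩)]
          have := Finset.card_pos.2 ⟨w, mem_nbrs.2 ⟨hw.1, hwx.symm⟩⟩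
          omega
        · refine Finset.card_le_card fun y hy => ?_
          rw [mem_nbrs] at hy ⊢
          have hy' : y ∈ S ∧ y ≠ u ∧ y ≠ w := by simpa [not_or] using hy.1
          rcases hy.2.2 with h | h | h
          · exact ⟨hy'.1, h⟩
          · exact (hxv h.1).elim
          · exact (hwx h.2).elim
      -- If the merged vertex is kept, `w ∈ I` is what keeps the neighbours of `w` out of `J`.
      have hmerged : ∀ J ⊆ I, u ∉ J → w ∉ J → (v ∈ J → w ∈ I) →
          J ⊆ S \ {u, w} ∧ (mergeInto G v w).IsIndepSet (J : Set V) := by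
        intro J hJI huJ hwJ hvJ
        refine ⟨fun x hx => ?_, fun x hx y hy hxy hadj' => ?_⟩
        · have h1 : x ≠ u := fun e => huJ (e ▸ hx)
          have h2 : x ≠ w := fun e => hwJ (e ▸ hx)
          simp [hIS (hJI hx), h1, h2]
        · rcases hadj'.2 with hxy' | ⟨rfl, hwy⟩ | ⟨rfl, hwx⟩
          · exact hI (hJI hx) (hJI hy) hxy hxy'
          · exact hI (hvJ hx) (hJI hy) (fun e => hwJ (e ▸ hy)) hwy
          · exact hI (hvJ hy) (hJI hx) (fun e => hwJ (e ▸ hx)) hwx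
      by_cases hboth : v ∈ I ∧ w ∈ I
      · have huI : u ∉ I := fun huI => hI huI hboth.1 huv hv.2
        obtain ⟨h1, h2⟩ := hmerged (I.erase w) (Finset.erase_subset _ _)
          (fun h => huI (Finset.mem_of_mem_erase h)) (by simp) fun _ => hboth.2
        refine le_trans ?_ (add_le_add_left (h.2 _ h1 h2) 1)
        have hvI : v ∈ I.erase w := Finset.mem_erase.2 ⟨hvw, hboth.1⟩
        rw [inducedValue, inducedValue, ← Finset.add_sum_erase I _ hboth.2,
          ← Finset.add_sum_erase (I.erase w) _ hvI, ← Finset.add_sum_erase (I.erase w) _ hvI]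
        have hrest := Finset.sum_le_sum fun x (hx : x ∈ (I.erase w).erase v) =>
          min_one_div_anti (ρ := 20 / 9) (by norm_num) (Nat.cast_nonneg _) (Nat.cast_le.2
            (hdegle x (h1 (Finset.mem_of_mem_erase hx)) (Finset.ne_of_mem_erase hx)))
        -- The common neighbour `u` disappears from both neighbourhoods, whence the 2.
        have hcard : (nbrs (mergeInto G v w) (S \ {u, w}) v).card + 2
            ≤ (nbrs G S v).card + (nbrs G S w).card := by
          have hsub : nbrs (mergeInto G v w) (S \ {u, w}) v
              ⊆ (nbrs G S v).erase u ∪ (nbrs G S w).erase u := by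
            intro y hy
            rw [mem_nbrs] at hy
            have hy' : y ∈ S ∧ y ≠ u ∧ y ≠ w := by simpa [not_or] using hy.1
            rcases hy.2.2 with h | h | h
            · exact Finset.mem_union_left _ (Finset.mem_erase.2 ⟨hy'.2.1, mem_nbrs.2 ⟨hy'.1, h⟩⟩)
            · exact Finset.mem_union_right _
                (Finset.mem_erase.2 ⟨hy'.2.1, mem_nbrs.2 ⟨hy'.1, h.2⟩⟩)
            · exact (hy.2.1 h.1.symm).elim
          have h3 := (Finset.card_le_card hsub).trans (Finset.card_union_le _ _)
          rw [Finset.card_erase_of_mem (mem_nbrs.2 ⟨hu, hv.2.symm⟩),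
            Finset.card_erase_of_mem (mem_nbrs.2 ⟨hu, hw.2.symm⟩)] at h3
          have := hmin v hv.1
          have := hmin w hw.1
          omega
        have hv2 : (2 : ℝ) ≤ (nbrs G S v).card := by exact_mod_cast hmin v hv.1
        have hw2 : (2 : ℝ) ≤ (nbrs G S w).card := by exact_mod_cast hmin w hw.1
        have hc : ((nbrs (mergeInto G v w) (S \ {u, w}) v).card : ℝ) + 2
            ≤ (nbrs G S v).card + (nbrs G S w).card := by exact_mod_cast hcard
        have hmain := min_div_merge (a := (nbrs G S v).card + 1) (b := (nbrs G S w).card + 1)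
          (c := (nbrs (mergeInto G v w) (S \ {u, w}) v).card + 1) (by linarith) (by linarith)
          (by positivity) (by linarith)
        linarith
      · have key : ∀ J ⊆ I, u ∉ J → w ∉ J → v ∉ J → I.card ≤ J.card + 1 →
            inducedValue (20 / 9) G S I ≤ expectedSize μ + 1 := by
          intro J hJI huJ hwJ hvJ hcard
          obtain ⟨h1, h2⟩ := hmerged J hJI huJ hwJ fun h => (hvJ h).elim
          refine (inducedValue_le_add_one (by norm_num) J hJI hcard fun x hx =>
            hdegle x (h1 hx) fun e => hvJ (e ▸ hx)).trans (add_le_add_left (h.2 J h1 h2) 1)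
        by_cases huI : u ∈ I
        · refine key (I.erase u) (Finset.erase_subset _ _) (by simp)
            (fun h => hI huI (Finset.mem_of_mem_erase h) huw hw.2)
            (fun h => hI huI (Finset.mem_of_mem_erase h) huv hv.2) ?_
          rw [Finset.card_erase_of_mem huI]
          omega
        · by_cases hvI : v ∈ I
          · refine key (I.erase v) (Finset.erase_subset _ _)
              (fun h => huI (Finset.mem_of_mem_erase h))
              (fun h => hboth ⟨hvI, Finset.mem_of_mem_erase h⟩) (by simp) ?_
            rw [Finset.card_erase_of_mem hvI]
            omega
          -- Here `w` may or may not lie in `I`; erasing it costs at most one in either case.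
          · refine key (I.erase w) (Finset.erase_subset _ _)
              (fun h => huI (Finset.mem_of_mem_erase h)) (by simp)
              (fun h => hvI (Finset.mem_of_mem_erase h)) ?_
            exact Nat.sub_le_iff_le_add.1 Finset.pred_card_le_card_erase
    · intro J hJ
      have hJS : ∀ x ∈ J, x ∈ S ∧ x ≠ u ∧ x ≠ w := by
        intro x hx
        simpa [not_or] using (h.1 J hJ).1 hx
      split_ifs
      · exact Finset.card_insert_of_notMem fun hwJ => (hJS w hwJ).2.2 rfl
      · exact Finset.card_insert_of_notMem fun huJ => (hJS u huJ).2.1 rfl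

/-- The three rules that take `u` are one: `u` and its neighbours form a clique, which an
independent set meets at most once. -/
theorem EliminateThenPLG.recovers {G : SimpleGraph V} {S : Finset V} {μ : PMF (Finset V)}
    (h : EliminateThenPLG 4 G S μ) : Recovers (20 / 9) G S μ := by
  have hρ : (0 : ℝ) ≤ 20 / 9 := by norm_num
  have card_le : ∀ {G : SimpleGraph V} {D : Finset V},
      (∀ a ∈ D, ∀ b ∈ D, a ≠ b → G.Adj a b) →
      ∀ I : Finset V, G.IsIndepSet (I : Set V) → (I ∩ D).card ≤ 1 := by
    intro G D hD I hI
    refine Finset.card_le_one.2 fun a ha b hb => ?_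
    rw [Finset.mem_inter] at ha hb
    by_contra hab
    exact hI ha.1 hb.1 hab (hD a ha.2 b hb.2 hab)
  induction h with
  | isolated G S μ u hu hdeg _ ih =>
    exact ih.take hρ hu (by simp) (by simp [hdeg]) (card_le (by simp))
  | pendant G S μ u v hu hdeg _ ih =>
    have hv : v ∈ nbrs G S u := by simp [hdeg]
    rw [mem_nbrs] at hv
    refine ih.take hρ hu (by simp) (by simp [hdeg]) (card_le ?_)
    simp [hv.2, hv.2.symm]
  | triangle G S μ u v w hu _ _ hdeg hadj _ ih =>
    have hv : v ∈ nbrs G S u := by simp [hdeg]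
    have hw : w ∈ nbrs G S u := by simp [hdeg]
    rw [mem_nbrs] at hv hw
    refine ih.take hρ hu (by simp) (by rw [hdeg]; exact Finset.subset_insert _ _) (card_le ?_)
    simp [hv.2, hv.2.symm, hw.2, hw.2.symm, hadj, hadj.symm]
  | merge G S μ u v w hu hmin hvw hdeg hadj _ ih => exact ih.merge hu hmin hvw hdeg hadj
  | plg G S μ hmin h => exact h.recovers hmin

theorem EliminateThenPLG.hasCanonicalRecoverableValue {G : SimpleGraph V} {μ : PMF (Finset V)}
    (h : EliminateThenPLG 4 G Finset.univ μ) : HasCanonicalRecoverableValue (20 / 9) G μ := by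
  classical
  have hr := h.recovers
  refine ⟨fun J hJ => (hr.1 J hJ).2, fun I hI => ?_⟩
  refine le_of_eq_of_le ?_ (hr.2 I (Finset.subset_univ I) hI)
  refine Finset.sum_congr rfl fun v _ => ?_
  have : nbrs G Finset.univ v = G.neighborFinset v := by
    ext u
    simp [mem_nbrs]
  rw [this, SimpleGraph.card_neighborFinset_eq_degree]

end Elimination

/-! ### Running time of deterministic commands -/

section Machine

theorem Config.run_add (s t : ℕ) (c : Config) :
    Config.run (s + t) c = (Config.run s c).bind (Config.run t) := by
  induction s generalizing c with
  | zero => rw [Nat.zero_add, Config.run, PMF.pure_bind]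
  | succ s ih =>
    rw [Nat.succ_add, Config.run, Config.run, PMF.bind_bind]
    exact congrArg _ (funext ih)

/-- The command `c` deterministically leads from the memory `σ` to the memory `σ'` in `t` steps. -/
def Exec (c : Cmd) (σ : Store) (t : ℕ) (σ' : Store) : Prop :=
  ∀ k : List Cmd, Config.run t (c :: k, σ) = PMF.pure (k, σ')

theorem Config.run_succ_of_step {c c' : Config} (h : c.step = PMF.pure c') (t : ℕ) :
    Config.run (t + 1) c = Config.run t c' := by
  rw [Config.run, h, PMF.pure_bind]

theorem Exec.run_add {c : Cmd} {σ σ' : Store} {t : ℕ} (h : Exec c σ t σ') (s : ℕ)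
    (k : List Cmd) : Config.run (t + s) (c :: k, σ) = Config.run s (k, σ') := by
  rw [Config.run_add, h k, PMF.pure_bind]

/-- `c` deterministically halts from `σ` within `T` steps, in a memory that satisfies `Q`. -/
def Halts (c : Cmd) (T : ℕ) (σ : Store) (Q : Store → Prop) : Prop :=
  ∃ t ≤ T, ∃ σ', Exec c σ t σ' ∧ Q σ'

/-- The rules for `Halts` form a Hoare calculus with time bounds; the postcondition of one command
is the halting statement of the next, so sequences are handled by nesting. -/
theorem Halts.mono {c : Cmd} {T T' : ℕ} {σ : Store} {Q Q' : Store → Prop} (h : Halts c T σ Q)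
    (hT : T ≤ T') (hQ : ∀ σ', Q σ' → Q' σ') : Halts c T' σ Q' := by
  obtain ⟨t, ht, σ', he, hq⟩ := h
  exact ⟨t, ht.trans hT, σ', he, hQ _ hq⟩

theorem Halts.assign {i : ℕ} {e : Expr} {σ : Store} {Q : Store → Prop}
    (h : Q (Function.update σ i (e.eval σ))) : Halts (Cmd.assign i e) 1 σ Q :=
  ⟨1, le_rfl, _, fun k => by
    rw [Config.run_succ_of_step (c' := (k, Function.update σ i (e.eval σ))) rfl]
    rfl, h⟩

theorem Halts.seq {c d : Cmd} {T T' : ℕ} {σ : Store} {Q : Store → Prop}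
    (h : Halts c T σ fun σ' => Halts d T' σ' Q) : Halts (Cmd.seq c d) (T + T' + 1) σ Q := by
  obtain ⟨t, ht, σ', he, t', ht', σ'', he', hq⟩ := h
  refine ⟨t + t' + 1, by omega, σ'', fun k => ?_, hq⟩
  rw [Config.run_succ_of_step (c' := (c :: d :: k, σ)) rfl, he.run_add, he' k]

theorem Config.step_cond_nil {e : Expr} {c d : Cmd} {k : List Cmd} {σ : Store}
    (h : e.eval σ = Data.nil) : Config.step (Cmd.cond e c d :: k, σ) = PMF.pure (d :: k, σ) := by
  simp [Config.step, h]

theorem Config.step_cond_cons {e : Expr} {c d : Cmd} {k : List Cmd} {σ : Store} {a b : Data}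
    (h : e.eval σ = Data.cons a b) :
    Config.step (Cmd.cond e c d :: k, σ) = PMF.pure (c :: k, σ) := by
  simp [Config.step, h]

theorem Config.step_loop_nil {e : Expr} {c : Cmd} {k : List Cmd} {σ : Store}
    (h : e.eval σ = Data.nil) : Config.step (Cmd.loop e c :: k, σ) = PMF.pure (k, σ) := by
  simp [Config.step, h]

theorem Config.step_loop_cons {e : Expr} {c : Cmd} {k : List Cmd} {σ : Store} {a b : Data}
    (h : e.eval σ = Data.cons a b) :
    Config.step (Cmd.loop e c :: k, σ) = PMF.pure (c :: Cmd.loop e c :: k, σ) := by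
  simp [Config.step, h]

theorem Halts.cond {e : Expr} {c d : Cmd} {T T' : ℕ} {σ : Store} {Q : Store → Prop}
    (hnil : e.eval σ = Data.nil → Halts d T' σ Q)
    (hcons : ∀ a b, e.eval σ = Data.cons a b → Halts c T σ Q) :
    Halts (Cmd.cond e c d) (T + T' + 1) σ Q := by
  cases h : e.eval σ with
  | nil =>
    obtain ⟨t, ht, σ', he, hq⟩ := hnil h
    refine ⟨t + 1, by omega, σ', fun k => ?_, hq⟩
    rw [Config.run_succ_of_step (Config.step_cond_nil h), he k]
  | cons a b =>
    obtain ⟨t, ht, σ', he, hq⟩ := hcons a b h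
    refine ⟨t + 1, by omega, σ', fun k => ?_, hq⟩
    rw [Config.run_succ_of_step (Config.step_cond_cons h), he k]

theorem Halts.loop_nil {e : Expr} {c : Cmd} {σ : Store} {Q : Store → Prop}
    (h : e.eval σ = Data.nil) (hQ : Q σ) : Halts (Cmd.loop e c) 1 σ Q :=
  ⟨1, le_rfl, σ, fun k => by
    rw [Config.run_succ_of_step (Config.step_loop_nil h)]
    rfl, hQ⟩

theorem Halts.loop_cons {e : Expr} {c : Cmd} {T T' : ℕ} {σ : Store} {Q : Store → Prop}
    {a b : Data} (h : e.eval σ = Data.cons a b)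
    (hc : Halts c T σ fun σ' => Halts (Cmd.loop e c) T' σ' Q) :
    Halts (Cmd.loop e c) (T + T' + 1) σ Q := by
  obtain ⟨t, ht, σ', he, t', ht', σ'', he', hq⟩ := hc
  refine ⟨t + t' + 1, by omega, σ'', fun k => ?_, hq⟩
  rw [Config.run_succ_of_step (Config.step_loop_cons h), he.run_add, he' k]

/-! ### Commands that compute functions

The variable `0` holds the argument and the value, the variable `1` a stack, and the variable `2`
the number of vertices in unary notation. -/

/-- The unary representation of a natural number. -/
def unary : ℕ → Data
  | 0 => Data.nil
  | n + 1 => Data.cons Data.nil (unary n)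

/-- The command `c` replaces the value `a` of the variable `0` by `b` within `T` steps. -/
def Maps (c : Cmd) (T n : ℕ) (a b : Data) : Prop :=
  ∀ (σ : Store) (Q : Store → Prop), σ 0 = a → σ 2 = unary n →
    (∀ σ', σ' 0 = b → σ' 1 = σ 1 → σ' 2 = unary n → Q σ') → Halts c T σ Q

theorem Maps.mono {c : Cmd} {T T' n : ℕ} {a b : Data} (h : Maps c T n a b) (hT : T ≤ T') :
    Maps c T' n a b :=
  fun σ Q h0 h2 hQ => (h σ Q h0 h2 hQ).mono hT fun _ => id

theorem Maps.assign {e : Expr} {n : ℕ} {a b : Data}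
    (h : ∀ σ : Store, σ 0 = a → σ 2 = unary n → e.eval σ = b) :
    Maps (Cmd.assign 0 e) 1 n a b := by
  intro σ Q h0 h2 hQ
  refine Halts.assign (hQ _ ?_ ?_ ?_)
  · simp [h σ h0 h2]
  · simp
  · simp [h2]

theorem Maps.comp {c d : Cmd} {S T n : ℕ} {x y z : Data} (hd : Maps d T n y z)
    (hc : Maps c S n x y) : Maps (Cmd.seq c d) (S + T + 1) n x z := by
  intro σ Q h0 h2 hQ
  refine Halts.seq (hc σ _ h0 h2 fun σ' h0' h1' h2' => hd σ' _ h0' h2' fun σ'' a b c => ?_)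
  exact hQ σ'' a (b.trans h1') c

/-- Run `c` and `d` on the same argument and combine the results to a pair. -/
def Cmd.pairing (c d : Cmd) : Cmd :=
  .seq (.assign 1 (.cons (.var 0) (.var 1))) <| .seq c <| .seq (.assign 3 (.var 0)) <|
  .seq (.assign 0 (.hd (.var 1))) <| .seq (.assign 1 (.cons (.var 3) (.tl (.var 1)))) <|
  .seq d <| .seq (.assign 0 (.cons (.hd (.var 1)) (.var 0))) (.assign 1 (.tl (.var 1)))

/-- The argument waits on the stack while `c` runs, and the value of `c` waits there while `d` runs.
This works because `Maps` demands that the stack be restored. -/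
theorem Maps.pairing {c d : Cmd} {S T n : ℕ} {x y z : Data} (hc : Maps c S n x y)
    (hd : Maps d T n x z) : Maps (Cmd.pairing c d) (S + T + 13) n x (Data.cons y z) := by
  intro σ Q h0 h2 hQ
  refine Halts.mono (Halts.seq <| Halts.assign <| Halts.seq <| hc _ _ (by simp [h0]) (by simp [h2])
    fun σ' h0' h1' h2' => Halts.seq <| Halts.assign <| Halts.seq <| Halts.assign <| Halts.seq <|
    Halts.assign <| Halts.seq <| hd _ _ ?_ ?_ fun σ'' h0'' h1'' h2'' => Halts.seq <|
    Halts.assign <| Halts.assign <| hQ _ ?_ ?_ ?_) (by omega) fun _ => id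
  all_goals simp_all [Expr.eval]

/-- Compute a list with `c`; depending on whether it is empty, run `e` on the argument or `d` on the
argument paired with the list. -/
def Cmd.branch (c d e : Cmd) : Cmd :=
  .seq (.assign 1 (.cons (.var 0) (.var 1))) <| .seq c <| .seq (.assign 3 (.var 0)) <|
  .seq (.assign 0 (.hd (.var 1))) <| .seq (.assign 1 (.tl (.var 1))) <|
  .cond (.var 3) (.seq (.assign 0 (.cons (.var 0) (.var 3))) d) e

theorem Maps.branch {c d e : Cmd} {S T U n : ℕ} {x y z : Data} (hc : Maps c S n x y)
    (hd : y ≠ Data.nil → Maps d T n (Data.cons x y) z) (he : y = Data.nil → Maps e U n x z) :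
    Maps (Cmd.branch c d e) (S + T + U + 13) n x z := by
  intro σ Q h0 h2 hQ
  refine Halts.mono (Halts.seq <| Halts.assign <| Halts.seq <| hc _ _ (by simp [h0]) (by simp [h2])
    fun σ' h0' h1' h2' => Halts.seq <| Halts.assign <| Halts.seq <| Halts.assign <| Halts.seq <|
    Halts.assign <| Halts.cond (T := T + 2) (T' := U) (fun h => ?_) fun a b h =>
      (Halts.mono (T := 1 + T + 1) (Halts.seq <| Halts.assign ?_) (by omega) fun _ => id))
    (by omega) fun _ => id
  · simp only [Expr.eval] at h
    have hy : y = Data.nil := by simpa [h0'] using h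
    refine he hy _ _ ?_ ?_ fun σ'' h0'' h1'' h2'' => hQ _ h0'' ?_ h2''
    all_goals simp_all [Expr.eval]
  · have hy : y ≠ Data.nil := by
      rintro rfl
      simp [Expr.eval, h0'] at h
    refine hd hy _ _ ?_ ?_ fun σ'' h0'' h1'' h2'' => hQ _ h0'' ?_ h2''
    all_goals simp_all [Expr.eval]

/-- Starting with the second component of the argument, apply `c` once for every vertex. -/
def Cmd.forVertices (c : Cmd) : Cmd :=
  .seq (.assign 1 (.cons (.cons (.var 2) (.hd (.var 0))) (.var 1))) <|
  .seq (.assign 0 (.tl (.var 0))) <|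
  .seq (.loop (.hd (.hd (.var 1))) (
    .seq (.assign 1 (.cons (.cons (.tl (.hd (.hd (.var 1)))) (.tl (.hd (.var 1))))
      (.tl (.var 1)))) <|
    .seq (.assign 0 (.cons (.tl (.hd (.var 1))) (.cons (.hd (.hd (.var 1))) (.var 0)))) c))
  (.assign 1 (.tl (.var 1)))

/-- The top of the stack holds a unary counter paired with the fixed `x`. The counter is decremented
before the body runs, so the indices come as n-1,…,0, the order of `Fin.foldr`. -/
theorem Maps.forVertices {β : Type} {c : Cmd} {T n : ℕ} {x : Data} (e : β → Data)
    (g : Fin n → β → β) (a : β)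
    (hc : ∀ (i : Fin n) a, Maps c T n (Data.cons x (Data.cons (unary i) (e a))) (e (g i a))) :
    Maps (Cmd.forVertices c) (n * (T + 5) + 7) n (Data.cons x (e a)) (e (Fin.foldr n g a)) := by
  have hloop : ∀ m (hm : m ≤ n) (a : β) (σ : Store) (s : Data) (Q : Store → Prop),
      σ 0 = e a → σ 1 = Data.cons (Data.cons (unary m) x) s → σ 2 = unary n →
      (∀ σ', σ' 0 = e (Fin.foldr m (fun i => g (i.castLE hm)) a) →
        σ' 1 = Data.cons (Data.cons Data.nil x) s → σ' 2 = unary n → Q σ') →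
      Halts (.loop (.hd (.hd (.var 1))) (
        .seq (.assign 1 (.cons (.cons (.tl (.hd (.hd (.var 1)))) (.tl (.hd (.var 1))))
          (.tl (.var 1)))) <|
        .seq (.assign 0 (.cons (.tl (.hd (.var 1))) (.cons (.hd (.hd (.var 1))) (.var 0)))) c))
        (m * (T + 5) + 1) σ Q := by
    intro m
    induction m with
    | zero =>
      intro hm a σ s Q h0 h1 h2 hQ
      refine Halts.mono (Halts.loop_nil (by simp [Expr.eval, h1, unary]) (hQ σ ?_ ?_ h2))
        (by omega) fun _ => id
      · simp [h0]
      · simp [h1, unary]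
    | succ m ih =>
      intro hm a σ s Q h0 h1 h2 hQ
      refine Halts.mono (Halts.loop_cons (T := 1 + (1 + T + 1) + 1) (T' := m * (T + 5) + 1)
        (a := Data.nil) (b := unary m) (by simp [Expr.eval, h1, unary])
        (Halts.seq <| Halts.assign <| Halts.seq <| Halts.assign <|
          hc ⟨m, hm⟩ a _ _ ?_ ?_ fun σ' h0' h1' h2' =>
          ih (Nat.le_of_succ_le hm) _ σ' s Q h0' ?_ h2'
            fun σ'' h0'' h1'' h2'' => hQ σ'' ?_ h1'' h2''))
        (by rw [Nat.succ_mul]; omega) fun _ => id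
      · simp [Expr.eval, h0, h1, unary]
      · simp [h2]
      · simp [h1', Expr.eval, h1, unary]
      · rw [h0'', Fin.foldr_succ_last]
        rfl
  intro σ Q h0 h2 hQ
  refine Halts.mono (Halts.seq <| Halts.assign <| Halts.seq <| Halts.assign <| Halts.seq <|
    hloop n le_rfl a _ (σ 1) _ ?_ ?_ ?_ fun σ' h0' h1' h2' => Halts.assign <| hQ _ ?_ ?_ ?_)
    (by omega) fun _ => id
  all_goals simp_all [Expr.eval]

end Machine

/-! ### Polynomial time computable families of functions -/

section PolyTime

/-- Types whose elements are represented by trees. -/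
class Enc (α : Type) where
  /-- The representation of an element. -/
  enc : α → Data

open Enc (enc)

instance : Enc Data := ⟨id⟩
instance : Enc Bool := ⟨Data.ofBool⟩
instance : Enc ℕ := ⟨unary⟩
instance {n : ℕ} : Enc (Fin n) := ⟨fun i => unary i⟩
instance {α β : Type} [Enc α] [Enc β] : Enc (α × β) := ⟨fun x => Data.cons (enc x.1) (enc x.2)⟩
instance {α : Type} [Enc α] : Enc (List α) := ⟨fun l => Data.ofList (l.map enc)⟩
instance {α : Type} [Enc α] {n : ℕ} : Enc (Fin n → α) :=
  ⟨fun f => Data.ofList (List.ofFn fun i => enc (f i))⟩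

variable {α β γ δ : ℕ → Type} [∀ n, Enc (α n)] [∀ n, Enc (β n)] [∀ n, Enc (γ n)] [∀ n, Enc (δ n)]

/-- The functions `f n` are computed by one command, in time polynomial in `n`. -/
def PolyTime (f : ∀ n, α n → β n) : Prop :=
  ∃ (c : Cmd) (p : Polynomial ℕ), ∀ n x, Maps c (p.eval n) n (enc x) (enc (f n x))

/-- One assignment is one step, whatever the sizes of the trees involved. -/
theorem PolyTime.of_expr {f : ∀ n, α n → β n} (e : Expr)
    (h : ∀ n x (σ : Store), σ 0 = enc x → σ 2 = unary n → e.eval σ = enc (f n x)) :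
    PolyTime f :=
  ⟨Cmd.assign 0 e, 1, fun n x => by
    rw [Polynomial.eval_one]
    exact Maps.assign (h n x)⟩

/-- Commands see only trees, so changing the type without changing the encoding is free. -/
theorem PolyTime.recode {f : ∀ n, α n → β n} (hf : PolyTime f) {g : ∀ n, α n → γ n}
    (h : ∀ n x, enc (g n x) = enc (f n x)) : PolyTime g := by
  obtain ⟨c, p, hc⟩ := hf
  exact ⟨c, p, fun n x => h n x ▸ hc n x⟩

theorem PolyTime.congr {f g : ∀ n, α n → β n} (hf : PolyTime f) (h : ∀ n x, g n x = f n x) :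
    PolyTime g :=
  hf.recode fun n x => by rw [h n x]

theorem PolyTime.comp {g : ∀ n, β n → γ n} {f : ∀ n, α n → β n} (hg : PolyTime g)
    (hf : PolyTime f) : PolyTime fun n x => g n (f n x) := by
  obtain ⟨c, p, hc⟩ := hf
  obtain ⟨d, q, hd⟩ := hg
  refine ⟨Cmd.seq c d, p + q + 1, fun n x => ?_⟩
  simpa using (hd n (f n x)).comp (hc n x)

theorem PolyTime.id : PolyTime fun n (x : α n) => x :=
  .of_expr (.var 0) fun _ _ _ h _ => h

theorem PolyTime.fst {f : ∀ n, α n → β n × γ n} (hf : PolyTime f) :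
    PolyTime fun n x => (f n x).1 :=
  .comp (g := fun _ y => y.1) (.of_expr (.hd (.var 0)) fun n x σ h _ => by
    simp [Expr.eval, h, enc]) hf

theorem PolyTime.snd {f : ∀ n, α n → β n × γ n} (hf : PolyTime f) :
    PolyTime fun n x => (f n x).2 :=
  .comp (g := fun _ y => y.2) (.of_expr (.tl (.var 0)) fun n x σ h _ => by
    simp [Expr.eval, h, enc]) hf

theorem PolyTime.pair {f : ∀ n, α n → β n} {g : ∀ n, α n → γ n} (hf : PolyTime f)
    (hg : PolyTime g) : PolyTime fun n x => (f n x, g n x) := by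
  obtain ⟨c, p, hc⟩ := hf
  obtain ⟨d, q, hd⟩ := hg
  refine ⟨Cmd.pairing c d, p + q + 13, fun n x => ?_⟩
  exact ((hc n x).pairing (hd n x)).mono (by simp)

theorem PolyTime.true : PolyTime fun n (_ : α n) => true :=
  .of_expr (.cons .nil .nil) fun _ _ _ _ _ => rfl

theorem PolyTime.false : PolyTime fun n (_ : α n) => false :=
  .of_expr .nil fun _ _ _ _ _ => rfl

theorem PolyTime.zero : PolyTime fun n (_ : α n) => (0 : ℕ) :=
  .of_expr .nil fun _ _ _ _ _ => rfl

theorem PolyTime.size : PolyTime fun n (_ : α n) => n :=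
  .of_expr (.var 2) fun _ _ _ _ h => h

theorem PolyTime.succ {f : ∀ n, α n → ℕ} (hf : PolyTime f) :
    PolyTime fun n x => f n x + 1 :=
  .comp (g := fun _ (k : ℕ) => k + 1) (.of_expr (.cons .nil (.var 0)) fun n x σ h _ => by
    simp [Expr.eval, h, enc, unary]) hf

theorem PolyTime.pred {f : ∀ n, α n → ℕ} (hf : PolyTime f) :
    PolyTime fun n x => f n x - 1 :=
  .comp (g := fun _ (k : ℕ) => k - 1) (.of_expr (.tl (.var 0)) fun n x σ h _ => by
    cases x <;> simp [Expr.eval, h, enc, unary]) hf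

theorem PolyTime.val {f : ∀ n, α n → Fin n} (hf : PolyTime f) :
    PolyTime fun n x => (f n x : ℕ) :=
  hf.recode fun _ _ => rfl

theorem PolyTime.nil : PolyTime fun n (_ : α n) => ([] : List (β n)) :=
  .of_expr .nil fun _ _ _ _ _ => rfl

theorem PolyTime.cons {f : ∀ n, α n → β n} {g : ∀ n, α n → List (β n)} (hf : PolyTime f)
    (hg : PolyTime g) : PolyTime fun n x => f n x :: g n x :=
  (hf.pair hg).recode fun _ _ => rfl

theorem PolyTime.ite {b : ∀ n, α n → Bool} {f g : ∀ n, α n → β n} (hb : PolyTime b)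
    (hf : PolyTime f) (hg : PolyTime g) :
    PolyTime fun n x => if b n x = Bool.true then f n x else g n x := by
  obtain ⟨c, p, hc⟩ := hb
  -- `Cmd.branch` hands its nonempty branch the argument paired with the tested value; the
  -- projection discards that value.
  obtain ⟨d, q, hd⟩ := PolyTime.comp (γ := β) (f := fun n (y : α n × Data) => y.1) hf
    (PolyTime.fst .id)
  obtain ⟨e, r, he⟩ := hg
  refine ⟨Cmd.branch c d e, p + q + r + 13, fun n x => ?_⟩
  have h := (hc n x).branch (d := d) (e := e) (T := q.eval n) (U := r.eval n)
    (z := enc (if b n x = Bool.true then f n x else g n x))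
    (fun hne => ?_) (fun heq => ?_)
  · simpa using h
  · cases hb : b n x
    · exact (hne (by rw [hb]; rfl)).elim
    · exact hd n (x, enc Bool.true)
  · cases hb : b n x
    · exact he n x
    · rw [hb] at heq
      cases heq

/-- Case distinction on a list. -/
def listCases {A B : Type} (l : List A) (b : B) (c : A → List A → B) : B :=
  match l with
  | [] => b
  | a :: t => c a t

@[simp] theorem listCases_nil {A B : Type} (b : B) (c : A → List A → B) :
    listCases [] b c = b := rfl

@[simp] theorem listCases_cons {A B : Type} (a : A) (t : List A) (b : B) (c : A → List A → B) :
    listCases (a :: t) b c = c a t := rfl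

theorem PolyTime.listCases {l : ∀ n, α n → List (β n)} {f : ∀ n, α n → γ n}
    {g : ∀ n, α n → β n → List (β n) → γ n} (hl : PolyTime l) (hf : PolyTime f)
    (hg : PolyTime fun n (y : α n × β n × List (β n)) => g n y.1 y.2.1 y.2.2) :
    PolyTime fun n x => listCases (l n x) (f n x) fun a t => g n x a t := by
  obtain ⟨c, p, hc⟩ := hl
  obtain ⟨d, q, hd⟩ := hg
  obtain ⟨e, r, he⟩ := hf
  refine ⟨Cmd.branch c d e, p + q + r + 13, fun n x => ?_⟩
  have h := (hc n x).branch (d := d) (e := e) (T := q.eval n) (U := r.eval n)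
    (z := enc (_root_.listCases (l n x) (f n x) fun a t => g n x a t))
    (fun hne => ?_) (fun heq => ?_)
  · simpa using h
  · cases hb : l n x with
    | nil => exact (hne (by rw [hb]; rfl)).elim
    | cons a t => exact hd n (x, a, t)
  · cases hb : l n x with
    | nil => exact he n x
    | cons a t =>
      rw [hb] at heq
      cases heq

/-- The bound for the body holds for every accumulator, so `n` rounds remain polynomial even if the
accumulator grows. -/
theorem PolyTime.foldr {g : ∀ n, α n → Fin n → β n → β n} {a : ∀ n, α n → β n}
    (hg : PolyTime fun n (y : α n × Fin n × β n) => g n y.1 y.2.1 y.2.2) (ha : PolyTime a) :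
    PolyTime fun n x => Fin.foldr n (fun i b => g n x i b) (a n x) := by
  obtain ⟨c, p, hc⟩ := hg
  have h : PolyTime fun n (y : α n × β n) => Fin.foldr n (g n y.1) y.2 :=
    ⟨Cmd.forVertices c, Polynomial.X * (p + 5) + 7, fun n y => by
      exact (Maps.forVertices enc (g n y.1) y.2 fun i a => hc n (y.1, i, a)).mono (by simp)⟩
  exact h.comp (f := fun n x => (x, a n x)) (PolyTime.id.pair ha)

theorem Fin.foldr_const {B : Type} (n : ℕ) (f : B → B) (b : B) :
    Fin.foldr n (fun _ => f) b = f^[n] b := by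
  induction n with
  | zero => simp
  | succ n ih => rw [Fin.foldr_succ, ih, Function.iterate_succ_apply']

theorem PolyTime.iterate {f : ∀ n, α n → β n → β n} {a : ∀ n, α n → β n}
    (hf : PolyTime fun n (y : α n × β n) => f n y.1 y.2) (ha : PolyTime a) :
    PolyTime fun n x => (f n x)^[n] (a n x) := by
  refine (PolyTime.foldr (g := fun n x _ b => f n x b) ?_ ha).congr fun n x =>
    (Fin.foldr_const n _ _).symm
  exact hf.comp (f := fun n (y : α n × Fin n × β n) => (y.1, y.2.2))
    ((PolyTime.fst .id).pair (PolyTime.snd (PolyTime.snd .id)))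

/-- Tabulation: the last index is treated first, so consing produces the table in increasing order.
-/
theorem PolyTime.lam {g : ∀ n, α n → Fin n → β n}
    (hg : PolyTime fun n (y : α n × Fin n) => g n y.1 y.2) :
    PolyTime fun n x => fun i => g n x i := by
  have h : PolyTime fun n x => Fin.foldr n (fun i l => g n x i :: l) [] := by
    refine PolyTime.foldr (.cons ?_ (.snd (.snd .id))) .nil
    exact hg.comp (f := fun n (y : α n × Fin n × List (β n)) => (y.1, y.2.1))
      ((PolyTime.fst .id).pair (PolyTime.fst (PolyTime.snd .id)))
  refine h.recode fun n x => ?_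
  change Data.ofList (List.ofFn fun i => enc (g n x i)) = Data.ofList (List.map enc (List.ofFn _))
  rw [List.map_ofFn]
  rfl

namespace Data

/-- The head of a tree. -/
def head : Data → Data
  | nil => nil
  | cons a _ => a

/-- The tail of a tree. -/
def tail : Data → Data
  | nil => nil
  | cons _ b => b

theorem tail_ofList (l : List Data) : (ofList l).tail = ofList l.tail := by
  cases l <;> rfl

theorem iterate_tail_ofList (l : List Data) (k : ℕ) :
    tail^[k] (ofList l) = ofList (l.drop k) := by
  induction k generalizing l with
  | zero => rfl
  | succ k ih => rw [Function.iterate_succ_apply, tail_ofList, ih, List.drop_tail]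

/-- One step of the search for an entry of a list with a given index. -/
def advance (y : Data × ℕ) : Data × ℕ :=
  if decide (y.2 = 0) = Bool.true then y else (y.1.tail, y.2 - 1)

/-- At index zero the step is idle, so a fixed number of rounds serves all smaller indices. -/
theorem iterate_advance (m : ℕ) : ∀ k ≤ m, ∀ d : Data, advance^[m] (d, k) = (tail^[k] d, 0) := by
  induction m with
  | zero =>
    intro k hk d
    obtain rfl := Nat.le_zero.1 hk
    rfl
  | succ m ih =>
    intro k hk d
    rw [Function.iterate_succ_apply]
    cases k with
    | zero => exact ih 0 (Nat.zero_le _) d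
    | succ k => exact ih k (Nat.le_of_succ_le_succ hk) d.tail

end Data

/-- A unary number has the same encoding as a list of `nil`s, so the test is a case distinction on a
list. -/
theorem PolyTime.isZero {f : ∀ n, α n → ℕ} (hf : PolyTime f) :
    PolyTime fun n x => decide (f n x = 0) := by
  have h : PolyTime fun n x => _root_.listCases (List.replicate (f n x) Data.nil) Bool.true
      fun _ _ => Bool.false := by
    refine .listCases (hf.recode fun n x => ?_) .true .false
    induction f n x with
    | zero => rfl
    | succ k ih => exact congrArg (Data.cons Data.nil) ih
  refine h.congr fun n x => ?_
  cases f n x <;> rfl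

theorem PolyTime.app {f : ∀ n, α n → Fin n → β n} {i : ∀ n, α n → Fin n} (hf : PolyTime f)
    (hi : PolyTime i) : PolyTime fun n x => f n x (i n x) := by
  have hd : PolyTime (α := fun _ => Data) (β := fun _ => Data) fun _ d => d.head :=
    .of_expr (.hd (.var 0)) fun n x σ h _ => by cases x <;> simp [Expr.eval, h, enc, Data.head]
  have tl : PolyTime (α := fun _ => Data) (β := fun _ => Data) fun _ d => d.tail :=
    .of_expr (.tl (.var 0)) fun n x σ h _ => by cases x <;> simp [Expr.eval, h, enc, Data.tail]
  have step : PolyTime (α := fun n => α n × Data × ℕ) (β := fun _ => Data × ℕ)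
      fun _ y => Data.advance y.2 :=
    .ite (.isZero (.snd (.snd .id))) (.snd .id)
      (.pair (tl.comp (.fst (.snd .id))) (.pred (.snd (.snd .id))))
  have h := hd.comp (.fst (.iterate (f := fun n (_ : α n) (y : Data × ℕ) => Data.advance y) step
    (.pair (hf.recode (g := fun n x => (enc (f n x) : Data)) fun _ _ => rfl) hi.val)))
  refine h.recode fun n x => ?_
  have hlt : (i n x : ℕ) < (List.ofFn fun j => enc (f n x j)).length := by simp
  rw [Data.iterate_advance n _ (i n x).2.le]
  change _ = Data.head (Data.tail^[(i n x : ℕ)] (Data.ofList _))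
  rw [Data.iterate_tail_ofList, List.drop_eq_getElem_cons hlt]
  simp [Data.ofList, Data.head]

/-- Comparison of `a` and `b`, which is correct for `a ≤ n`. -/
def natLe (n a b : ℕ) : Bool :=
  decide (((fun y : ℕ × ℕ => if decide (y.2 = 0) = true then y else (y.1 - 1, y.2 - 1))^[n]
    (a, b)).1 = 0)

/-- After `m` rounds of joint decrement the first number is `a - min b m`; cutting `b` off at `n` is
harmless when `a ≤ n`. -/
theorem natLe_iff {n a b : ℕ} (h : a ≤ n) : natLe n a b = true ↔ a ≤ b := by
  have key : ∀ m a b : ℕ,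
      ((fun y : ℕ × ℕ => if decide (y.2 = 0) = true then y else (y.1 - 1, y.2 - 1))^[m]
        (a, b)).1 = a - min b m := by
    intro m
    induction m with
    | zero => simp
    | succ m ih =>
      intro a b
      rw [Function.iterate_succ_apply]
      cases b with
      | zero => simpa using ih a 0
      | succ b =>
        simp only [Nat.add_eq_zero_iff, one_ne_zero, and_false, decide_false, Bool.false_eq_true,
          if_false, Nat.add_sub_cancel, ih]
        omega
  rw [natLe, key, decide_eq_true_iff]
  omega

theorem PolyTime.natLe {f g : ∀ n, α n → ℕ} (hf : PolyTime f) (hg : PolyTime g) :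
    PolyTime fun n x => natLe n (f n x) (g n x) :=
  .isZero (.fst (.iterate (.ite (.isZero (.snd (.snd .id))) (.snd .id)
    (.pair (.pred (.fst (.snd .id))) (.pred (.snd (.snd .id))))) (.pair hf hg)))

theorem PolyTime.and {f g : ∀ n, α n → Bool} (hf : PolyTime f) (hg : PolyTime g) :
    PolyTime fun n x => (f n x && g n x) :=
  (PolyTime.ite hf hg .false).congr fun n x => by cases f n x <;> rfl

theorem PolyTime.or {f g : ∀ n, α n → Bool} (hf : PolyTime f) (hg : PolyTime g) :
    PolyTime fun n x => (f n x || g n x) :=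
  (PolyTime.ite hf .true hg).congr fun n x => by cases f n x <;> rfl

theorem PolyTime.not {f : ∀ n, α n → Bool} (hf : PolyTime f) : PolyTime fun n x => !(f n x) :=
  (PolyTime.ite hf .false .true).congr fun n x => by cases f n x <;> rfl

theorem PolyTime.eq {f g : ∀ n, α n → Fin n} (hf : PolyTime f) (hg : PolyTime g) :
    PolyTime fun n x => decide (f n x = g n x) := by
  refine ((hf.val.natLe hg.val).and (hg.val.natLe hf.val)).congr fun n x => ?_
  rw [Bool.eq_iff_iff, decide_eq_true_iff, Bool.and_eq_true, natLe_iff (f n x).2.le,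
    natLe_iff (g n x).2.le, Fin.ext_iff]
  omega

/-- The elements of a set of vertices in increasing order. -/
def setList {n : ℕ} (s : Fin n → Bool) : List (Fin n) :=
  Fin.foldr n (fun i l => if s i = true then i :: l else l) []

/-- Whether a set of vertices is nonempty. -/
def anyFin {n : ℕ} (s : Fin n → Bool) : Bool := listCases (setList s) false fun _ _ => true

/-- Whether a set of vertices contains all vertices. -/
def allFin {n : ℕ} (s : Fin n → Bool) : Bool := !anyFin fun i => !s i

/-- The cardinality of a set of vertices. -/
def count {n : ℕ} (s : Fin n → Bool) : ℕ :=
  Fin.foldr n (fun i k => if s i = true then k + 1 else k) 0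

theorem PolyTime.setList {s : ∀ n, α n → Fin n → Bool}
    (hs : PolyTime fun n (y : α n × Fin n) => s n y.1 y.2) :
    PolyTime fun n x => setList fun i => s n x i :=
  .foldr (.ite (hs.comp (.pair (.fst .id) (.fst (.snd .id))))
    (.cons (.fst (.snd .id)) (.snd (.snd .id))) (.snd (.snd .id))) .nil

theorem PolyTime.anyFin {s : ∀ n, α n → Fin n → Bool}
    (hs : PolyTime fun n (y : α n × Fin n) => s n y.1 y.2) :
    PolyTime fun n x => anyFin fun i => s n x i :=
  .listCases (.setList hs) .false .true

theorem PolyTime.allFin {s : ∀ n, α n → Fin n → Bool}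
    (hs : PolyTime fun n (y : α n × Fin n) => s n y.1 y.2) :
    PolyTime fun n x => allFin fun i => s n x i :=
  .not (.anyFin (.not hs))

theorem PolyTime.count {s : ∀ n, α n → Fin n → Bool}
    (hs : PolyTime fun n (y : α n × Fin n) => s n y.1 y.2) :
    PolyTime fun n x => count fun i => s n x i :=
  .foldr (.ite (hs.comp (.pair (.fst .id) (.fst (.snd .id))))
    (.succ (.snd (.snd .id))) (.snd (.snd .id))) .zero

end PolyTime

/-! ### The algorithm as a family of functions -/

section Algorithm

/-- Sets of vertices. -/
abbrev VSet (n : ℕ) : Type := Fin n → Bool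

/-- Adjacency matrices. -/
abbrev Mat (n : ℕ) : Type := Fin n → Fin n → Bool

/-- Records of elimination steps, the last one first. -/
abbrev Trace (n : ℕ) : Type := List (Fin n × Fin n × Fin n)

variable {n : ℕ}

/-- The vertices of minimum degree in the subgraph induced on `S`. -/
def minVertices (A : Mat n) (S : VSet n) : List (Fin n) :=
  setList fun v => S v && allFin fun u =>
    (!S u || natLe n (count fun w => S w && A v w) (count fun w => S w && A u w))

/-- The adjacency matrix after merging `w` into `v`. -/
def mergeMat (A : Mat n) (v w : Fin n) : Mat n := fun a b =>
  (!decide (a = b)) && (A a b || ((decide (a = v) && A w b) || (decide (b = v) && A w a)))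

/-- One elimination step, which does nothing if the minimum degree is at least three. -/
def elimStep (y : Mat n × VSet n × Trace n) : Mat n × VSet n × Trace n :=
  listCases (minVertices y.1 y.2.1) y fun u _ =>
    listCases (setList fun x => y.2.1 x && y.1 u x)
      (y.1, (fun x => y.2.1 x && !decide (x = u)), (u, u, u) :: y.2.2) fun v l =>
    listCases l
      (y.1, (fun x => y.2.1 x && (!decide (x = u) && !decide (x = v))), (u, u, u) :: y.2.2)
      fun w l' =>
    listCases l'
      (if y.1 v w = true then
        (y.1, (fun x => y.2.1 x && (!decide (x = u) && (!decide (x = v) && !decide (x = w)))),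
          (u, u, u) :: y.2.2)
      else (mergeMat y.1 v w, (fun x => y.2.1 x && (!decide (x = u) && !decide (x = w))),
        (u, v, w) :: y.2.2))
      fun _ _ => y

/-- Undo the last elimination step, given an independent set of the smaller graph. -/
def unwindStep (y : Trace n × VSet n) : Trace n × VSet n :=
  listCases y.1 y fun o K =>
    (K, if y.2 o.2.1 = true then fun x => y.2 x || decide (x = o.2.2)
      else fun x => y.2 x || decide (x = o.1))

/-- One step of the greedy algorithm, with the remaining vertices and the set found so far. -/
def greedyStep (A : Mat n) (y : VSet n × VSet n) : VSet n × VSet n :=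
  listCases (minVertices A y.1) y fun v _ =>
    ((fun x => y.1 x && (!decide (x = v) && !A v x)), fun x => y.2 x || decide (x = v))

/-- One step of an auction that finds a maximum matching in the bipartite double cover. The state
consists of the matching, the prices of the right vertices, and the left vertices that gave up. -/
def auctionStep (A : Mat n) (T : VSet n) (y : Mat n × (Fin n → ℕ) × VSet n) :
    Mat n × (Fin n → ℕ) × VSet n :=
  listCases (setList fun l => T l && ((!y.2.2 l) && !anyFin fun r => y.1 l r)) y fun l _ =>
    listCases (setList fun r => (T r && A l r) && allFin fun r' =>
        ((!(T r' && A l r')) || natLe n (y.2.1 r) (y.2.1 r')))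
      (y.1, y.2.1, fun x => y.2.2 x || decide (x = l)) fun r _ =>
    if natLe n n (y.2.1 r) = true then (y.1, y.2.1, fun x => y.2.2 x || decide (x = l))
    else
      ((fun l' r' => if decide (r' = r) = true then decide (l' = l) else y.1 l' r'),
        (fun r' => if decide (r' = r) = true then y.2.1 r' + 1 else y.2.1 r'), y.2.2)

/-- The final state of the auction. -/
def auction (A : Mat n) (T : VSet n) : Mat n × (Fin n → ℕ) × VSet n :=
  (fun y => (fun y => auctionStep A T (auctionStep A T y))^[n] y)^[n]
    ((fun _ _ => false), (fun _ => 0), fun _ => false)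

/-- A number that does not occur as a price. -/
def freeLevel (p : Fin n → ℕ) : ℕ :=
  Fin.foldr n (fun i t =>
    if (anyFin fun r => natLe n (p r) i && natLe n i (p r)) = true then t else (i : ℕ)) n

/-- The left vertices of a maximum independent set of the bipartite double cover. -/
def highLeft (y : Mat n × (Fin n → ℕ) × VSet n) : VSet n := fun l =>
  y.2.2 l || anyFin fun r => y.1 l r && !natLe n (y.2.1 r) (freeLevel y.2.1)

/-- The right vertices of a maximum independent set of the bipartite double cover. -/
def lowRight (y : Mat n × (Fin n → ℕ) × VSet n) : VSet n := fun r =>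
  natLe n (y.2.1 r) (freeLevel y.2.1)

/-- The output of LP+greedy on the subgraph induced on `T`, from the two sides of a maximum
independent set of its bipartite double cover. -/
def takeGreedy (A : Mat n) (T L R : VSet n) : VSet n := fun v =>
  (T v && (L v && R v)) || ((greedyStep A)^[n]
    ((fun v => T v && ((L v && !R v) || ((!L v) && R v))), fun _ => false)).2 v

/-- The output of LP+greedy on the subgraph induced on `T`. -/
def lpGreedy (A : Mat n) (T : VSet n) : VSet n :=
  takeGreedy A T (highLeft (auction A T)) (lowRight (auction A T))

/-- The vertices with at most three neighbours before them. -/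
def layers (A : Mat n) (S : VSet n) (B : Mat n) : VSet n := fun v =>
  S v && natLe n (count fun u => S u && (A v u && B v u)) 3

/-- The state while the ordering is drawn: the vertices that are left, as a list and as a set, the
predecessors of the vertices already drawn, and the graph with its trace. -/
abbrev DrawState (n : ℕ) : Type :=
  List (Fin n) × VSet n × Mat n × (Mat n × VSet n × Trace n)

/-- The state before the first draw. -/
def initialState (A : Mat n) : DrawState n :=
  (fun y : Mat n × VSet n × Trace n =>
    (setList (fun i => y.2.1 i), y.2.1, (fun _ _ => false), y))
    (elimStep^[n] (A, (fun _ => true), []))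

/-- The update of the state when the vertex `d` is drawn. -/
def drawStep (d : Fin n) (y : DrawState n) : DrawState n :=
  (setList (fun x => y.2.1 x && !decide (x = d)), (fun x => y.2.1 x && !decide (x = d)),
    (fun v u => if decide (v = d) = true then y.2.2.2.2.1 u && !y.2.1 u else y.2.2.1 v u),
    y.2.2.2)

/-- The output, computed from the state after the last draw. -/
def finalSet (y : DrawState n) : VSet n :=
  (unwindStep^[n] (y.2.2.2.2.2,
    lpGreedy y.2.2.2.1 (layers y.2.2.2.1 y.2.2.2.2.1 y.2.2.1))).2

end Algorithm

/-! ### The pieces of the algorithm are polynomial-time computable. -/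

section AlgorithmPolyTime

variable {α : ℕ → Type} [∀ n, Enc (α n)]

theorem PolyTime.minVertices {A : ∀ n, α n → Mat n} {S : ∀ n, α n → VSet n}
    (hA : PolyTime A) (hS : PolyTime S) :
    PolyTime fun n x => minVertices (A n x) (S n x) := by
  have h : PolyTime (α := fun n => Mat n × VSet n) fun _ y => _root_.minVertices y.1 y.2 := by
    unfold _root_.minVertices
    repeat' with_reducible first
      | exact .id
      | apply PolyTime.fst
      | apply PolyTime.snd
      | apply PolyTime.setList
      | apply PolyTime.and
      | apply PolyTime.or
      | apply PolyTime.not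
      | apply PolyTime.allFin
      | apply PolyTime.count
      | apply PolyTime.natLe
      | apply PolyTime.app
  exact h.comp (hA.pair hS)


theorem PolyTime.mergeMat :
    PolyTime (α := fun n => Mat n × Fin n × Fin n) fun _ y => mergeMat y.1 y.2.1 y.2.2 := by
  unfold _root_.mergeMat
  repeat' with_reducible first
    | exact .id
    | apply PolyTime.fst
    | apply PolyTime.snd
    | apply PolyTime.eq
    | apply PolyTime.and
    | apply PolyTime.or
    | apply PolyTime.not
    | apply PolyTime.app
    | apply PolyTime.lam

theorem PolyTime.elimStep : PolyTime fun n => elimStep (n := n) := by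
  unfold _root_.elimStep
  have hm : ∀ {β : ℕ → Type} [∀ n, Enc (β n)] {A : ∀ n, β n → Mat n} {v w : ∀ n, β n → Fin n},
      PolyTime A → PolyTime v → PolyTime w →
      PolyTime fun n x => _root_.mergeMat (A n x) (v n x) (w n x) :=
    fun hA hv hw => PolyTime.mergeMat.comp (hA.pair (hv.pair hw))
  repeat' with_reducible first
    | exact .id
    | apply PolyTime.fst
    | apply PolyTime.snd
    | apply PolyTime.ite
    | apply PolyTime.cons
    | apply PolyTime.listCases
    | apply PolyTime.minVertices
    | apply hm
    | apply PolyTime.setList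
    | apply PolyTime.eq
    | apply PolyTime.and
    | apply PolyTime.not
    | apply PolyTime.pair
    | apply PolyTime.app
    | apply PolyTime.lam

theorem PolyTime.unwindStep : PolyTime fun n => unwindStep (n := n) := by
  unfold _root_.unwindStep
  repeat' with_reducible first
    | exact .id
    | apply PolyTime.fst
    | apply PolyTime.snd
    | apply PolyTime.ite
    | apply PolyTime.listCases
    | apply PolyTime.eq
    | apply PolyTime.or
    | apply PolyTime.pair
    | apply PolyTime.app
    | apply PolyTime.lam

theorem PolyTime.greedyStep :
    PolyTime (α := fun n => Mat n × VSet n × VSet n) fun _ y => greedyStep y.1 y.2 := by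
  unfold _root_.greedyStep
  repeat' with_reducible first
    | exact .id
    | apply PolyTime.fst
    | apply PolyTime.snd
    | apply PolyTime.listCases
    | apply PolyTime.minVertices
    | apply PolyTime.eq
    | apply PolyTime.and
    | apply PolyTime.or
    | apply PolyTime.not
    | apply PolyTime.pair
    | apply PolyTime.app
    | apply PolyTime.lam

theorem PolyTime.auctionStep :
    PolyTime (α := fun n => (Mat n × VSet n) × Mat n × (Fin n → ℕ) × VSet n)
      fun _ y => auctionStep y.1.1 y.1.2 y.2 := by
  unfold _root_.auctionStep
  repeat' with_reducible first
    | exact .id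
    | apply PolyTime.fst
    | apply PolyTime.snd
    | apply PolyTime.ite
    | apply PolyTime.listCases
    | apply PolyTime.setList
    | apply PolyTime.anyFin
    | apply PolyTime.allFin
    | apply PolyTime.eq
    | apply PolyTime.and
    | apply PolyTime.or
    | apply PolyTime.not
    | apply PolyTime.natLe
    | apply PolyTime.size
    | apply PolyTime.succ
    | apply PolyTime.pair
    | apply PolyTime.app
    | apply PolyTime.lam

/-- Nested loops of length `n` around a doubled step give the 2n² rounds that the auction needs. -/
theorem PolyTime.iterate_twice_sq {β : ℕ → Type} [∀ n, Enc (β n)] {f : ∀ n, α n → β n → β n}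
    {a : ∀ n, α n → β n} (hf : PolyTime fun n (y : α n × β n) => f n y.1 y.2) (ha : PolyTime a) :
    PolyTime fun n x => (fun y => (fun y => f n x (f n x y))^[n] y)^[n] (a n x) := by
  have h : PolyTime fun n (y : α n × β n) => f n y.1 (f n y.1 y.2) :=
    hf.comp ((PolyTime.fst .id).pair hf)
  exact .iterate (.iterate (h.comp (.pair (.fst (.fst .id)) (.snd .id))) (.snd .id)) ha

theorem PolyTime.auction :
    PolyTime (α := fun n => Mat n × VSet n) fun _ y => auction y.1 y.2 := by
  have ha : PolyTime (α := fun n => Mat n × VSet n)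
      (β := fun n => Mat n × (Fin n → ℕ) × VSet n)
      fun _ _ => ((fun _ _ => Bool.false), (fun _ => 0), fun _ => Bool.false) :=
    .pair (.lam (.lam .false)) (.pair (.lam .zero) (.lam .false))
  have h := PolyTime.auctionStep.iterate_twice_sq
    (f := fun n (x : Mat n × VSet n) => _root_.auctionStep x.1 x.2) ha
  exact h

theorem PolyTime.freeLevel :
    PolyTime (α := fun n => Fin n → ℕ) fun _ p => freeLevel p := by
  unfold _root_.freeLevel
  refine .foldr ?_ .size
  repeat' with_reducible first
    | exact .id
    | apply PolyTime.fst
    | apply PolyTime.snd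
    | apply PolyTime.ite
    | apply PolyTime.anyFin
    | apply PolyTime.and
    | apply PolyTime.natLe
    | apply PolyTime.val
    | apply PolyTime.app

theorem PolyTime.highLeft : PolyTime fun n => highLeft (n := n) := by
  unfold _root_.highLeft
  have hf : ∀ {β : ℕ → Type} [∀ n, Enc (β n)] {p : ∀ n, β n → Fin n → ℕ},
      PolyTime p → PolyTime fun n x => _root_.freeLevel (p n x) :=
    fun hp => PolyTime.freeLevel.comp hp
  repeat' with_reducible first
    | exact .id
    | apply PolyTime.fst
    | apply PolyTime.snd
    | apply hf
    | apply PolyTime.anyFin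
    | apply PolyTime.and
    | apply PolyTime.or
    | apply PolyTime.not
    | apply PolyTime.natLe
    | apply PolyTime.app
    | apply PolyTime.lam

theorem PolyTime.lowRight : PolyTime fun n => lowRight (n := n) := by
  unfold _root_.lowRight
  have hf : ∀ {β : ℕ → Type} [∀ n, Enc (β n)] {p : ∀ n, β n → Fin n → ℕ},
      PolyTime p → PolyTime fun n x => _root_.freeLevel (p n x) :=
    fun hp => PolyTime.freeLevel.comp hp
  repeat' with_reducible first
    | exact .id
    | apply PolyTime.fst
    | apply PolyTime.snd
    | apply hf
    | apply PolyTime.natLe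
    | apply PolyTime.app
    | apply PolyTime.lam

theorem PolyTime.takeGreedy {A : ∀ n, α n → Mat n} {T L R : ∀ n, α n → VSet n}
    (hA : PolyTime A) (hT : PolyTime T) (hL : PolyTime L) (hR : PolyTime R) :
    PolyTime fun n x => takeGreedy (A n x) (T n x) (L n x) (R n x) := by
  have hg : ∀ {β : ℕ → Type} [∀ n, Enc (β n)] {A : ∀ n, β n → Mat n}
      {y : ∀ n, β n → VSet n × VSet n}, PolyTime A → PolyTime y →
      PolyTime fun n x => (_root_.greedyStep (A n x))^[n] (y n x) :=
    fun hA hy => .iterate (PolyTime.greedyStep.comp (.pair (hA.comp (.fst .id)) (.snd .id))) hy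
  have h : PolyTime (α := fun n => Mat n × VSet n × VSet n × VSet n)
      fun _ y => _root_.takeGreedy y.1 y.2.1 y.2.2.1 y.2.2.2 := by
    unfold _root_.takeGreedy
    repeat' with_reducible first
      | exact .id
      | apply PolyTime.fst
      | apply PolyTime.snd
      | apply PolyTime.false
      | apply hg
      | apply PolyTime.and
      | apply PolyTime.or
      | apply PolyTime.not
      | apply PolyTime.pair
      | apply PolyTime.app
      | apply PolyTime.lam
  exact h.comp (hA.pair (hT.pair (hL.pair hR)))

theorem PolyTime.lpGreedy {A : ∀ n, α n → Mat n} {T : ∀ n, α n → VSet n}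
    (hA : PolyTime A) (hT : PolyTime T) : PolyTime fun n x => lpGreedy (A n x) (T n x) := by
  have h := PolyTime.auction.comp (hA.pair hT)
  exact .takeGreedy hA hT (PolyTime.highLeft.comp h) (PolyTime.lowRight.comp h)

theorem PolyTime.layers :
    PolyTime (α := fun n => Mat n × VSet n × Mat n) fun _ y => layers y.1 y.2.1 y.2.2 := by
  unfold _root_.layers
  have h3 : ∀ {β : ℕ → Type} [∀ n, Enc (β n)], PolyTime fun n (_ : β n) => 3 :=
    .succ (.succ (.succ .zero))
  repeat' with_reducible first
    | exact .id
    | apply PolyTime.fst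
    | apply PolyTime.snd
    | apply h3
    | apply PolyTime.count
    | apply PolyTime.and
    | apply PolyTime.natLe
    | apply PolyTime.app
    | apply PolyTime.lam

theorem PolyTime.initialState : PolyTime fun n => initialState (n := n) := by
  have h : PolyTime fun n (A : Mat n) => _root_.elimStep^[n] (A, (fun _ => Bool.true), []) :=
    .iterate (PolyTime.elimStep.comp (.snd .id)) (.pair .id (.pair (.lam .true) .nil))
  refine .comp (g := fun n (y : Mat n × VSet n × Trace n) =>
    (_root_.setList (fun i => y.2.1 i), y.2.1, (fun _ _ => Bool.false), y)) ?_ h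
  exact .pair (.setList (.app (.fst (.snd (.fst .id))) (.snd .id))) (.pair (.fst (.snd .id))
    (.pair (.lam (.lam .false)) .id))

theorem PolyTime.drawStep :
    PolyTime (α := fun n => Fin n × DrawState n) fun _ y => drawStep y.1 y.2 := by
  unfold _root_.drawStep
  repeat' with_reducible first
    | exact .id
    | apply PolyTime.fst
    | apply PolyTime.snd
    | apply PolyTime.ite
    | apply PolyTime.setList
    | apply PolyTime.eq
    | apply PolyTime.and
    | apply PolyTime.not
    | apply PolyTime.pair
    | apply PolyTime.app
    | apply PolyTime.lam

theorem PolyTime.finalSet : PolyTime fun n => finalSet (n := n) := by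
  have hA : PolyTime fun n (y : DrawState n) => y.2.2.2.1 := .fst (.snd (.snd (.snd .id)))
  have hS : PolyTime fun n (y : DrawState n) => y.2.2.2.2.1 := .fst (.snd (.snd (.snd (.snd .id))))
  have hB : PolyTime fun n (y : DrawState n) => y.2.2.1 := .fst (.snd (.snd .id))
  have hK : PolyTime fun n (y : DrawState n) => y.2.2.2.2.2 :=
    .snd (.snd (.snd (.snd (.snd .id))))
  exact .snd (.iterate (PolyTime.unwindStep.comp (.snd .id))
    (.pair hK (.lpGreedy hA (PolyTime.layers.comp (hA.pair (hS.pair hB))))))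

end AlgorithmPolyTime

/-! ### Correctness -/

section Correctness

variable {n : ℕ}

theorem setList_eq_filter (s : VSet n) : setList s = (List.finRange n).filter s := by
  rw [setList, Fin.foldr_eq_foldr_finRange]
  induction List.finRange n with
  | nil => rfl
  | cons i l ih =>
    rw [List.foldr_cons, ih, List.filter_cons]

theorem mem_setList {s : VSet n} {i : Fin n} : i ∈ setList s ↔ s i = true := by
  simp [setList_eq_filter]

theorem nodup_setList (s : VSet n) : (setList s).Nodup := by
  rw [setList_eq_filter]
  exact (List.nodup_finRange n).filter _

/-- The set of vertices with a given characteristic function. -/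
def toSet (s : VSet n) : Finset (Fin n) := Finset.univ.filter fun i => s i = true

@[simp] theorem mem_toSet {s : VSet n} {i : Fin n} : i ∈ toSet s ↔ s i = true := by
  simp [toSet]

theorem setList_toFinset (s : VSet n) : (setList s).toFinset = toSet s := by
  ext i
  simp [mem_setList]

theorem setList_eq_nil {s : VSet n} (h : setList s = []) (i : Fin n) : s i = false := by
  by_contra hi
  have := mem_setList.2 (Bool.not_eq_false _ ▸ hi : s i = true)
  simp [h] at this

theorem anyFin_iff {s : VSet n} : anyFin s = true ↔ ∃ i, s i = true := by
  rw [anyFin]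
  cases h : setList s with
  | nil =>
    refine ⟨fun h' => by simp at h', ?_⟩
    rintro ⟨i, hi⟩
    rw [setList_eq_nil h i] at hi
    cases hi
  | cons i l => exact ⟨fun _ => ⟨i, mem_setList.1 (h ▸ List.mem_cons_self)⟩, fun _ => rfl⟩

theorem allFin_iff {s : VSet n} : allFin s = true ↔ ∀ i, s i = true := by
  rw [allFin, Bool.not_eq_true', ← Bool.not_eq_true, anyFin_iff]
  simp

theorem count_eq_card (s : VSet n) : count s = (toSet s).card := by
  rw [← setList_toFinset, List.toFinset_card_of_nodup (nodup_setList s), setList_eq_filter,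
    count, Fin.foldr_eq_foldr_finRange]
  induction List.finRange n with
  | nil => rfl
  | cons i l ih =>
    rw [List.foldr_cons, ih, List.filter_cons]
    split_ifs <;> rfl

theorem count_le (s : VSet n) : count s ≤ n := by
  rw [count_eq_card]
  exact (Finset.card_le_univ _).trans_eq (Fintype.card_fin n)

/-- The matrix `A` is the adjacency matrix of the graph `G`. -/
def Represents (A : Mat n) (G : SimpleGraph (Fin n)) : Prop := ∀ i j, A i j = true ↔ G.Adj i j

theorem toSet_nbrs {A : Mat n} {G : SimpleGraph (Fin n)} (hA : Represents A G) (S : VSet n)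
    (v : Fin n) : toSet (fun w => S w && A v w) = nbrs G (toSet S) v := by
  ext w
  simp [mem_nbrs, hA v w]

theorem mem_minVertices {A : Mat n} {G : SimpleGraph (Fin n)} (hA : Represents A G) {S : VSet n}
    {v : Fin n} : v ∈ minVertices A S ↔ v ∈ toSet S ∧
      ∀ u ∈ toSet S, (nbrs G (toSet S) v).card ≤ (nbrs G (toSet S) u).card := by
  rw [minVertices, mem_setList, Bool.and_eq_true, allFin_iff, mem_toSet]
  refine and_congr_right fun _ => forall_congr' fun u => ?_
  rw [Bool.or_eq_true, natLe_iff (count_le _), count_eq_card, count_eq_card, toSet_nbrs hA,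
    toSet_nbrs hA, mem_toSet]
  cases S u <;> simp

theorem minVertices_eq_nil {A : Mat n} {G : SimpleGraph (Fin n)} (hA : Represents A G)
    {S : VSet n} (h : minVertices A S = []) : toSet S = ∅ := by
  by_contra hne
  obtain ⟨v, hv, hmin⟩ := Finset.exists_min_image (toSet S) (fun u => (nbrs G (toSet S) u).card)
    (Finset.nonempty_iff_ne_empty.2 hne)
  have := (mem_minVertices hA).2 ⟨hv, hmin⟩
  simp [h] at this

/-! #### Greedy -/

/-- Each round deletes at least one vertex, and rounds on the empty set are idle. -/
theorem iterate_greedyStep {A : Mat n} {G : SimpleGraph (Fin n)} (hA : Represents A G) (m : ℕ) :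
    ∀ T J : VSet n, (toSet T).card ≤ m → ∃ K, GreedyOutcome G (toSet T) K ∧
      toSet ((greedyStep A)^[m] (T, J)).2 = toSet J ∪ K := by
  induction m with
  | zero =>
    intro T J hT
    rw [Finset.card_eq_zero.1 (Nat.le_zero.1 hT)]
    exact ⟨∅, .done, by simp⟩
  | succ m ih =>
    intro T J hT
    rw [Function.iterate_succ_apply, greedyStep]
    cases h : minVertices A T with
    | nil =>
      have h0 := minVertices_eq_nil hA h
      have := ih T J (by simp [h0])
      exact this
    | cons v l =>
      obtain ⟨hv, hmin⟩ := (mem_minVertices hA).1 (h ▸ List.mem_cons_self (a := v) (l := l))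
      have hT' : toSet (fun x => T x && (!decide (x = v) && !A v x))
          = toSet T \ insert v (nbrs G (toSet T) v) := by
        ext x
        simp only [mem_toSet, Bool.and_eq_true, Bool.not_eq_true', decide_eq_false_iff_not,
          Finset.mem_sdiff, Finset.mem_insert, mem_nbrs, not_or, ← hA v x]
        refine and_congr_right fun hx => and_congr_right fun _ => ?_
        simp [hx]
      have hJ' : toSet (fun x => J x || decide (x = v)) = insert v (toSet J) := by
        ext x
        simp [or_comm]
      obtain ⟨K, hK, hK'⟩ := ih (fun x => T x && (!decide (x = v) && !A v x))
        (fun x => J x || decide (x = v)) (by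
          rw [hT']
          have := Finset.card_lt_card (Finset.sdiff_ssubset
            (Finset.insert_subset hv (nbrs_subset G (toSet T) v)) (Finset.insert_nonempty _ _))
          omega)
      rw [hT'] at hK
      refine ⟨insert v K, .pick _ K v hv hmin hK, ?_⟩
      rw [listCases_cons, hK', hJ', Finset.insert_union, Finset.union_insert]

/-! #### Elimination -/

theorem mergeMat_represents {A : Mat n} {G : SimpleGraph (Fin n)} (hA : Represents A G)
    (v w : Fin n) : Represents (mergeMat A v w) (mergeInto G v w) := by
  intro a b
  simp [mergeMat, mergeInto, hA a b, hA w a, hA w b]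

/-- Undo an elimination step. -/
def undo (J : Finset (Fin n)) (o : Fin n × Fin n × Fin n) : Finset (Fin n) :=
  if o.2.1 ∈ J then insert o.2.2 J else insert o.1 J

/-- With the record `(u, u, u)` both branches insert `u`, so one kind of record covers taking a
vertex as well as merging. -/
theorem undo_self (u : Fin n) : (fun J => undo J (u, u, u)) = fun J => insert u J := by
  funext J
  simp [undo]

/-- The vertex `u` has minimum degree, so the length of its neighbour list selects the rule and
supplies the minimum-degree condition; three or more neighbours mean that elimination is over. -/
theorem elimStep_spec {A : Mat n} {G : SimpleGraph (Fin n)} (hA : Represents A G) (S : VSet n)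
    (K : Trace n) :
    (elimStep (A, S, K) = (A, S, K) ∧ ∀ x ∈ toSet S, 3 ≤ (nbrs G (toSet S) x).card) ∨
    ∃ A' G' S' o, elimStep (A, S, K) = (A', S', o :: K) ∧ Represents A' G' ∧
      (toSet S').card < (toSet S).card ∧ ∀ μ, EliminateThenPLG 4 G' (toSet S') μ →
        EliminateThenPLG 4 G (toSet S) (μ.map fun J => undo J o) := by
  rw [elimStep]
  cases h : minVertices A S with
  | nil => exact Or.inl ⟨rfl, by simp [minVertices_eq_nil hA h]⟩
  | cons u l =>
    obtain ⟨hu, hmin⟩ := (mem_minVertices hA).1 (h ▸ List.mem_cons_self (a := u) (l := l))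
    have hset := (setList_toFinset fun x => S x && A u x).trans (toSet_nbrs hA S u)
    have hnodup := nodup_setList fun x => S x && A u x
    have hsub : ∀ S' : VSet n, S' u = false → (∀ x, S' x = true → S x = true) →
        (toSet S').card < (toSet S).card := fun S' h1 h2 =>
      Finset.card_lt_card ⟨fun x hx => mem_toSet.2 (h2 x (mem_toSet.1 hx)), fun h => by
        have := mem_toSet.1 (h hu)
        simp [h1] at this⟩
    simp only [listCases_cons]
    rw [← hset] at hmin
    cases h1 : setList (fun x => S x && A u x) with
    | nil =>
      rw [h1] at hset
      refine Or.inr ⟨A, G, _, (u, u, u), rfl, hA, hsub _ (by simp) (by simp +contextual), fun μ hμ => ?_⟩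
      rw [undo_self]
      refine .isolated G _ μ u hu (by rw [← hset]; rfl) ?_
      convert hμ using 1
      ext x
      simp
    | cons v l1 =>
    cases l1 with
    | nil =>
      rw [h1] at hset
      refine Or.inr ⟨A, G, _, (u, u, u), rfl, hA, hsub _ (by simp) (by simp +contextual), fun μ hμ => ?_⟩
      rw [undo_self]
      refine .pendant G _ μ u v hu (by rw [← hset]; rfl) ?_
      convert hμ using 1
      ext x
      simp
    | cons w l2 =>
    cases l2 with
    | nil =>
      rw [h1] at hset hnodup hmin
      have hvw : v ≠ w := by
        rintro rfl
        simp at hnodup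
      have hmin2 : ∀ x ∈ toSet S, 2 ≤ (nbrs G (toSet S) x).card := by
        intro x hx
        have := hmin x hx
        rwa [List.toFinset_card_of_nodup hnodup] at this
      have hdeg : nbrs G (toSet S) u = {v, w} := by
        rw [← hset]
        simp
      simp only [listCases_cons, listCases_nil]
      by_cases hadj : A v w = true
      · rw [if_pos hadj]
        refine Or.inr ⟨A, G, _, (u, u, u), rfl, hA, hsub _ (by simp) (by simp +contextual), fun μ hμ => ?_⟩
        rw [undo_self]
        refine .triangle G _ μ u v w hu hmin2 hvw hdeg ((hA v w).1 hadj) ?_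
        convert hμ using 1
        ext x
        simp
      · rw [if_neg hadj]
        refine Or.inr ⟨_, mergeInto G v w, _, (u, v, w), rfl, mergeMat_represents hA v w,
          hsub _ (by simp) (by simp +contextual), fun μ hμ => ?_⟩
        refine .merge G _ μ u v w hu hmin2 hvw hdeg (fun h => hadj ((hA v w).2 h)) ?_
        convert hμ using 1
        ext x
        simp
    | cons z l3 =>
      refine Or.inl ⟨rfl, fun x hx => le_trans ?_ (hmin x hx)⟩
      rw [List.toFinset_card_of_nodup hnodup, h1]
      simp

/-- Every effective step removes a vertex, so `|S|` rounds reach a fixed point. The trace has the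
latest step first, hence `foldl` undoes the steps in reverse order. -/
theorem iterate_elimStep_spec (m : ℕ) : ∀ {A : Mat n} {G : SimpleGraph (Fin n)}
    (_ : Represents A G) (S : VSet n) (K : Trace n), (toSet S).card ≤ m →
    ∃ A' G' S' K', elimStep^[m] (A, S, K) = (A', S', K' ++ K) ∧ K'.length ≤ m ∧
      Represents A' G' ∧ (∀ x ∈ toSet S', 3 ≤ (nbrs G' (toSet S') x).card) ∧
      ∀ μ, EliminateThenPLG 4 G' (toSet S') μ →
        EliminateThenPLG 4 G (toSet S) (μ.map fun J => K'.foldl undo J) := by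
  induction m with
  | zero =>
    intro A G hA S K hS
    refine ⟨A, G, S, [], rfl, le_rfl, hA, ?_, fun μ hμ => ?_⟩
    · simp [Finset.card_eq_zero.1 (Nat.le_zero.1 hS)]
    · rwa [show (fun J => List.foldl undo J []) = id from rfl, PMF.map_id]
  | succ m ih =>
    intro A G hA S K hS
    rw [Function.iterate_succ_apply]
    rcases elimStep_spec hA S K with ⟨h1, h2⟩ | ⟨A₁, G₁, S₁, o, h1, hA₁, hlt, hμ₁⟩
    · have hfix : ∀ j, elimStep^[j] (A, S, K) = (A, S, K) := fun j =>
        Function.iterate_fixed h1 j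
      refine ⟨A, G, S, [], by rw [h1, hfix]; rfl, Nat.zero_le _, hA, h2, fun μ hμ => ?_⟩
      rwa [show (fun J => List.foldl undo J []) = id from rfl, PMF.map_id]
    · obtain ⟨A', G', S', K', h3, hlen, hA', hdeg, hμ'⟩ := ih hA₁ S₁ (o :: K) (by omega)
      refine ⟨A', G', S', K' ++ [o], by rw [h1, h3]; simp, by simpa using hlen, hA', hdeg,
        fun μ hμ => ?_⟩
      have := hμ₁ _ (hμ' μ hμ)
      rw [PMF.map_comp] at this
      simpa [Function.comp_def] using this

theorem iterate_unwindStep (m : ℕ) : ∀ (K : Trace n) (J : VSet n), K.length ≤ m →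
    toSet (unwindStep^[m] (K, J)).2 = K.foldl undo (toSet J) := by
  induction m with
  | zero =>
    intro K J hK
    rw [List.length_eq_zero_iff.1 (Nat.le_zero.1 hK)]
    rfl
  | succ m ih =>
    intro K J hK
    rw [Function.iterate_succ_apply]
    cases K with
    | nil => exact ih [] J (Nat.zero_le _)
    | cons o K =>
      rw [List.foldl_cons, unwindStep, listCases_cons, ih _ _ (by simpa using hK)]
      congr 1
      ext x
      by_cases h : J o.2.1 = true <;> simp [undo, h, or_comm]

end Correctness

/-! #### The linear program -/

section Auction

variable {n : ℕ} {A : Mat n} {T : VSet n}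

/-- The invariant of the auction. -/
structure AuctionInv (A : Mat n) (T : VSet n) (y : Mat n × (Fin n → ℕ) × VSet n) : Prop where
  price_le : ∀ r, y.2.1 r ≤ n
  edge : ∀ l r, y.1 l r = true → T l = true ∧ T r = true ∧ A l r = true
  right_unique : ∀ l r r', y.1 l r = true → y.1 l r' = true → r = r'
  left_unique : ∀ l l' r, y.1 l r = true → y.1 l' r = true → l = l'
  slack : ∀ l r, y.1 l r = true → ∀ r', T r' = true → A l r' = true → y.2.1 r ≤ y.2.1 r' + 1
  owned : ∀ r, 0 < y.2.1 r → ∃ l, y.1 l r = true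
  gaveUp : ∀ l, y.2.2 l = true → ∀ r, T r = true → A l r = true → n ≤ y.2.1 r

/-- Every left vertex in `T` is matched or gave up. -/
def AuctionDone (T : VSet n) (y : Mat n × (Fin n → ℕ) × VSet n) : Prop :=
  ∀ l, T l = true → y.2.2 l = true ∨ ∃ r, y.1 l r = true

/-- The progress of the auction. -/
def auctionPotential (y : Mat n × (Fin n → ℕ) × VSet n) : ℕ :=
  ∑ r, y.2.1 r + (toSet y.2.2).card

theorem AuctionInv.potential_le {y : Mat n × (Fin n → ℕ) × VSet n} (h : AuctionInv A T y) :
    auctionPotential y ≤ n * n + n := by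
  refine add_le_add ?_ ((Finset.card_le_univ _).trans_eq (Fintype.card_fin n))
  refine (Finset.sum_le_card_nsmul _ _ n fun r _ => h.price_le r).trans_eq ?_
  simp

/-- A bidder takes a cheapest neighbour and raises its price by one, which gives `slack`. Prices
never fall, so `slack` and `gaveUp` persist; an evicted owner is replaced at once, so `owned`
persists. Each active step raises a price or makes a bidder give up. -/
theorem auctionStep_spec {y : Mat n × (Fin n → ℕ) × VSet n} (h : AuctionInv A T y) :
    (AuctionDone T y ∧ auctionStep A T y = y) ∨
      (AuctionInv A T (auctionStep A T y) ∧
        auctionPotential y + 1 ≤ auctionPotential (auctionStep A T y)) := by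
  rw [auctionStep]
  cases h1 : setList (fun l => T l && ((!y.2.2 l) && !anyFin fun r => y.1 l r)) with
  | nil =>
    refine Or.inl ⟨fun l hl => ?_, rfl⟩
    have := setList_eq_nil h1 l
    simp only [hl, Bool.true_and] at this
    by_contra hnot
    rw [not_or] at hnot
    have h3 : (anyFin fun r => y.1 l r) = false := by
      rw [← Bool.not_eq_true, anyFin_iff]
      exact hnot.2
    simp [h3, hnot.1] at this
  | cons l ls =>
    right
    have hl := mem_setList.1 (h1 ▸ List.mem_cons_self (a := l) (l := ls))
    simp only [Bool.and_eq_true, Bool.not_eq_true', ← Bool.not_eq_true (anyFin _),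
      anyFin_iff] at hl
    obtain ⟨hTl, hup, hfree⟩ := hl
    -- This covers both ways of giving up: no neighbour at all, or a cheapest neighbour of price
    -- `n`.
    have hgive : (∀ r, T r = true → A l r = true → n ≤ y.2.1 r) →
        AuctionInv A T (y.1, y.2.1, fun x => y.2.2 x || decide (x = l)) ∧
        auctionPotential y + 1
          ≤ auctionPotential (y.1, y.2.1, fun x => y.2.2 x || decide (x = l)) := by
      intro hn
      refine ⟨⟨h.price_le, h.edge, h.right_unique, h.left_unique, h.slack, h.owned,
        fun l' hl' => ?_⟩, ?_⟩
      · rcases Bool.or_eq_true_iff.1 hl' with h' | h'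
        · exact h.gaveUp l' h'
        · rw [of_decide_eq_true h']
          exact hn
      · have : toSet (fun x => y.2.2 x || decide (x = l)) = insert l (toSet y.2.2) := by
          ext x
          simp [or_comm]
        rw [auctionPotential, auctionPotential, this, Finset.card_insert_of_notMem (by simp [hup])]
        simp only
        omega
    simp only [listCases_cons]
    cases h2 : setList (fun r => (T r && A l r) && allFin fun r' =>
        ((!(T r' && A l r')) || natLe n (y.2.1 r) (y.2.1 r'))) with
    | nil =>
      refine hgive fun r hr hlr => ?_
      obtain ⟨r₀, hr₀, hmin⟩ := Finset.exists_min_image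
        (toSet fun r => T r && A l r) y.2.1 ⟨r, by simp [hr, hlr]⟩
      have := setList_eq_nil h2 r₀
      rw [← Bool.not_eq_true, Bool.and_eq_true, allFin_iff] at this
      refine (this ⟨mem_toSet.1 hr₀, fun r' => ?_⟩).elim
      rw [Bool.or_eq_true, natLe_iff (h.price_le _)]
      cases h' : T r' && A l r'
      · exact Or.inl rfl
      · exact Or.inr (hmin r' (mem_toSet.2 h'))
    | cons r rs =>
      have hr := mem_setList.1 (h2 ▸ List.mem_cons_self (a := r) (l := rs))
      rw [Bool.and_eq_true, allFin_iff, Bool.and_eq_true] at hr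
      obtain ⟨⟨hTr, hlr⟩, hmin'⟩ := hr
      have hmin : ∀ r', T r' = true → A l r' = true → y.2.1 r ≤ y.2.1 r' := by
        intro r' h3 h4
        have := hmin' r'
        rw [Bool.or_eq_true, natLe_iff (h.price_le _)] at this
        simpa [h3, h4] using this
      simp only [listCases_cons]
      by_cases hn : natLe n n (y.2.1 r) = true
      · rw [if_pos hn]
        rw [natLe_iff le_rfl] at hn
        exact hgive fun r' h3 h4 => hn.trans (hmin r' h3 h4)
      · rw [if_neg hn]
        rw [natLe_iff le_rfl, not_le] at hn
        have hle : ∀ r', y.2.1 r' ≤ if decide (r' = r) = true then y.2.1 r' + 1 else y.2.1 r' := by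
          intro r'
          split_ifs <;> omega
        refine ⟨⟨fun r' => ?_, fun l' r' hM => ?_, fun l' r₁ r₂ h₁ h₂ => ?_,
          fun l₁ l₂ r' h₁ h₂ => ?_, fun l' r' hM r'' h₁ h₂ => ?_, fun r' hpos => ?_,
          fun l' hl' r' h₁ h₂ => ?_⟩, ?_⟩
        · have := h.price_le r'
          by_cases e : r' = r
          · subst e
            simpa using hn
          · simpa [e] using this
        · by_cases e : r' = r
          · subst e
            obtain rfl : l' = l := by simpa using hM
            exact ⟨hTl, hTr, hlr⟩
          · exact h.edge l' r' (by simpa [e] using hM)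
        · by_cases e₁ : r₁ = r <;> by_cases e₂ : r₂ = r
          · exact e₁.trans e₂.symm
          · obtain rfl : l' = l := by simpa [e₁] using h₁
            exact (hfree ⟨r₂, by simpa [e₂] using h₂⟩).elim
          · obtain rfl : l' = l := by simpa [e₂] using h₂
            exact (hfree ⟨r₁, by simpa [e₁] using h₁⟩).elim
          · exact h.right_unique l' r₁ r₂ (by simpa [e₁] using h₁) (by simpa [e₂] using h₂)
        · by_cases e : r' = r
          · exact (show l₁ = l by simpa [e] using h₁).trans (show l₂ = l by simpa [e] using h₂).symm
          · exact h.left_unique l₁ l₂ r' (by simpa [e] using h₁) (by simpa [e] using h₂)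
        · refine le_trans ?_ (Nat.add_le_add_right (hle r'') 1)
          by_cases e : r' = r
          · subst e
            obtain rfl : l' = l := by simpa using hM
            simpa using hmin r'' h₁ h₂
          · simpa [e] using h.slack l' r' (by simpa [e] using hM) r'' h₁ h₂
        · by_cases e : r' = r
          · exact ⟨l, by simp [e]⟩
          · simpa [e] using h.owned r' (by simpa [e] using hpos)
        · exact (h.gaveUp l' hl' r' h₁ h₂).trans (hle r')
        · have hsum : ∑ r', y.2.1 r' < ∑ r',
              if decide (r' = r) = true then y.2.1 r' + 1 else y.2.1 r' :=
            Finset.sum_lt_sum (fun r' _ => hle r') ⟨r, Finset.mem_univ _, by simp⟩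
          simp only [auctionPotential]
          omega

theorem iterate_auctionStep {y : Mat n × (Fin n → ℕ) × VSet n} (h : AuctionInv A T y) (m : ℕ) :
    AuctionInv A T ((auctionStep A T)^[m] y) ∧
      ((AuctionDone T ((auctionStep A T)^[m] y) ∧
        auctionStep A T ((auctionStep A T)^[m] y) = (auctionStep A T)^[m] y) ∨
        m ≤ auctionPotential ((auctionStep A T)^[m] y)) := by
  induction m with
  | zero => exact ⟨h, Or.inr (Nat.zero_le _)⟩
  | succ m ih =>
    rw [Function.iterate_succ_apply']
    rcases auctionStep_spec ih.1 with h1 | h1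
    · rw [h1.2]
      exact ⟨ih.1, Or.inl h1⟩
    · refine ⟨h1.1, Or.inr ?_⟩
      rcases ih.2 with h3 | h3
      · have := h1.2
        rw [h3.2] at this
        omega
      · omega

/-- The potential never exceeds n² + n and grows in every active round, so the auction is over after
2n² rounds. -/
theorem auction_spec (A : Mat n) (T : VSet n) :
    AuctionInv A T (auction A T) ∧ AuctionDone T (auction A T) := by
  have h0 : AuctionInv A T ((fun _ _ => false), (fun _ => 0), fun _ => false) := by
    constructor <;> simp
  have hiter : auction A T
      = (auctionStep A T)^[2 * n * n] ((fun _ _ => false), (fun _ => 0), fun _ => false) := by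
    rw [auction, Function.iterate_mul, Function.iterate_mul]
    rfl
  rw [hiter]
  obtain ⟨h1, h2⟩ := iterate_auctionStep h0 (2 * n * n)
  refine ⟨h1, h2.elim And.left fun h3 => ?_⟩
  rcases auctionStep_spec h1 with h4 | h4
  · exact h4.1
  · exfalso
    have h5 := h4.1.potential_le
    rcases Nat.eq_zero_or_pos n with rfl | hn
    · omega
    · nlinarith

/-- Pigeonhole: `n` prices cannot fill the `n + 1` levels 0,…,n. The default `n` is reached only
when all smaller levels are attained. -/
theorem freeLevel_spec (p : Fin n → ℕ) (hp : ∀ r, p r ≤ n) :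
    freeLevel p ≤ n ∧ ∀ r, p r ≠ freeLevel p := by
  have key : ∀ l : List (Fin n), ∀ t, t = l.foldr (fun (i : Fin n) t =>
      if (anyFin fun r => natLe n (p r) i && natLe n i (p r)) = true then t else (i : ℕ)) n →
      (t ≤ n ∧ ∀ r, p r ≠ t) ∨ (t = n ∧ ∀ i ∈ l, ∃ r, p r = i) := by
    intro l
    induction l with
    | nil => exact fun t ht => Or.inr ⟨ht, by simp⟩
    | cons i l ih =>
      rintro t rfl
      rw [List.foldr_cons]
      have hany : (anyFin fun r => natLe n (p r) i && natLe n i (p r)) = true ↔ ∃ r, p r = i := by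
        rw [anyFin_iff]
        refine exists_congr fun r => ?_
        rw [Bool.and_eq_true, natLe_iff (hp r), natLe_iff i.2.le]
        exact (le_antisymm_iff).symm
      split_ifs with h
      · refine (ih _ rfl).imp id fun h' => ⟨h'.1, fun j hj => ?_⟩
        rcases List.mem_cons.1 hj with rfl | hj
        · exact hany.1 h
        · exact h'.2 j hj
      · exact Or.inl ⟨i.2.le, fun r hr => h (hany.2 ⟨r, hr⟩)⟩
  have hlevel := key (List.finRange n) (freeLevel p) (by
    rw [freeLevel, Fin.foldr_eq_foldr_finRange])
  refine hlevel.elim id fun h => ⟨h.1.le, fun r hr => ?_⟩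
  have hsub : Finset.range (n + 1) ⊆ Finset.univ.image p := by
    intro k hk
    rcases Nat.lt_succ_iff_lt_or_eq.1 (Finset.mem_range.1 hk) with hk | rfl
    · obtain ⟨r, hr⟩ := h.2 ⟨k, hk⟩ (List.mem_finRange _)
      exact Finset.mem_image.2 ⟨r, Finset.mem_univ _, hr⟩
    · exact Finset.mem_image.2 ⟨r, Finset.mem_univ _, hr.trans h.1⟩
  have := (Finset.card_le_card hsub).trans Finset.card_image_le
  simp at this

/-- Weak duality: a vertex of `Y` together with its partner in `X`, if any, carries weight at most
one. -/
theorem sum_add_sum_le_card {V : Type*} [DecidableEq V] {X Y : Finset V} {y : V → ℝ} (φ : V → V)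
    (hφ : ∀ v ∈ X, φ v ∈ Y) (hinj : Set.InjOn φ X) (hsum : ∀ v ∈ X, y v + y (φ v) ≤ 1)
    (hle : ∀ v ∈ Y, y v ≤ 1) : ∑ v ∈ X, y v + ∑ v ∈ Y, y v ≤ Y.card := by
  have h1 : ∑ v ∈ X, y v ≤ ∑ v ∈ X.image φ, (1 - y v) := by
    rw [Finset.sum_image hinj]
    exact Finset.sum_le_sum fun v hv => by linarith [hsum v hv]
  have h2 : ∑ v ∈ X.image φ, (1 - y v) ≤ ∑ v ∈ Y, (1 - y v) :=
    Finset.sum_le_sum_of_subset_of_nonneg (Finset.image_subset_iff.2 hφ)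
      fun v hv _ => by linarith [hle v hv]
  have h3 : ∑ v ∈ Y, (1 - y v) = Y.card - ∑ v ∈ Y, y v := by
    rw [Finset.sum_sub_distrib]
    simp
  linarith

/-- The half-integral solution that belongs to two sets of vertices. -/
noncomputable def halfSolution (L R : VSet n) (v : Fin n) : ℝ :=
  (if L v = true then 1 / 2 else 0) + if R v = true then 1 / 2 else 0

/-- A König-type argument in the double cover: cutting at the free level `t` gives an independent
set, and matching edges cover everything outside it, so LP duality makes it optimal. -/
theorem halfSolution_optimum {G : SimpleGraph (Fin n)} (hA : Represents A G)
    {y : Mat n × (Fin n → ℕ) × VSet n} (hy : AuctionInv A T y) (hdone : AuctionDone T y) :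
    HalfIntegralLPOptimum G (toSet T) (halfSolution (highLeft y) (lowRight y)) := by
  obtain ⟨ht, hfree⟩ := freeLevel_spec y.2.1 hy.price_le
  set t := freeLevel y.2.1 with htdef
  have hR : ∀ r, lowRight y r = true ↔ y.2.1 r ≤ t := fun r => by
    rw [lowRight, natLe_iff (hy.price_le r), htdef]
  have hL : ∀ l, highLeft y l = true ↔ y.2.2 l = true ∨ ∃ r, y.1 l r = true ∧ t < y.2.1 r := by
    intro l
    rw [highLeft, Bool.or_eq_true, anyFin_iff]
    refine or_congr_right (exists_congr fun r => ?_)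
    rw [Bool.and_eq_true, Bool.not_eq_true', ← Bool.not_eq_true, natLe_iff (hy.price_le r), not_le]
  -- Giving up or `slack` yields price at least `t` at `v`; it exceeds `t` because no price equals
  -- `t`.
  have hLR : ∀ u v, T v = true → A u v = true → highLeft y u = true → lowRight y v = false := by
    intro u v hv huv hu
    rw [← Bool.not_eq_true, hR, not_le]
    rcases (hL u).1 hu with h | ⟨r, hM, hr⟩
    · exact lt_of_le_of_ne (ht.trans (hy.gaveUp u h v hv huv)) (hfree v).symm
    · have := hy.slack u r hM v hv huv
      exact lt_of_le_of_ne (by omega) (hfree v).symm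
  refine ⟨⟨fun v _ => ?_, fun u hu v hv huv => ?_⟩, fun v _ => ?_, fun z hz => ?_⟩
  · unfold halfSolution
    split_ifs <;> norm_num
  · have h1 := hLR u v (mem_toSet.1 hv) ((hA u v).2 huv)
    have h2 := hLR v u (mem_toSet.1 hu) ((hA v u).2 huv.symm)
    unfold halfSolution
    cases h3 : highLeft y u <;> cases h4 : highLeft y v <;> simp [h3, h4] at h1 h2 <;>
      cases h5 : lowRight y u <;> cases h6 : lowRight y v <;> simp [h5, h6] at h1 h2 ⊢ <;> norm_num
  · unfold halfSolution
    split_ifs <;> norm_num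
  -- Low left vertices are matched into low right ones, and high right vertices are owned by high
  -- left ones. Adding the two duality bounds gives 2∑z ≤ |L| + |R| on `T`.
  · have hmatch : ∀ l ∈ (toSet T).filter (fun v => ¬ highLeft y v = true), ∃ r, y.1 l r = true := by
      intro l hl
      rw [Finset.mem_filter, mem_toSet, hL, not_or] at hl
      exact (hdone l hl.1).resolve_left hl.2.1
    have hown : ∀ r ∈ (toSet T).filter (fun v => ¬ lowRight y v = true), ∃ l, y.1 l r = true := by
      intro r hr
      rw [Finset.mem_filter, hR, not_le] at hr
      exact hy.owned r (Nat.zero_lt_of_lt hr.2)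
    choose! φ hφ using hmatch
    choose! ψ hψ using hown
    have hedge : ∀ l r, y.1 l r = true → z l + z r ≤ 1 := fun l r h => by
      have := hy.edge l r h
      exact hz.2 l (mem_toSet.2 this.1) r (mem_toSet.2 this.2.1) ((hA l r).1 this.2.2)
    have h1 := sum_add_sum_le_card (X := (toSet T).filter fun v => ¬ highLeft y v = true)
      (Y := (toSet T).filter fun v => lowRight y v = true) (y := z) φ
      (fun l hl => by
        have hM := hφ l hl
        rw [Finset.mem_filter, hL, not_or] at hl
        rw [Finset.mem_filter, mem_toSet, hR]
        refine ⟨(hy.edge _ _ hM).2.1, ?_⟩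
        by_contra h
        exact hl.2.2 ⟨φ l, hM, not_le.1 h⟩)
      (fun l hl l' hl' h => hy.left_unique l l' (φ l) (hφ l hl) (h ▸ hφ l' hl'))
      (fun l hl => hedge _ _ (hφ l hl))
      (fun v hv => (hz.1 v (Finset.mem_filter.1 hv).1).2)
    have h2 := sum_add_sum_le_card (X := (toSet T).filter fun v => ¬ lowRight y v = true)
      (Y := (toSet T).filter fun v => highLeft y v = true) (y := z) ψ
      (fun r hr => by
        have hM := hψ r hr
        rw [Finset.mem_filter, hR, not_le] at hr
        rw [Finset.mem_filter, mem_toSet, hL]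
        exact ⟨(hy.edge _ _ hM).1, Or.inr ⟨r, hM, hr.2⟩⟩)
      (fun r hr r' hr' h => hy.right_unique (ψ r) r r' (hψ r hr) (h ▸ hψ r' hr'))
      (fun r hr => by
        rw [add_comm]
        exact hedge _ _ (hψ r hr))
      (fun v hv => (hz.1 v (Finset.mem_filter.1 hv).1).2)
    have h3 := Finset.sum_filter_add_sum_filter_not (toSet T) (fun v => highLeft y v = true) z
    have h4 := Finset.sum_filter_add_sum_filter_not (toSet T) (fun v => lowRight y v = true) z
    have h5 : ∑ v ∈ toSet T, halfSolution (highLeft y) (lowRight y) v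
        = (((toSet T).filter fun v => highLeft y v = true).card
          + ((toSet T).filter fun v => lowRight y v = true).card) / 2 := by
      unfold halfSolution
      rw [Finset.sum_add_distrib, ← Finset.sum_filter, ← Finset.sum_filter, Finset.sum_const,
        Finset.sum_const, nsmul_eq_mul, nsmul_eq_mul]
      ring
    rw [h5]
    linarith

theorem takeGreedy_outcome {G : SimpleGraph (Fin n)} (hA : Represents A G) (L R : VSet n)
    (hx : HalfIntegralLPOptimum G (toSet T) (halfSolution L R)) :
    LPGreedyOutcome G (toSet T) (toSet (takeGreedy A T L R)) := by
  classical
  obtain ⟨K, hK, hK'⟩ := iterate_greedyStep hA n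
    (fun v => T v && ((L v && !R v) || ((!L v) && R v))) (fun _ => false)
    ((Finset.card_le_univ _).trans_eq (Fintype.card_fin n))
  refine ⟨_, K, hx, ?_, ?_⟩
  · convert hK using 1
    ext v
    rw [Finset.mem_filter, mem_toSet, mem_toSet, halfSolution]
    cases T v <;> cases L v <;> cases R v <;> norm_num
  · ext v
    have h1 : ((greedyStep A)^[n] ((fun v => T v && ((L v && !R v) || ((!L v) && R v))),
        fun _ => false)).2 v = true ↔ v ∈ K := by
      rw [← mem_toSet, hK']
      simp
    rw [mem_toSet, takeGreedy, Bool.or_eq_true, h1, Finset.mem_union, Finset.mem_filter, mem_toSet,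
      halfSolution]
    cases T v <;> cases L v <;> cases R v <;> norm_num

theorem lpGreedy_outcome {G : SimpleGraph (Fin n)} (hA : Represents A G) (T : VSet n) :
    LPGreedyOutcome G (toSet T) (toSet (lpGreedy A T)) :=
  takeGreedy_outcome hA _ _ (halfSolution_optimum hA (auction_spec A T).1 (auction_spec A T).2)

end Auction

/-! ### Drawing the ordering -/

section Drawing

/-- A uniformly random entry of the list `a :: l`. -/
noncomputable def uniformEntry {α : Type*} (a : α) (l : List α) : PMF α :=
  (PMF.uniformOfFintype (Fin (l.length + 1))).map fun i => (a :: l).get i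

theorem uniformEntry_map {α β : Type*} (f : α → β) (a : α) (l : List α) :
    uniformEntry (f a) (l.map f) = (uniformEntry a l).map f := by
  -- The length occurs in the type of the random index, so it is first replaced by a variable.
  have h : ∀ (b : β) (l' : List β) (k : ℕ) (hk : l'.length = k), uniformEntry b l'
      = (PMF.uniformOfFintype (Fin (k + 1))).map fun i : Fin (k + 1) => (b :: l')[(i : ℕ)]'(by
        simpa [hk] using i.2) := by
    rintro b l' k rfl
    rfl
  rw [h _ _ l.length (by simp), uniformEntry, PMF.map_comp]
  congr 1
  funext i
  simp [← List.map_cons]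

theorem Data.toList_ofList (l : List Data) : (Data.ofList l).toList = l := by
  induction l with
  | nil => rfl
  | cons a l ih => exact congrArg _ ih

theorem Data.pick_enc {α : Type} [Enc α] (a : α) (l : List α) :
    (Enc.enc (a :: l)).pick = (uniformEntry a l).map Enc.enc := by
  rw [← uniformEntry_map]
  have h : (Enc.enc (a :: l)).pick
      = uniformEntry (Enc.enc a) (Data.ofList (l.map Enc.enc)).toList := rfl
  rw [h, Data.toList_ofList]

theorem uniformEntry_apply {α : Type*} {a d : α} {l : List α} (hd : d ∈ a :: l)
    (hnodup : (a :: l).Nodup) : uniformEntry a l d = ((l.length + 1 : ℕ) : ENNReal)⁻¹ := by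
  classical
  obtain ⟨i, rfl⟩ := List.mem_iff_get.1 hd
  rw [uniformEntry, PMF.map_apply, tsum_eq_single i]
  · simp [PMF.uniformOfFintype_apply]
  · intro j hj
    rw [if_neg fun h => hj (List.nodup_iff_injective_get.1 hnodup h).symm]

/-- Both masses are one, so a strict inequality anywhere is impossible. Lower bounds for point
probabilities thus determine a law. -/
theorem PMF.eq_of_le {α : Type*} {p q : PMF α} (h : ∀ a, p a ≤ q a) : p = q := by
  by_contra hne
  obtain ⟨a, ha⟩ : ∃ a, p a ≠ q a := by
    by_contra hall
    push Not at hall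
    exact hne (PMF.ext hall)
  have := ENNReal.tsum_lt_tsum (by rw [p.tsum_coe]; simp) h (lt_of_le_of_ne (h a) ha)
  rw [p.tsum_coe, q.tsum_coe] at this
  exact lt_irrefl _ this

variable {n : ℕ}

/-- The vertices of a set, in the random order in which they are drawn. -/
noncomputable def drawOrder : ℕ → VSet n → PMF (List (Fin n))
  | 0, _ => PMF.pure []
  | m + 1, s => listCases (setList s) (PMF.pure []) fun a l =>
      (uniformEntry a l).bind fun d =>
        (drawOrder m fun x => s x && !decide (x = d)).map (d :: ·)

theorem toSet_erase (s : VSet n) (d : Fin n) :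
    toSet (fun x => s x && !decide (x = d)) = (toSet s).erase d := by
  ext x
  simp [and_comm]

theorem length_setList (s : VSet n) : (setList s).length = (toSet s).card := by
  rw [← setList_toFinset, List.toFinset_card_of_nodup (nodup_setList s)]

/-- The prescribed head is drawn with probability 1/(m+1), and the tail is handled by induction. As
there are m! orderings, a lower bound suffices. -/
theorem le_drawOrder_apply : ∀ (m : ℕ) (s : VSet n) (L : List (Fin n)), (toSet s).card = m →
    L.Nodup → L.toFinset = toSet s → ((m.factorial : ℕ) : ENNReal)⁻¹ ≤ drawOrder m s L := by
  intro m
  induction m with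
  | zero =>
    intro s L hs _ hL
    rw [Finset.card_eq_zero.1 hs, List.toFinset_eq_empty_iff] at hL
    simp [hL, drawOrder]
  | succ m ih =>
    intro s L hs hnodup hL
    have hlen := length_setList s
    cases h : setList s with
    | nil => simp [h, hs] at hlen
    | cons a l =>
      cases L with
      | nil =>
        rw [← hL] at hs
        simp at hs
      | cons d L =>
        have hd : d ∈ toSet s := by
          rw [← hL]
          simp
        have hdl : d ∈ a :: l := h ▸ mem_setList.2 (mem_toSet.1 hd)
        rw [List.nodup_cons] at hnodup
        have h1 := ih (fun x => s x && !decide (x = d)) L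
          (by rw [toSet_erase, Finset.card_erase_of_mem hd, hs]; rfl) hnodup.2
          (by
            rw [toSet_erase, ← hL, List.toFinset_cons, Finset.erase_insert]
            simpa using hnodup.1)
        rw [drawOrder, h, listCases_cons, PMF.bind_apply]
        refine le_trans ?_ (ENNReal.le_tsum d)
        rw [uniformEntry_apply hdl (h ▸ nodup_setList s)]
        have h2 : l.length + 1 = m + 1 := by
          rw [← List.length_cons (a := a), ← h, hlen, hs]
        have h3 : ((drawOrder m fun x => s x && !decide (x = d)).map (d :: ·)) (d :: L)
            = drawOrder m (fun x => s x && !decide (x = d)) L := by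
          rw [PMF.map_apply, tsum_eq_single L]
          · simp
          · intro L' hL'
            rw [if_neg]
            simpa using hL'.symm
        rw [h2, h3, Nat.factorial_succ, Nat.cast_mul,
          ENNReal.mul_inv (Or.inr (by simp)) (Or.inl (by simp))]
        gcongr

/-- The vertices of `S` in the order `π`. -/
def orderList {S : Finset (Fin n)} (π : S ≃ Fin S.card) : List (Fin n) :=
  List.ofFn fun i => ((π.symm i : S) : Fin n)

theorem nodup_orderList {S : Finset (Fin n)} (π : S ≃ Fin S.card) : (orderList π).Nodup :=
  List.nodup_ofFn.2 (Subtype.val_injective.comp π.symm.injective)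

theorem mem_orderList {S : Finset (Fin n)} (π : S ≃ Fin S.card) {v : Fin n} :
    v ∈ orderList π ↔ v ∈ S := by
  rw [orderList, List.mem_ofFn]
  constructor
  · rintro ⟨i, rfl⟩
    exact (π.symm i).2
  · exact fun h => ⟨π ⟨v, h⟩, by simp⟩

theorem idxOf_orderList {S : Finset (Fin n)} (π : S ≃ Fin S.card) (v : S) :
    (orderList π).idxOf (v : Fin n) = π v := by
  have hlt : ((π v : Fin S.card) : ℕ) < (orderList π).length := by simp [orderList]
  have hget : (orderList π)[((π v : Fin S.card) : ℕ)] = (v : Fin n) := by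
    simp [orderList]
  rw [← hget]
  exact (nodup_orderList π).idxOf_getElem _ hlt

theorem orderList_injective {S : Finset (Fin n)} :
    Function.Injective (orderList : (S ≃ Fin S.card) → List (Fin n)) := by
  intro π π' h
  ext v
  rw [← idxOf_orderList, ← idxOf_orderList, h]

/-- The vertices are drawn in a uniformly random order. -/
theorem drawOrder_eq_uniform (s : VSet n) : drawOrder (toSet s).card s
    = (PMF.uniformOfFintype (toSet s ≃ Fin (toSet s).card)).map orderList := by
  classical
  refine (PMF.eq_of_le fun L => ?_).symm
  by_cases hL : ∃ π : toSet s ≃ Fin (toSet s).card, orderList π = L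
  · obtain ⟨π, rfl⟩ := hL
    refine le_trans (le_of_eq ?_) (le_drawOrder_apply _ s _ rfl (nodup_orderList π) (by
      ext v
      rw [List.mem_toFinset, mem_orderList]))
    rw [PMF.map_apply, tsum_eq_single π]
    · rw [if_pos rfl, PMF.uniformOfFintype_apply, Fintype.card_equiv (toSet s).equivFin,
        Fintype.card_coe]
    · intro π' hπ'
      rw [if_neg fun h => hπ' (orderList_injective h).symm]
  · rw [PMF.map_apply, ENNReal.tsum_eq_zero.2]
    · exact zero_le
    · exact fun π => if_neg fun h => hL ⟨π, h.symm⟩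

/-- When `v` is drawn, its row becomes the set of vertices no longer left, before `v` itself is
removed. Vertices not yet drawn have `idxOf` equal to the length, hence come after all drawn ones.
-/
theorem foldl_drawStep (S : VSet n) (y : DrawState n) (hy : y.2.1 = S)
    (hB : y.2.2.1 = fun _ _ => false) (hE : y.2.2.2.2.1 = S) (L : List (Fin n)) :
    L.Nodup → (L.foldl (fun y d => drawStep d y) y).2.2.2 = y.2.2.2 ∧
      (∀ u, (L.foldl (fun y d => drawStep d y) y).2.1 u = true ↔ S u = true ∧ u ∉ L) ∧
      ∀ v u, (L.foldl (fun y d => drawStep d y) y).2.2.1 v u = true ↔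
        v ∈ L ∧ S u = true ∧ L.idxOf u < L.idxOf v := by
  induction L using List.reverseRecOn with
  | nil => simp [hy, hB]
  | append_singleton L d ih =>
    intro hnodup
    rw [List.nodup_append_comm, List.singleton_append, List.nodup_cons] at hnodup
    obtain ⟨h1, h2, h3⟩ := ih hnodup.2
    rw [List.foldl_append, List.foldl_cons, List.foldl_nil]
    set z := L.foldl (fun y d => drawStep d y) y
    refine ⟨h1, fun u => ?_, fun v u => ?_⟩
    · simp only [drawStep, Bool.and_eq_true, h2 u, Bool.not_eq_true', decide_eq_false_iff_not,
        List.mem_append, List.mem_singleton, not_or, and_assoc]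
    · simp only [drawStep, decide_eq_true_eq, h1, hE]
      have hz : z.2.1 u = false ↔ ¬ (S u = true ∧ u ∉ L) := by
        rw [← h2 u, Bool.not_eq_true]
      by_cases hv : v = d
      · subst hv
        rw [if_pos rfl, Bool.and_eq_true, Bool.not_eq_true', hz,
          List.idxOf_append_of_notMem hnodup.1]
        by_cases hu : u ∈ L
        · have := List.idxOf_lt_length_of_mem hu
          rw [List.idxOf_append_of_mem hu]
          simp [hu]
          omega
        · rw [List.idxOf_append_of_notMem hu]
          simp [hu]
      · rw [if_neg hv, h3]
        by_cases hvL : v ∈ L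
        · have := List.idxOf_lt_length_of_mem hvL
          rw [List.idxOf_append_of_mem hvL]
          by_cases hu : u ∈ L
          · rw [List.idxOf_append_of_mem hu]
            simp [hvL]
          · have h4 := List.idxOf_eq_length hu
            rw [List.idxOf_append_of_notMem hu]
            simp [hvL]
            omega
        · simp [hvL, hv]

theorem layers_eq_firstLayers {A : Mat n} {G : SimpleGraph (Fin n)} (hA : Represents A G)
    (S : VSet n) (B : Mat n) (π : toSet S ≃ Fin (toSet S).card)
    (hB : ∀ v u, B v u = true ↔ v ∈ orderList π ∧ S u = true ∧
      (orderList π).idxOf u < (orderList π).idxOf v) :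
    toSet (layers A S B) = firstLayers 4 G (toSet S) π := by
  classical
  ext v
  rw [mem_toSet, layers, Bool.and_eq_true, natLe_iff (count_le _), count_eq_card, mem_firstLayers]
  rw [← mem_toSet, ← exists_prop]
  refine exists_congr fun hv => ?_
  have h : (Finset.univ.filter fun u : toSet S => G.Adj v u ∧ π u < π ⟨v, hv⟩).map
      (Function.Embedding.subtype _) = toSet fun u => S u && (A v u && B v u) := by
    ext u
    simp only [Finset.mem_map, Finset.mem_filter, Finset.mem_univ, true_and,
      Function.Embedding.subtype_apply, mem_toSet, Bool.and_eq_true, hA v u, hB v u]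
    constructor
    · rintro ⟨a, ha, rfl⟩
      refine ⟨mem_toSet.1 a.2, ha.1, (mem_orderList π).2 hv, mem_toSet.1 a.2, ?_⟩
      rw [idxOf_orderList π a, idxOf_orderList π ⟨v, hv⟩]
      exact ha.2
    · rintro ⟨hu, hadj, _, _, hlt⟩
      refine ⟨⟨u, mem_toSet.2 hu⟩, ⟨hadj, ?_⟩, rfl⟩
      rw [idxOf_orderList π ⟨u, mem_toSet.2 hu⟩, idxOf_orderList π ⟨v, hv⟩] at hlt
      exact hlt
  rw [← h, Finset.card_map, rankIn_closedNbhd]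
  exact (Nat.lt_succ_iff (n := 3)).symm

/-- The law of the output of the algorithm. -/
noncomputable def outputLaw (A : Mat n) : PMF (Finset (Fin n)) :=
  (drawOrder (toSet (initialState A).2.1).card (initialState A).2.1).map fun L =>
    toSet (finalSet (L.foldl (fun y d => drawStep d y) (initialState A)))

theorem outputLaw_spec {A : Mat n} {G : SimpleGraph (Fin n)} (hA : Represents A G) :
    EliminateThenPLG 4 G Finset.univ (outputLaw A) := by
  have huniv : toSet (fun _ : Fin n => true) = Finset.univ := by
    ext
    simp
  obtain ⟨A', G', S', K', hit, hlen, hA', hdeg, hμ⟩ := iterate_elimStep_spec n hA (fun _ => true) []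
    ((Finset.card_le_univ _).trans_eq (Fintype.card_fin n))
  rw [List.append_nil] at hit
  rw [huniv] at hμ
  have hinit : initialState A = (setList S', S', (fun _ _ => false), A', S', K') := by
    rw [initialState, hit]
  let final : (toSet S' ≃ Fin (toSet S').card) → DrawState n := fun π =>
    (orderList π).foldl (fun y d => drawStep d y) (initialState A)
  have hfinal : ∀ π, (final π).2.2.2 = (A', S', K') ∧
      ∀ v u, (final π).2.2.1 v u = true ↔
        v ∈ orderList π ∧ S' u = true ∧ (orderList π).idxOf u < (orderList π).idxOf v := by
    intro π
    obtain ⟨h1, _, h3⟩ := foldl_drawStep S' (initialState A) (by rw [hinit]) (by rw [hinit])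
      (by rw [hinit]) _ (nodup_orderList π)
    exact ⟨h1.trans (by rw [hinit]), h3⟩
  have hlaw : PLGLaw 4 G' (toSet S') ((PMF.uniformOfFintype (toSet S' ≃ Fin (toSet S').card)).map
      fun π => toSet (lpGreedy A' (layers A' S' (final π).2.2.1))) := by
    refine ⟨_, fun π => ?_, rfl⟩
    rw [← layers_eq_firstLayers hA' S' _ π (hfinal π).2]
    exact lpGreedy_outcome hA' _
  have h := hμ _ (.plg G' _ _ hdeg hlaw)
  rw [PMF.map_comp] at h
  convert h using 1
  rw [outputLaw, show (initialState A).2.1 = S' by rw [hinit], drawOrder_eq_uniform, PMF.map_comp]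
  congr 1
  funext π
  have hE := (hfinal π).1
  simp only [Function.comp_apply]
  rw [← iterate_unwindStep n K' _ hlen, finalSet]
  change toSet (unwindStep^[n] ((final π).2.2.2.2.2, lpGreedy (final π).2.2.2.1
    (layers (final π).2.2.2.1 (final π).2.2.2.2.1 (final π).2.2.1))).2 = _
  rw [hE]

end Drawing

/-! ### The program -/

section Program

theorem PMF.bind_congr_support {α β : Type*} {p : PMF α} {f g : α → PMF β}
    (h : ∀ a ∈ p.support, f a = g a) : p.bind f = p.bind g := by
  refine PMF.ext fun b => ?_
  rw [PMF.bind_apply, PMF.bind_apply]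
  refine tsum_congr fun a => ?_
  by_cases ha : a ∈ p.support
  · rw [h a ha]
  · rw [PMF.mem_support_iff, not_not] at ha
    rw [ha, zero_mul, zero_mul]

/-- From the configuration `c` the machine halts within `T` steps, and the final value of the
variable `0` has the law `ν`. -/
def HaltsLaw (c : Config) (T : ℕ) (ν : PMF Data) : Prop :=
  (∀ d ∈ (Config.run T c).support, d.1 = []) ∧ (Config.run T c).map (fun d => d.2 0) = ν

theorem Config.run_halted (T : ℕ) (σ : Store) : Config.run T ([], σ) = PMF.pure ([], σ) := by
  induction T with
  | zero => rfl
  | succ T ih => rw [Config.run_succ_of_step (c' := ([], σ)) rfl, ih]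

/-- Halted configurations are fixed by further steps. -/
theorem HaltsLaw.mono {c : Config} {T T' : ℕ} {ν : PMF Data} (h : HaltsLaw c T ν) (hT : T ≤ T') :
    HaltsLaw c T' ν := by
  obtain ⟨s, rfl⟩ := Nat.exists_eq_add_of_le hT
  have hrun : Config.run (T + s) c = Config.run T c := by
    rw [Config.run_add]
    refine (PMF.bind_congr_support fun d hd => ?_).trans (PMF.bind_pure _)
    obtain ⟨k, σ⟩ := d
    obtain rfl : k = [] := h.1 _ hd
    exact Config.run_halted s σ
  rwa [HaltsLaw, hrun]

theorem HaltsLaw.halted (σ : Store) : HaltsLaw ([], σ) 0 (PMF.pure (σ 0)) := by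
  constructor
  · intro d hd
    obtain rfl : d = ([], σ) := by simpa [Config.run] using hd
    rfl
  · rw [Config.run, PMF.pure_map]

theorem HaltsLaw.of_run {c c' : Config} {s T : ℕ} {ν : PMF Data}
    (hs : Config.run s c = PMF.pure c') (h : HaltsLaw c' T ν) : HaltsLaw c (s + T) ν := by
  rwa [HaltsLaw, Config.run_add, hs, PMF.pure_bind]

theorem HaltsLaw.step {c c' : Config} {T : ℕ} {ν : PMF Data} (hs : c.step = PMF.pure c')
    (h : HaltsLaw c' T ν) : HaltsLaw c (T + 1) ν := by
  rwa [HaltsLaw, Config.run_succ_of_step hs]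

theorem HaltsLaw.of_halts {c : Cmd} {k : List Cmd} {σ : Store} {S T : ℕ} {ν : PMF Data}
    (h : Halts c S σ fun σ' => HaltsLaw (k, σ') T ν) : HaltsLaw (c :: k, σ) (S + T) ν := by
  obtain ⟨t, ht, σ', he, hq⟩ := h
  exact (HaltsLaw.of_run (he k) hq).mono (by omega)

theorem HaltsLaw.choose {α : Type*} {i : ℕ} {e : Expr} {k : List Cmd} {σ : Store} {T : ℕ}
    {q : PMF α} {f : α → Data} {ν : α → PMF Data} (hq : (e.eval σ).pick = q.map f)
    (h : ∀ a ∈ q.support, HaltsLaw (k, Function.update σ i (f a)) T (ν a)) :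
    HaltsLaw (Cmd.choose i e :: k, σ) (T + 1) (q.bind ν) := by
  have hrun : Config.run (T + 1) (Cmd.choose i e :: k, σ)
      = q.bind fun a => Config.run T (k, Function.update σ i (f a)) := by
    rw [Config.run, Config.step, hq, PMF.map_comp, PMF.bind_map]
    rfl
  constructor
  · intro d hd
    rw [hrun, PMF.mem_support_bind_iff] at hd
    obtain ⟨a, ha, had⟩ := hd
    exact (h a ha).1 d had
  · rw [hrun, PMF.map_bind]
    exact PMF.bind_congr_support fun a ha => (h a ha).2

/-- Draw the vertices of the first component of the state one after the other, and process each of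
them by the command `c`. -/
def Cmd.drawLoop (c : Cmd) : Cmd :=
  .loop (.hd (.var 0)) (.seq (.choose 3 (.hd (.var 0)))
    (.seq (.assign 0 (.cons (.var 3) (.var 0))) c))

/-- The loop obeys the recursion that defines `drawOrder`; the induction is on the number of
vertices left, which also counts the rounds. -/
theorem drawLoop_haltsLaw {n : ℕ} {c d : Cmd} {S T : ℕ}
    (hc : ∀ (v : Fin n) (y : DrawState n),
      Maps c S n (Enc.enc (v, y)) (Enc.enc (drawStep v y)))
    (hd : ∀ y : DrawState n, Maps d T n (Enc.enc y) (Enc.enc (finalSet y))) (m : ℕ) :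
    ∀ (y : DrawState n) (σ : Store), y.1 = setList y.2.1 → (toSet y.2.1).card = m →
      σ 0 = Enc.enc y → σ 2 = unary n →
      HaltsLaw ([Cmd.drawLoop c, d], σ) (m * (S + 5) + (T + 1))
        ((drawOrder m y.2.1).map fun L =>
          Enc.enc (finalSet (L.foldl (fun y d => drawStep d y) y))) := by
  induction m with
  | zero =>
    intro y σ hy hm h0 h2
    have hnil : y.1 = [] := by
      rw [hy, ← List.length_eq_zero_iff, length_setList, hm]
    have heval : (Expr.hd (.var 0)).eval σ = Data.nil := by
      simp [Expr.eval, h0, Enc.enc, hnil, Data.ofList]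
    rw [drawOrder, PMF.pure_map, zero_mul, zero_add]
    refine HaltsLaw.step (Config.step_loop_nil heval)
      (HaltsLaw.of_halts (T := 0) (hd y σ _ h0 h2 fun σ' h0' _ _ => ?_))
    rw [List.foldl_nil, ← h0']
    exact HaltsLaw.halted σ'
  | succ m ih =>
    intro y σ hy hm h0 h2
    have hlen := length_setList y.2.1
    cases h : setList y.2.1 with
    | nil => simp [h, hm] at hlen
    | cons a l =>
      have hy1 : (Expr.hd (.var 0)).eval σ = Enc.enc (a :: l) := by
        rw [← h, ← hy]
        simp [Expr.eval, h0, Enc.enc]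
      rw [drawOrder, h, listCases_cons, PMF.map_bind]
      refine HaltsLaw.mono (T := (m * (S + 5) + (T + 1)) + (S + 2) + 1 + 1 + 1) ?_ (by
        rw [Nat.succ_mul]
        omega)
      refine HaltsLaw.step (Config.step_loop_cons (a := Enc.enc a) (b := Enc.enc l)
        (hy1.trans rfl)) ?_
      have hpick : ((Expr.hd (.var 0)).eval σ).pick = (uniformEntry a l).map Enc.enc := by
        rw [hy1, Data.pick_enc]
      have hnext : ∀ v ∈ a :: l, HaltsLaw
          ([.seq (.assign 0 (.cons (.var 3) (.var 0))) c, Cmd.drawLoop c, d],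
            Function.update σ 3 (Enc.enc v)) ((m * (S + 5) + (T + 1)) + (S + 2))
          (((drawOrder m fun x => y.2.1 x && !decide (x = v)).map (v :: ·)).map fun L =>
            Enc.enc (finalSet (L.foldl (fun y d => drawStep d y) y))) := by
        intro v hv
        have hvS : v ∈ toSet y.2.1 := mem_toSet.2 (mem_setList.1 (h ▸ hv))
        rw [add_comm]
        refine HaltsLaw.mono (T := (1 + S + 1) + (m * (S + 5) + (T + 1)))
          (HaltsLaw.of_halts (Halts.seq (Halts.assign ?_))) (by omega)
        refine hc v y _ _ ?_ ?_ fun σ' h0' _ h2' => ?_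
        · simp [Expr.eval, h0]
          rfl
        · simp [h2]
        · rw [PMF.map_comp]
          exact ih (drawStep v y) σ' rfl (by
            rw [drawStep, toSet_erase, Finset.card_erase_of_mem hvS, hm]
            rfl) h0' h2'
      refine HaltsLaw.step rfl (HaltsLaw.choose hpick fun v hv => ?_)
      refine hnext v ?_
      rw [uniformEntry, PMF.support_map] at hv
      obtain ⟨i, _, rfl⟩ := hv
      exact List.get_mem _ i

/-- Store the number of vertices in unary notation in the variable `2`. -/
def Cmd.prepare : Cmd :=
  .seq (.assign 3 (.var 0))
    (.loop (.var 3) (.seq (.assign 3 (.tl (.var 3))) (.assign 2 (.cons .nil (.var 2)))))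

theorem Cmd.prepare_halts {n : ℕ} (A : Mat n) (Q : Store → Prop)
    (hQ : ∀ σ : Store, σ 0 = Enc.enc A → σ 2 = unary n → Q σ) :
    Halts Cmd.prepare (4 * n + 3) (fun i => if i = 0 then Enc.enc A else Data.nil) Q := by
  have hloop : ∀ (l : List Data) (k : ℕ) (σ : Store), σ 0 = Enc.enc A → σ 2 = unary k →
      σ 3 = Data.ofList l → k + l.length = n →
      Halts (.loop (.var 3) (.seq (.assign 3 (.tl (.var 3))) (.assign 2 (.cons .nil (.var 2)))))
        (4 * l.length + 1) σ Q := by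
    intro l
    induction l with
    | nil =>
      rintro k σ h0 h2 h3 rfl
      exact Halts.loop_nil (by simp [Expr.eval, h3, Data.ofList]) (hQ σ h0 h2)
    | cons a l ih =>
      intro k σ h0 h2 h3 hk
      refine Halts.mono (Halts.loop_cons (a := a) (b := Data.ofList l)
        (by simp [Expr.eval, h3, Data.ofList]) (Halts.seq <| Halts.assign <| Halts.assign <|
          ih (k + 1) _ ?_ ?_ ?_ ?_)) (by rw [List.length_cons]; omega) fun _ => id
      · simp [h0]
      · simp [Expr.eval, h2, unary]
      · simp [Expr.eval, h3, Data.ofList]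
      · rw [← hk, List.length_cons]
        omega
  refine Halts.mono (Halts.seq <| Halts.assign <|
    hloop (List.ofFn fun i => Enc.enc (A i)) 0 _ ?_ ?_ ?_ ?_) ?_ fun _ => id
  · simp
  · simp [unary]
  · simp [Expr.eval]
    rfl
  · simp
  · rw [List.length_ofFn]
    omega

theorem encodeSet_toSet {n : ℕ} (s : VSet n) : encodeSet (toSet s) = Enc.enc s := by
  have h : ∀ i, decide (i ∈ toSet s) = s i := fun i => by
    rw [Bool.eq_iff_iff, decide_eq_true_iff, mem_toSet]
  simp only [encodeSet, h]
  rfl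

theorem exists_program : ∃ (P : Cmd) (p : Polynomial ℕ), ∀ (n : ℕ) (A : Mat n),
    P.HaltsWithLaw (Enc.enc A) (p.eval n) ((outputLaw A).map encodeSet) := by
  obtain ⟨ci, pi, hi⟩ := PolyTime.initialState
  obtain ⟨cd, pd, hd⟩ := PolyTime.drawStep
  obtain ⟨cf, pf, hf⟩ := PolyTime.finalSet
  refine ⟨.seq Cmd.prepare (.seq ci (.seq (Cmd.drawLoop cd) cf)),
    4 * Polynomial.X + pi + Polynomial.X * (pd + 5) + pf + 10, fun n A => ?_⟩
  have hlaw : (outputLaw A).map encodeSet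
      = (drawOrder (toSet (initialState A).2.1).card (initialState A).2.1).map fun L =>
        Enc.enc (finalSet (L.foldl (fun y d => drawStep d y) (initialState A))) := by
    rw [outputLaw, PMF.map_comp]
    congr 1
    funext L
    exact encodeSet_toSet _
  have hcard : (toSet (initialState A).2.1).card ≤ n :=
    (Finset.card_le_univ _).trans_eq (Fintype.card_fin n)
  have hmain : HaltsLaw (Cmd.start (.seq Cmd.prepare (.seq ci (.seq (Cmd.drawLoop cd) cf)))
      (Enc.enc A)) _ ((outputLaw A).map encodeSet) :=
    HaltsLaw.step rfl <| HaltsLaw.of_halts <| Cmd.prepare_halts A _ fun σ h0 h2 =>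
      HaltsLaw.step rfl <| HaltsLaw.of_halts <| hi n A σ _ h0 h2 fun σ' h0' _ h2' =>
      HaltsLaw.step rfl <| by
        rw [hlaw]
        exact drawLoop_haltsLaw (fun v y => hd n (v, y)) (hf n) _ (initialState A) σ' rfl rfl
          h0' h2'
  refine hmain.mono ?_
  -- The number of draws is the number of vertices surviving elimination, at most `n`.
  have := Nat.mul_le_mul_right (pd.eval n + 5) hcard
  simp only [Polynomial.eval_add, Polynomial.eval_mul, Polynomial.eval_X, Polynomial.eval_ofNat]
  omega

end Program

theorem mainTheorem7 :
    (∃ (P : Cmd) (p : Polynomial ℕ), ∀ (n : ℕ) (G : SimpleGraph (Fin n)),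
      ∃ μ : PMF (Finset (Fin n)),
        P.HaltsWithLaw (encodeGraph G) (p.eval n) (μ.map encodeSet) ∧
        EliminateThenPLG 4 G Finset.univ μ ∧
        HasCanonicalRecoverableValue (20 / 9) G μ) ∧
    (∀ (V : Type*) [Fintype V] [DecidableEq V] (G : SimpleGraph V) (μ : PMF (Finset V)),
      EliminateThenPLG 4 G Finset.univ μ → HasCanonicalRecoverableValue (20 / 9) G μ) := by
  classical
  refine ⟨?_, fun V _ _ G μ h => h.hasCanonicalRecoverableValue⟩
  obtain ⟨P, p, hP⟩ := exists_program
  refine ⟨P, p, fun n G => ?_⟩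
  -- The classical decision procedure is the one in `encodeGraph`, so `Enc.enc A` and `encodeGraph
  -- G` agree definitionally.
  let A : Mat n := fun i j => @decide (G.Adj i j) (Classical.propDecidable _)
  have hA : Represents A G := fun i j => by simp [A]
  exact ⟨outputLaw A, hP n A, outputLaw_spec hA,
    (outputLaw_spec hA).hasCanonicalRecoverableValue⟩
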